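/- **Setting.** All manifolds and maps are $C^\infty$. Let $\pi\colon E\to M$ be a surjective submersion (for instance a fibre bundle), $\dim M=m$, $\dim E=m+n$, $E$ Hausdorff, and let $\omega$ be a nowhere vanishing $m$-form on $M$. Let $J^1\pi\to E$ be the first jet bundle; its points over $y\in E$ are the linear maps $\sigma\colon T_{\pi(y)}M\to T_yE$ with $T_y\pi\circ\sigma=\mathrm{id}$, and $j^1\phi=(x\mapsto T_x\phi)$ for a section $\phi$ of $\pi$. Let $\mathcal M\pi=\Lambda^m_2T^*E\to E$ be the bundle of $m$-covectors on $E$ that vanish whenever two of their arguments are $\pi$-vertical, $\Theta$ its tautological $m$-form and $\Omega=-d\Theta$; let $J^1\pi^*=\mathcal M\pi/\pi^*\Lambda^mT^*M$ and let $\mu\colon\mathcal M\pi\to J^1\pi^*$ be the quotient map. Let $\pounds\in C^\infty(J^1\pi)$ be a Lagrangian function and let $\Theta_{\mathcal L}$ be the Poincaré–Cartan $m$-form on $J^1\pi$ of the Lagrangian density $\pounds\,\omega$; in natural coordinates $(x^\nu,y^A,v^A_\nu)$ with $\omega=d^mx$, $$\Theta_{\mathcal L}=\frac{\partial\pounds}{\partial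 v^A_\nu}\,dy^A\wedge d^{m-1}x_\nu-\Big(\frac{\partial\pounds}{\partial v^A_\nu}v^A_\nu-\pounds\Big)d^mx ,\qquad d^{m-1}x_\nu=i\Big(\frac{\partial}{\partial x^\nu}\Big)d^mx .$$ Put $\Omega_{\mathcal L}=-d\Theta_{\mathcal L}$. Let $\widetilde{\mathcal{FL}}\colon J^1\pi\to\mathcal M\pi$ be the extended Legendre map: for $\bar y\in J^1\pi$ over $y\in E$, $\widetilde{\mathcal{FL}}(\bar y)$ is the covector at $y$ whose pullback along the projection $J^1\pi\to E$ is $\Theta_{\mathcal L}$ at $\bar y$. Let $\mathcal{FL}=\mu\circ\widetilde{\mathcal{FL}}$. The Hamiltonian submanifold is $$\mathcal W_0=\{(\sigma,\alpha)\in J^1\pi\times_E\mathcal M\pi \;:\; \sigma^*\alpha=\pounds(\sigma)\,\omega\},$$ with projections $\rho_1^0\colon\mathcal W_0\to J^1\pi$, $\rho_2^0\colon\mathcal W_0\to\mathcal M\pi$, $\rho_E^0\colon\mathcal W_0\to E$ and $\rho_M^0\colon\mathcal W_0\to M$, and $\Omega_0=(\rho_2^0)^*\Omega$. **The three problems.**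 * A section $\psi_0$ of $\rho_M^0$ solves the *unified problem* if $\psi_0^*\,i(Y)\Omega_0=0$ for every vector field $Y$ on $\mathcal W_0$. * For a section $\phi$ of $\pi$, $j^1\phi$ solves the *Lagrangian problem* if $(j^1\phi)^*\,i(X)\Omega_{\mathcal L}=0$ for every vector field $X$ on $J^1\pi$. * For a section $\phi$ of $\pi$, $\psi=\mathcal{FL}\circ j^1\phi$ solves the *Hamiltonian problem* if $\psi$ is a smooth section of $J^1\pi^*\to M$ and: 1. (hyper-regular case) if $\mathcal{FL}$ is a diffeomorphism and $h=\widetilde{\mathcal{FL}}\circ\mathcal{FL}^{-1}$, then $\psi^*\,i(X)(h^*\Omega)=0$ for every vector field $X$ on $J^1\pi^*$; 2. (regular case) if $\mathcal{FL}$ restricts to a diffeomorphism $\Phi$ from an open set $U\subset J^1\pi$ onto an open subset of $J^1\pi^*$ and $h=\widetilde{\mathcal{FL}}\circ\Phi^{-1}$, then $\psi^*\,i(X)(h^*\Omega)=0$ at each $x\in M$ with $j^1\phi(x)\in U$, for every vector field $X$ on $J^1\pi^*$; 3. (almost-regular case) if $P=\mathcal{FL}(J^1\pi)$ is a closed embedded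 submanifold of $J^1\pi^*$, $\mathcal{FL}\colon J^1\pi\to P$ is a submersion and the fibres of $\mathcal{FL}$ are connected, and $h_P\colon P\to\mathcal M\pi$ is the map with $h_P\circ\mathcal{FL}=\widetilde{\mathcal{FL}}$, then $\psi$ is smooth as a map into $P$ and $\psi^*\,i(X)(h_P^*\Omega)=0$ for every vector field $X$ on $P$. **Theorem.** Let $\psi_0\colon M\to\mathcal W_0$ be a section of $\rho_M^0$ that solves the unified problem. Then $\phi=\rho^0_E\circ\psi_0$ is a section of $\pi$, $\rho_1^0\circ\psi_0=j^1\phi$ (so $\rho_1^0\circ\psi_0$ is holonomic) and $\rho_2^0\circ\psi_0=\widetilde{\mathcal{FL}}\circ j^1\phi$, that is, $\psi_0=(j^1\phi,\widetilde{\mathcal{FL}}\circ j^1\phi)$; moreover $j^1\phi$ solves the Lagrangian problem and $\mathcal{FL}\circ j^1\phi$ solves the Hamiltonian problem. Conversely, if $\phi$ is a section of $\pi$ such that $j^1\phi$ solves the Lagrangian problem, then $\mathcal{FL}\circ j^1\phi$ solves the Hamiltonian problem, and $\psi_0=(j^1\phi,\widetilde{\mathcal{FL}}\circ j^1\phi)$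 is a smooth section of $\mathcal W_0$ that solves the unified problem. -/

import Mathlib

open Set Function Manifold Topology
open scoped ContDiff

noncomputable section

namespace FieldTheory

/-- The Euclidean space `ℝᵏ`. -/
abbrev V (k : ℕ) : Type := EuclideanSpace ℝ (Fin k)

/-! ## Differential forms on manifolds

If `X` is a manifold modelled on the normed space `F` (without boundary), then the tangent space
`TangentSpace 𝓘(ℝ, F) x` is by definition a copy of `F`, and a `k`-form on `X` is a map assigning
to each point a continuous alternating `k`-linear map on that space. -/

section Forms

variable {F : Type*} [NormedAddCommGroup F] [NormedSpace ℝ F]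
  {X : Type*} [TopologicalSpace X] [ChartedSpace F X]
  {F' : Type*} [NormedAddCommGroup F'] [NormedSpace ℝ F']
  {Y : Type*} [TopologicalSpace Y] [ChartedSpace F' Y]

/-- A (not necessarily smooth) differential `k`-form on a manifold `X` modelled on `F`. -/
abbrev DForm (F : Type*) [NormedAddCommGroup F] [NormedSpace ℝ F]
    (X : Type*) [TopologicalSpace X] [ChartedSpace F X] (k : ℕ) : Type _ :=
  (x : X) → TangentSpace 𝓘(ℝ, F) x [⋀^Fin k]→L[ℝ] ℝ

/-- The local expression, on the target of the chart at `x₀`, of a differential form. -/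
def DForm.inChart {k : ℕ} (θ : DForm F X k) (x₀ : X) : F → F [⋀^Fin k]→L[ℝ] ℝ := fun z =>
  (θ ((chartAt F x₀).symm z)).compContinuousLinearMap
    (mfderiv 𝓘(ℝ, F) 𝓘(ℝ, F) (chartAt F x₀).symm z)

/-- A form is smooth if all its local expressions are. -/
def DForm.IsSmooth {k : ℕ} (θ : DForm F X k) : Prop :=
  ∀ x₀ : X, ContDiffOn ℝ ∞ (θ.inChart x₀) (chartAt F x₀).target

/-- The exterior derivative of a form, computed at `x` in the chart at `x`. -/
def DForm.d {k : ℕ} (θ : DForm F X k) : DForm F X (k + 1) := fun x =>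
  (extDeriv (θ.inChart x) (chartAt F x x)).compContinuousLinearMap
    (mfderiv 𝓘(ℝ, F) 𝓘(ℝ, F) (chartAt F x) x)

/-- The pullback of a form along a map. -/
def DForm.pullback {k : ℕ} (f : X → Y) (θ : DForm F' Y k) : DForm F X k := fun x =>
  (θ (f x)).compContinuousLinearMap (mfderiv 𝓘(ℝ, F) 𝓘(ℝ, F') f x)

/-- Smooth vector fields on a manifold. -/
def IsSmoothVectorField [IsManifold 𝓘(ℝ, F) ∞ X] (Z : (x : X) → TangentSpace 𝓘(ℝ, F) x) : Prop :=
  ContMDiff 𝓘(ℝ, F) 𝓘(ℝ, F).tangent ∞ (fun x => (⟨x, Z x⟩ : TangentBundle 𝓘(ℝ, F) X))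

/-- `(ψ^* i(Z) Ω)_x = 0` : the form `i(Z) Ω`, pulled back along `ψ : X → Y`, vanishes at `x`. -/
def ContractionVanishesAt {k : ℕ} (Ω : DForm F' Y (k + 1)) (Z : (y : Y) → TangentSpace 𝓘(ℝ, F') y)
    (ψ : X → Y) (x : X) : Prop :=
  ∀ u : Fin k → TangentSpace 𝓘(ℝ, F) x,
    Ω (ψ x) (Fin.cons (Z (ψ x)) (fun i => mfderiv 𝓘(ℝ, F) 𝓘(ℝ, F') ψ x (u i))) = 0

/-- The field equation `ψ^* i(Z) Ω = 0` for all smooth vector fields `Z` on `Y`, over `S ⊆ X`. -/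
def FieldEquationOn [IsManifold 𝓘(ℝ, F') ∞ Y] {k : ℕ} (Ω : DForm F' Y (k + 1)) (ψ : X → Y)
    (S : Set X) : Prop :=
  ∀ Z : (y : Y) → TangentSpace 𝓘(ℝ, F') y, IsSmoothVectorField Z →
    ∀ x ∈ S, ContractionVanishesAt (F := F) Ω Z ψ x

end Forms

/-! ## The configuration bundle, adapted charts and adapted frames -/

/-- The configuration bundle `π : E → M`, with `dim M = m` and `dim E = m + n`: a surjective smooth
submersion. (Locally trivial smooth bundles are a special case.) -/
structure ConfigurationBundle (m n : ℕ) (E M : Type*)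
    [TopologicalSpace E] [ChartedSpace (V (m + n)) E] [IsManifold 𝓘(ℝ, V (m + n)) ∞ E]
    [TopologicalSpace M] [ChartedSpace (V m) M] [IsManifold 𝓘(ℝ, V m) ∞ M] where
  /-- the projection `π` -/
  proj : E → M
  isSubmersion : IsSubmersion 𝓘(ℝ, V (m + n)) 𝓘(ℝ, V m) ∞ proj
  surjective : Surjective proj

section Bundle

variable {m n : ℕ} {E M : Type*}
  [TopologicalSpace E] [ChartedSpace (V (m + n)) E] [IsManifold 𝓘(ℝ, V (m + n)) ∞ E]
  [TopologicalSpace M] [ChartedSpace (V m) M] [IsManifold 𝓘(ℝ, V m) ∞ M]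

namespace ConfigurationBundle

variable (B : ConfigurationBundle m n E M)

/-- The tangent map `T_y π : T_y E → T_{π y} M`. -/
def T (y : E) : V (m + n) →L[ℝ] V m := mfderiv 𝓘(ℝ, V (m + n)) 𝓘(ℝ, V m) B.proj y

/-- The vertical tangent space `V_y π = ker T_y π`. -/
abbrev vert (y : E) : Submodule ℝ (V (m + n)) := LinearMap.ker (B.T y).toLinearMap

/-- Natural (adapted) coordinates `(x^ν, y^A)` of `E`: a smooth chart `c` with values in `ℝᵐ × ℝⁿ`
covering a smooth chart `c₀` of `M`. -/
structure AdaptedChart where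
  c : OpenPartialHomeomorph E (V m × V n)
  c₀ : OpenPartialHomeomorph M (V m)
  mapsTo : MapsTo B.proj c.source c₀.source
  fst_eq : ∀ y ∈ c.source, (c y).1 = c₀ (B.proj y)
  smooth : ContMDiffOn 𝓘(ℝ, V (m + n)) 𝓘(ℝ, V m × V n) ∞ c c.source
  smooth_symm : ContMDiffOn 𝓘(ℝ, V m × V n) 𝓘(ℝ, V (m + n)) ∞ c.symm c.target
  smooth₀ : ContMDiffOn 𝓘(ℝ, V m) 𝓘(ℝ, V m) ∞ c₀ c₀.source
  smooth₀_symm : ContMDiffOn 𝓘(ℝ, V m) 𝓘(ℝ, V m) ∞ c₀.symm c₀.target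

lemma exists_adaptedChart (y : E) : ∃ a : B.AdaptedChart, y ∈ a.c.source := by
  obtain ⟨F, _, _, hF⟩ := B.isSubmersion
  have h := hF y
  have e := h.equiv
  have hfd : FiniteDimensional ℝ (V m × F) := e.toLinearEquiv.finiteDimensional
  have hfF : FiniteDimensional ℝ F :=
    FiniteDimensional.of_surjective (LinearMap.snd ℝ (V m) F) LinearMap.snd_surjective
  have hdim : Module.finrank ℝ F = Module.finrank ℝ (V n) := by
    have h1 := e.toLinearEquiv.finrank_eq
    rw [Module.finrank_prod] at h1
    simp at h1 ⊢
    omega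
  let eF : F ≃L[ℝ] V n := ContinuousLinearEquiv.ofFinrankEq hdim
  let ee : V (m + n) ≃L[ℝ] V m × V n :=
    h.equiv.trans ((ContinuousLinearEquiv.refl ℝ (V m)).prodCongr eF)
  have hd := h.domChart_mem_maximalAtlas
  have hc := h.codChart_mem_maximalAtlas
  refine ⟨⟨h.domChart.transHomeomorph ee.toHomeomorph, h.codChart, ?_, ?_, ?_, ?_, ?_, ?_⟩, ?_⟩
  · exact h.mapsto_domChart_source_codChart_source
  · intro z hz
    have hz' : z ∈ h.domChart.source := hz
    have hzt : h.domChart z ∈ (h.domChart.extend 𝓘(ℝ, V (m + n))).target := by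
      simpa using h.domChart.map_source hz'
    have := h.writtenInCharts hzt
    simp [hz'] at this
    simpa [ee] using this.symm
  · exact (ee.contDiff.contMDiff).comp_contMDiffOn (contMDiffOn_of_mem_maximalAtlas hd)
  · refine (contMDiffOn_symm_of_mem_maximalAtlas hd).comp (ee.symm.contDiff.contMDiff.contMDiffOn) ?_
    intro z hz
    simpa using hz
  · exact contMDiffOn_of_mem_maximalAtlas hc
  · exact contMDiffOn_symm_of_mem_maximalAtlas hc
  · exact h.mem_domChart_source

/-- A chosen adapted chart around `y`. -/
def chartNear (y : E) : B.AdaptedChart := (B.exists_adaptedChart y).choose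

lemma mem_chartNear (y : E) : y ∈ (B.chartNear y).c.source := (B.exists_adaptedChart y).choose_spec

/-- An adapted frame at `y`: linear coordinates on `T_y E` and on `T_{π y} M` in which `T_y π` is
the projection `ℝᵐ × ℝⁿ → ℝᵐ`. -/
structure AdaptedFrame (y : E) where
  D : V (m + n) ≃L[ℝ] (V m × V n)
  D₀ : V m ≃L[ℝ] V m
  fst_D : ∀ v, (D v).1 = D₀ (B.T y v)

variable {B}

namespace AdaptedChart

variable (a : B.AdaptedChart)

lemma mdiff : a.c.MDifferentiable 𝓘(ℝ, V (m + n)) 𝓘(ℝ, V m × V n) :=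
  ⟨a.smooth.mdifferentiableOn (by simp), a.smooth_symm.mdifferentiableOn (by simp)⟩

lemma mdiff₀ : a.c₀.MDifferentiable 𝓘(ℝ, V m) 𝓘(ℝ, V m) :=
  ⟨a.smooth₀.mdifferentiableOn (by simp), a.smooth₀_symm.mdifferentiableOn (by simp)⟩

/-- The frame induced by an adapted chart: the differentials of `c` and `c₀`. -/
def frame {y : E} (hy : y ∈ a.c.source) : B.AdaptedFrame y where
  D := a.mdiff.mfderiv hy
  D₀ := a.mdiff₀.mfderiv (a.mapsTo hy)
  fst_D v := by
    have hπ : MDifferentiableAt 𝓘(ℝ, V (m + n)) 𝓘(ℝ, V m) B.proj y :=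
      (B.isSubmersion.contMDiff y).mdifferentiableAt (by simp)
    have h1 : HasMFDerivAt 𝓘(ℝ, V (m + n)) 𝓘(ℝ, V m) (fun z => a.c₀ (B.proj z)) y
        ((mfderiv 𝓘(ℝ, V m) 𝓘(ℝ, V m) a.c₀ (B.proj y)).comp
          (mfderiv 𝓘(ℝ, V (m + n)) 𝓘(ℝ, V m) B.proj y)) :=
      (a.mdiff₀.mdifferentiableAt (a.mapsTo hy)).hasMFDerivAt.comp y hπ.hasMFDerivAt
    have h2 : HasMFDerivAt 𝓘(ℝ, V (m + n)) 𝓘(ℝ, V m) (fun z => (a.c z).1) y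
        ((ContinuousLinearMap.fst ℝ (V m) (V n)).comp
          (mfderiv 𝓘(ℝ, V (m + n)) 𝓘(ℝ, V m × V n) a.c y)) :=
      HasMFDerivAt.comp y
        ((ContinuousLinearMap.fst ℝ (V m) (V n)).hasMFDerivAt (x := a.c y))
        (a.mdiff.mdifferentiableAt hy).hasMFDerivAt
    have h3 : (fun z => a.c₀ (B.proj z)) =ᶠ[𝓝 y] fun z => (a.c z).1 := by
      filter_upwards [a.c.open_source.mem_nhds hy] with z hz using (a.fst_eq z hz).symm
    have h4 := hasMFDerivAt_unique (h1.congr_of_eventuallyEq h3.symm) h2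
    exact (DFunLike.congr_fun h4 v).symm

end AdaptedChart

end ConfigurationBundle

/-! ## Bundles associated with adapted frames

Each of the bundles over `E` below has fibres which an adapted frame at `y` identifies with a fixed
normed space, the identifications for two frames differing by a smooth function of the transition
matrices. Adapted charts of `E` then induce charts of the total space. -/

open ConfigurationBundle in
/-- Fibres `S y` with typical fibre `F`, trivialised by adapted frames. -/
structure NaturalBundle (B : ConfigurationBundle m n E M) (S : E → Type)
    (F : Type) [NormedAddCommGroup F] [NormedSpace ℝ F] where
  triv : ∀ y, B.AdaptedFrame y → S y ≃ F
  /-- the action of a transition matrix and its inverse on the typical fibre -/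
  act : ((V m × V n) →L[ℝ] (V m × V n)) → ((V m × V n) →L[ℝ] (V m × V n)) → F → F
  act_smooth : ContDiff ℝ ∞ (fun p : ((V m × V n) →L[ℝ] (V m × V n)) ×
    ((V m × V n) →L[ℝ] (V m × V n)) × F => act p.1 p.2.1 p.2.2)
  compat : ∀ y (a b : B.AdaptedFrame y) (f : F), triv y b ((triv y a).symm f) =
    act (b.D.toContinuousLinearMap.comp a.D.symm.toContinuousLinearMap)
      (a.D.toContinuousLinearMap.comp b.D.symm.toContinuousLinearMap) f

namespace NaturalBundle

variable {B : ConfigurationBundle m n E M} {S : E → Type}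
  {F : Type} [NormedAddCommGroup F] [NormedSpace ℝ F] (N : NaturalBundle B S F)

/-- The total space of the bundle, with its projection `base` onto `E`. -/
@[ext]
structure Total (N : NaturalBundle B S F) where
  base : E
  fib : S base

open Classical in
/-- The coordinates `(x^ν, y^A, f)` on the total space induced by the adapted chart around `e`. -/
def coord (e : E) (p : N.Total) : (V m × V n) × F :=
  ((B.chartNear e).c p.base,
    if h : p.base ∈ (B.chartNear e).c.source then N.triv p.base ((B.chartNear e).frame h) p.fib
    else 0)

open Classical in
/-- The point of the total space with given coordinates. -/
def ofCoord (e : E) (z : (V m × V n) × F) : N.Total :=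
  if h : z.1 ∈ (B.chartNear e).c.target then
    ⟨(B.chartNear e).c.symm z.1,
      (N.triv _ ((B.chartNear e).frame ((B.chartNear e).c.map_target h))).symm z.2⟩
  else ⟨e, (N.triv e ((B.chartNear e).frame (B.mem_chartNear e))).symm z.2⟩

lemma coord_of_mem {e : E} {p : N.Total} (h : p.base ∈ (B.chartNear e).c.source) :
    N.coord e p = ((B.chartNear e).c p.base, N.triv p.base ((B.chartNear e).frame h) p.fib) := by
  simp [coord, h]

lemma ofCoord_of_mem {e : E} {z : (V m × V n) × F} (h : z.1 ∈ (B.chartNear e).c.target) :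
    N.ofCoord e z = ⟨(B.chartNear e).c.symm z.1,
      (N.triv _ ((B.chartNear e).frame ((B.chartNear e).c.map_target h))).symm z.2⟩ := by
  simp [ofCoord, h]

/-- The chart of the total space induced by the chosen adapted chart around `e`. -/
def chart (e : E) : PartialEquiv N.Total ((V m × V n) × F) where
  toFun := N.coord e
  invFun := N.ofCoord e
  source := {p | p.base ∈ (B.chartNear e).c.source}
  target := {z | z.1 ∈ (B.chartNear e).c.target}
  map_source' p hp := (B.chartNear e).c.map_source hp
  map_target' z hz := by
    rw [N.ofCoord_of_mem hz]
    exact (B.chartNear e).c.map_target hz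
  left_inv' p hp := by
    obtain ⟨y, s⟩ := p
    have hy : y ∈ (B.chartNear e).c.source := hp
    rw [N.coord_of_mem hp, N.ofCoord_of_mem ((B.chartNear e).c.map_source hy)]
    have key : ∀ (y' : E) (h' : y' ∈ (B.chartNear e).c.source), y' = y →
        (⟨y', (N.triv y' ((B.chartNear e).frame h')).symm
          (N.triv y ((B.chartNear e).frame hy) s)⟩ : N.Total) = ⟨y, s⟩ := by
      rintro y' h' rfl
      simp
    exact key _ _ ((B.chartNear e).c.left_inv hy)
  right_inv' z hz := by
    have hz' : z.1 ∈ (B.chartNear e).c.target := hz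
    have h := (B.chartNear e).c.map_target hz'
    rw [N.ofCoord_of_mem hz', N.coord_of_mem h]
    simp [hz']

/-- The change of adapted coordinates from the chart at `e` to the chart at `e'`. -/
def transition (B : ConfigurationBundle m n E M) (e e' : E) : V m × V n → V m × V n :=
  (B.chartNear e').c ∘ (B.chartNear e).c.symm

lemma contDiffOn_transition (e e' : E) : ContDiffOn ℝ ∞ (transition B e e')
    ((B.chartNear e).c.symm.trans (B.chartNear e').c).source := by
  rw [← contMDiffOn_iff_contDiffOn]
  refine (B.chartNear e').smooth.comp ((B.chartNear e).smooth_symm.mono ?_) ?_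
  · intro z hz
    exact hz.1
  · intro z hz
    exact hz.2

lemma fderiv_transition (e e' : E) {y : E} (hy : y ∈ (B.chartNear e).c.source)
    (hy' : y ∈ (B.chartNear e').c.source) :
    fderiv ℝ (transition B e e') ((B.chartNear e).c y) =
      (((B.chartNear e').frame hy').D.toContinuousLinearMap).comp
        ((B.chartNear e).frame hy).D.symm.toContinuousLinearMap := by
  rw [← mfderiv_eq_fderiv]
  have hl := (B.chartNear e).c.left_inv hy
  have h1 := (B.chartNear e).mdiff.mdifferentiableAt_symm ((B.chartNear e).c.map_source hy)
  have h2 : MDifferentiableAt 𝓘(ℝ, V (m + n)) 𝓘(ℝ, V m × V n) (B.chartNear e').c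
      ((B.chartNear e).c.symm ((B.chartNear e).c y)) := by
    rw [hl]; exact (B.chartNear e').mdiff.mdifferentiableAt hy'
  have h3 := mfderiv_comp ((B.chartNear e).c y) h2 h1
  rw [hl] at h3
  exact h3

lemma chart_trans_source (e e' : E) : ((N.chart e).symm.trans (N.chart e')).source =
    ((B.chartNear e).c.symm.trans (B.chartNear e').c).source ×ˢ univ := by
  ext ⟨z, f⟩
  simp only [PartialEquiv.trans_source, PartialEquiv.symm_source, mem_inter_iff, mem_preimage,
    mem_prod, mem_univ, and_true, OpenPartialHomeomorph.trans_source,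
    OpenPartialHomeomorph.symm_source]
  refine and_congr_right fun hz => ?_
  have hz' : z ∈ (B.chartNear e).c.target := hz
  change (N.ofCoord e (z, f)).base ∈ (B.chartNear e').c.source ↔ _
  rw [N.ofCoord_of_mem hz']

lemma chart_trans_apply (e e' : E) {z : (V m × V n) × F}
    (hz : z ∈ ((N.chart e).symm.trans (N.chart e')).source) :
    ((N.chart e).symm.trans (N.chart e')) z = (transition B e e' z.1,
      N.act (fderiv ℝ (transition B e e') z.1)
        (fderiv ℝ (transition B e' e) (transition B e e' z.1)) z.2) := by
  rw [chart_trans_source] at hz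
  obtain ⟨⟨h1, h2⟩, -⟩ := hz
  have h1' : z.1 ∈ (B.chartNear e).c.target := h1
  have h2' : (B.chartNear e).c.symm z.1 ∈ (B.chartNear e').c.source := h2
  have h3 := (B.chartNear e).c.map_target h1'
  have hr := (B.chartNear e).c.right_inv h1'
  have e1 := fderiv_transition e e' h3 h2'
  have e2 := fderiv_transition e' e h2' h3
  rw [hr] at e1
  have e3 : transition B e e' z.1 = (B.chartNear e').c ((B.chartNear e).c.symm z.1) := rfl
  rw [e3, e1, e2, ← N.compat]
  change N.coord e' (N.ofCoord e z) = _
  rw [N.ofCoord_of_mem h1', N.coord_of_mem h2']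

lemma contDiffOn_chart_trans (e e' : E) :
    ContDiffOn ℝ ∞ ((N.chart e).symm.trans (N.chart e'))
      ((N.chart e).symm.trans (N.chart e')).source := by
  have hs := N.chart_trans_source e e'
  have ho := ((B.chartNear e).c.symm.trans (B.chartNear e').c).open_source
  have ho' := ((B.chartNear e').c.symm.trans (B.chartNear e).c).open_source
  have hfst : ContDiffOn ℝ ∞ (Prod.fst : (V m × V n) × F → V m × V n)
      ((N.chart e).symm.trans (N.chart e')).source := contDiff_fst.contDiffOn
  have hm : MapsTo Prod.fst ((N.chart e).symm.trans (N.chart e')).source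
      ((B.chartNear e).c.symm.trans (B.chartNear e').c).source := by
    rw [hs]; exact fun z hz => hz.1
  have hτ := contDiffOn_transition (B := B) e e'
  have hmτ : MapsTo (transition B e e') ((B.chartNear e).c.symm.trans (B.chartNear e').c).source
      ((B.chartNear e').c.symm.trans (B.chartNear e).c).source := by
    intro z hz
    refine ⟨(B.chartNear e').c.map_source hz.2, ?_⟩
    change (B.chartNear e').c.symm ((B.chartNear e').c ((B.chartNear e).c.symm z)) ∈
      (B.chartNear e).c.source
    have hz2 : (B.chartNear e).c.symm z ∈ (B.chartNear e').c.source := hz.2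
    rw [(B.chartNear e').c.left_inv hz2]
    exact (B.chartNear e).c.map_target hz.1
  have h1 : ContDiffOn ℝ ∞ (fderiv ℝ (transition B e e'))
      ((B.chartNear e).c.symm.trans (B.chartNear e').c).source :=
    hτ.fderiv_of_isOpen ho (by simp)
  have h2 : ContDiffOn ℝ ∞ (fderiv ℝ (transition B e' e))
      ((B.chartNear e').c.symm.trans (B.chartNear e).c).source :=
    (contDiffOn_transition e' e).fderiv_of_isOpen ho' (by simp)
  refine ContDiffOn.congr ?_ (fun z hz => N.chart_trans_apply e e' hz)
  refine (hτ.comp hfst hm).prodMk ?_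
  exact N.act_smooth.comp_contDiffOn ((h1.comp hfst hm).prodMk
    (((h2.comp hτ hmτ).comp hfst hm).prodMk contDiff_snd.contDiffOn))

/-- The charts of the total space, before it has a topology. -/
def core : ChartedSpaceCore ((V m × V n) × F) N.Total where
  atlas := range N.chart
  chartAt p := N.chart p.base
  mem_chart_source p := B.mem_chartNear p.base
  chart_mem_atlas p := mem_range_self _
  open_source := by
    rintro _ _ ⟨e, rfl⟩ ⟨e', rfl⟩
    rw [chart_trans_source]
    exact ((B.chartNear e).c.symm.trans (B.chartNear e').c).open_source.prod isOpen_univ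
  continuousOn_toFun := by
    rintro _ _ ⟨e, rfl⟩ ⟨e', rfl⟩
    exact (N.contDiffOn_chart_trans e e').continuousOn

instance : TopologicalSpace N.Total := N.core.toTopologicalSpace

instance : ChartedSpace ((V m × V n) × F) N.Total := N.core.toChartedSpace

instance : IsManifold 𝓘(ℝ, (V m × V n) × F) ∞ N.Total := by
  apply isManifold_of_contDiffOn
  intro c c' hc hc'
  change c ∈ ⋃ (e : PartialEquiv N.Total _) (he : e ∈ N.core.atlas), _ at hc
  change c' ∈ ⋃ (e : PartialEquiv N.Total _) (he : e ∈ N.core.atlas), _ at hc'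
  simp only [mem_iUnion, mem_singleton_iff] at hc hc'
  obtain ⟨_, ⟨e, rfl⟩, rfl⟩ := hc
  obtain ⟨_, ⟨e', rfl⟩, rfl⟩ := hc'
  have := N.contDiffOn_chart_trans e e'
  simp only [modelWithCornersSelf_coe, modelWithCornersSelf_coe_symm, range_id, inter_univ,
    Function.id_comp, Function.comp_id, preimage_id]
  exact this

/-- The fibre product over `E` of two bundles. -/
def prod {S' : E → Type} {F' : Type} [NormedAddCommGroup F'] [NormedSpace ℝ F']
    (N : NaturalBundle B S F) (N' : NaturalBundle B S' F') :
    NaturalBundle B (fun y => S y × S' y) (F × F') where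
  triv y a := (N.triv y a).prodCongr (N'.triv y a)
  act A A' f := (N.act A A' f.1, N'.act A A' f.2)
  act_smooth := by
    refine ContDiff.prodMk ?_ ?_
    · exact N.act_smooth.comp (contDiff_fst.prodMk
        ((contDiff_fst.comp contDiff_snd).prodMk (contDiff_fst.comp (contDiff_snd.comp contDiff_snd))))
    · exact N'.act_smooth.comp (contDiff_fst.prodMk
        ((contDiff_fst.comp contDiff_snd).prodMk (contDiff_snd.comp (contDiff_snd.comp contDiff_snd))))
  compat y a b f := by
    exact Prod.ext (N.compat y a b f.1) (N'.compat y a b f.2)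

/-- Transport of the structure along fibrewise bijections. -/
def congr {S' : E → Type} (N : NaturalBundle B S F) (φ : ∀ y, S' y ≃ S y) :
    NaturalBundle B S' F where
  triv y a := (φ y).trans (N.triv y a)
  act := N.act
  act_smooth := N.act_smooth
  compat y a b f := by simp [N.compat]

end NaturalBundle

end Bundle

/-! ## Linear algebra of multimomenta -/

section Multimomenta

variable {W : Type*} [NormedAddCommGroup W] [NormedSpace ℝ W]
  {W' : Type*} [NormedAddCommGroup W'] [NormedSpace ℝ W'] {k : ℕ}

/-- `Λᵏ₂` : the `k`-covectors on `W` that vanish when two of their arguments lie in `K`. -/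
def twoVertical (k : ℕ) (K : Submodule ℝ W) : Submodule ℝ (W [⋀^Fin k]→L[ℝ] ℝ) where
  carrier := {α | ∀ v : Fin k → W, ∀ i j, i ≠ j → v i ∈ K → v j ∈ K → α v = 0}
  add_mem' ha hb v i j hij hi hj := by
    simp [ha v i j hij hi hj, hb v i j hij hi hj]
  zero_mem' v i j hij hi hj := rfl
  smul_mem' c a ha v i j hij hi hj := by
    simp [ha v i j hij hi hj]

/-- Transport of `Λᵏ₂` along a linear isomorphism `D` compatible with the projections `T`, `T₁`. -/
def twoVerticalCongr (k : ℕ) {W₁ W₁' : Type*} [NormedAddCommGroup W₁] [NormedSpace ℝ W₁]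
    [NormedAddCommGroup W₁'] [NormedSpace ℝ W₁'] (T : W →L[ℝ] W') (T₁ : W₁ →L[ℝ] W₁')
    (D : W ≃L[ℝ] W₁) (D₀ : W' ≃L[ℝ] W₁') (h : ∀ v, T₁ (D v) = D₀ (T v)) :
    twoVertical k (LinearMap.ker T.toLinearMap) ≃ twoVertical k (LinearMap.ker T₁.toLinearMap) where
  toFun α := ⟨α.1.compContinuousLinearMap D.symm.toContinuousLinearMap, by
    intro v i j hij hi hj
    have key : ∀ w, T₁ w = 0 → T (D.symm w) = 0 := fun w hw => by
      have := h (D.symm w)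
      rw [D.apply_symm_apply, hw] at this
      exact (map_eq_zero_iff D₀ D₀.injective).1 this.symm
    exact α.2 _ i j hij (key _ hi) (key _ hj)⟩
  invFun α := ⟨α.1.compContinuousLinearMap D.toContinuousLinearMap, by
    intro v i j hij hi hj
    have key : ∀ w, T w = 0 → T₁ (D w) = 0 := fun w hw => by rw [h, hw, map_zero]
    exact α.2 _ i j hij (key _ hi) (key _ hj)⟩
  left_inv a := by
    apply Subtype.ext; ext v
    simp [Function.comp_def]
  right_inv a := by
    apply Subtype.ext; ext v
    simp [Function.comp_def]

/-- Equality in `Λᵏ₂ / π*Λᵏ` : two covectors are equivalent if their difference is pulled back along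
`T : W → W'`. -/
def modPulledBack (k : ℕ) (T : W →L[ℝ] W') :
    Setoid (twoVertical k (LinearMap.ker T.toLinearMap)) where
  r α α' := ∃ β : W' [⋀^Fin k]→L[ℝ] ℝ, α.1 - α'.1 = β.compContinuousLinearMap T
  iseqv :=
    { refl := fun α => ⟨0, by ext v; simp⟩
      symm := by
        rintro α α' ⟨β, hβ⟩
        refine ⟨-β, ?_⟩
        rw [← neg_sub, hβ]
        ext v; simp
      trans := by
        rintro α α' α'' ⟨β, hβ⟩ ⟨γ, hγ⟩
        refine ⟨β + γ, ?_⟩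
        rw [← sub_add_sub_cancel _ α'.1, hβ, hγ]
        ext v; simp }

lemma finiteDimensional_covectors (W : Type*) [NormedAddCommGroup W] [NormedSpace ℝ W] (k : ℕ)
    [FiniteDimensional ℝ W] :
    FiniteDimensional ℝ (W [⋀^Fin k]→L[ℝ] ℝ) := by
  let f : (W [⋀^Fin k]→L[ℝ] ℝ) →ₗ[ℝ] MultilinearMap ℝ (fun _ : Fin k => W) ℝ :=
    { toFun := fun α => α.1.1
      map_add' := fun _ _ => rfl
      map_smul' := fun _ _ => rfl }
  refine FiniteDimensional.of_injective f ?_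
  intro a b hab
  ext v
  exact DFunLike.congr_fun hab v

lemma exists_projection [FiniteDimensional ℝ W] (K : Submodule ℝ (W [⋀^Fin k]→L[ℝ] ℝ)) :
    ∃ P : (W [⋀^Fin k]→L[ℝ] ℝ) →L[ℝ] K, ∀ α : K, P α = α := by
  have := finiteDimensional_covectors W k
  exact Submodule.ClosedComplemented.of_finiteDimensional K

lemma contDiff_pullback (W : Type*) [NormedAddCommGroup W] [NormedSpace ℝ W]
    [FiniteDimensional ℝ W] (k : ℕ) :
    ContDiff ℝ ∞ (fun p : (W [⋀^Fin k]→L[ℝ] ℝ) × (W →L[ℝ] W) =>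
      p.1.compContinuousLinearMap p.2) := by
  have := finiteDimensional_covectors W k
  let ι : (W [⋀^Fin k]→L[ℝ] ℝ) →L[ℝ] ContinuousMultilinearMap ℝ (fun _ : Fin k => W) ℝ :=
    ContinuousAlternatingMap.toContinuousMultilinearMapCLM ℝ
  have hι : Injective ι := ContinuousAlternatingMap.toContinuousMultilinearMap_injective
  have : FiniteDimensional ℝ (ContinuousMultilinearMap ℝ (fun _ : Fin k => W) ℝ) :=
    FiniteDimensional.of_injective
      ({ toFun := fun α => α.1, map_add' := fun _ _ => rfl, map_smul' := fun _ _ => rfl } :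
        ContinuousMultilinearMap ℝ (fun _ : Fin k => W) ℝ →ₗ[ℝ]
          MultilinearMap ℝ (fun _ : Fin k => W) ℝ)
      ContinuousMultilinearMap.toMultilinearMap_injective
  obtain ⟨r, hr⟩ := LinearMap.exists_leftInverse_of_injective ι.toLinearMap
    (LinearMap.ker_eq_bot.2 hι)
  have h1 : ContDiff ℝ ∞ (fun p : (W [⋀^Fin k]→L[ℝ] ℝ) × (W →L[ℝ] W) =>
      (ContinuousMultilinearMap.compContinuousLinearMapContinuousMultilinear ℝ
        (fun _ : Fin k => W) (fun _ => W) ℝ (fun _ => p.2)) (ι p.1)) :=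
    ((ContinuousMultilinearMap.contDiff _).comp (contDiff_pi.2 fun _ => contDiff_snd)).clm_apply
      (ι.contDiff.comp contDiff_fst)
  have h2 := (LinearMap.toContinuousLinearMap r).contDiff (n := ∞) |>.comp h1
  have h3 : (fun p : (W [⋀^Fin k]→L[ℝ] ℝ) × (W →L[ℝ] W) => p.1.compContinuousLinearMap p.2) =
      LinearMap.toContinuousLinearMap r ∘ fun p : (W [⋀^Fin k]→L[ℝ] ℝ) × (W →L[ℝ] W) =>
      (ContinuousMultilinearMap.compContinuousLinearMapContinuousMultilinear ℝ
        (fun _ : Fin k => W) (fun _ => W) ℝ (fun _ => p.2)) (ι p.1) := by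
    funext p
    exact (DFunLike.congr_fun hr (p.1.compContinuousLinearMap p.2)).symm
  rw [h3]
  exact h2

end Multimomenta

section Bundle

variable {m n : ℕ} {E M : Type*}
  [TopologicalSpace E] [ChartedSpace (V (m + n)) E] [IsManifold 𝓘(ℝ, V (m + n)) ∞ E]
  [TopologicalSpace M] [ChartedSpace (V m) M] [IsManifold 𝓘(ℝ, V m) ∞ M]
  (B : ConfigurationBundle m n E M)

namespace ConfigurationBundle

/-! ## The first jet bundle -/

/-- The fibre of `J¹π` over `y` : the values at `π y` of the differentials of local sections through
`y`, i.e. the linear right inverses of `T_y π`. -/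
abbrev JetFibre (y : E) : Type :=
  {σ : V m →L[ℝ] V (m + n) // (B.T y).comp σ = ContinuousLinearMap.id ℝ (V m)}

/-- The first jet bundle, with fibre coordinates `v^A_ν`. -/
def jetBundle : NaturalBundle B B.JetFibre (V m →L[ℝ] V n) where
  triv y a :=
    { toFun := fun σ => (ContinuousLinearMap.snd ℝ (V m) (V n)).comp
        (a.D.toContinuousLinearMap.comp (σ.1.comp a.D₀.symm.toContinuousLinearMap))
      invFun := fun v => ⟨a.D.symm.toContinuousLinearMap.comp
        (((ContinuousLinearMap.id ℝ (V m)).prod v).comp a.D₀.toContinuousLinearMap), by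
          ext1 w
          apply a.D₀.injective
          simp [← a.fst_D]⟩
      left_inv := by
        intro σ
        apply Subtype.ext
        ext1 w
        apply a.D.injective
        have h : B.T y (σ.1 w) = w := DFunLike.congr_fun σ.2 w
        apply Prod.ext
        · simp [a.fst_D, h]
        · simp
      right_inv := by
        intro v
        ext1 w
        simp }
  act A A' v := (ContinuousLinearMap.snd ℝ (V m) (V n)).comp (A.comp
    ((ContinuousLinearMap.inl ℝ (V m) (V n) + (ContinuousLinearMap.inr ℝ (V m) (V n)).comp v).comp
      ((ContinuousLinearMap.fst ℝ (V m) (V n)).comp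
        (A'.comp (ContinuousLinearMap.inl ℝ (V m) (V n))))))
  act_smooth := by
    have hA := contDiff_fst (𝕜 := ℝ) (n := ∞) (E := (V m × V n) →L[ℝ] (V m × V n))
      (F := ((V m × V n) →L[ℝ] (V m × V n)) × (V m →L[ℝ] V n))
    have hs := contDiff_snd (𝕜 := ℝ) (n := ∞) (E := (V m × V n) →L[ℝ] (V m × V n))
      (F := ((V m × V n) →L[ℝ] (V m × V n)) × (V m →L[ℝ] V n))
    have hA' := hs.fst
    have hv := hs.snd
    exact contDiff_const.clm_comp (hA.clm_comp ((contDiff_const.add (contDiff_const.clm_comp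
      hv)).clm_comp (contDiff_const.clm_comp (hA'.clm_comp contDiff_const))))
  compat y a b v := by
    ext1 w
    have h : (a.D (b.D.symm (w, 0))).1 = a.D₀ (b.D₀.symm w) := by
      rw [a.fst_D]
      congr 1
      apply b.D₀.injective
      simp [← b.fst_D]
    have h' : (b.D (a.D.symm (a.D₀ (b.D₀.symm w), v (a.D₀ (b.D₀.symm w))))).2 =
        (b.D (a.D.symm (a.D₀ (b.D₀.symm w), 0))).2 +
          (b.D (a.D.symm (0, v (a.D₀ (b.D₀.symm w))))).2 := by
      rw [← Prod.snd_add, ← map_add, ← map_add]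
      simp
    simp [h, h']

/-- `J¹π`. -/
abbrev J1 : Type _ := B.jetBundle.Total

/-! ## Multimomentum bundles -/

/-- The fibre of `Mπ = Λᵐ₂ T*E` : the `m`-covectors on `T_y E` that vanish by the action of two
vertical vectors. -/
abbrev MomentumFibre (y : E) : Submodule ℝ (V (m + n) [⋀^Fin m]→L[ℝ] ℝ) := twoVertical m (B.vert y)

/-- The fibre of `J¹π* = Mπ / π*Λᵐ T*M`. -/
abbrev DualFibre (y : E) : Type := Quotient (modPulledBack m (B.T y))

variable (m n) in
/-- `ℝᵐ × ℝⁿ → ℝᵐ`. -/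
abbrev modelProj : (V m × V n) →L[ℝ] V m := ContinuousLinearMap.fst ℝ (V m) (V n)

variable (m n) in
/-- The horizontal projector `(x, y) ↦ (x, 0)`. -/
abbrev modelHor : (V m × V n) →L[ℝ] (V m × V n) :=
  (ContinuousLinearMap.inl ℝ (V m) (V n)).comp (modelProj m n)

variable (m n) in
/-- The typical fibre of `Mπ` : covectors `p^ν_A dy^A ∧ d^{m-1}x_ν + p dᵐx` on `ℝᵐ × ℝⁿ`. -/
def MomentumModel : Type := twoVertical m (LinearMap.ker (modelProj m n).toLinearMap)

instance : NormedAddCommGroup (MomentumModel m n) :=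
  inferInstanceAs (NormedAddCommGroup (twoVertical m (LinearMap.ker (modelProj m n).toLinearMap)))

instance : NormedSpace ℝ (MomentumModel m n) :=
  inferInstanceAs (NormedSpace ℝ (twoVertical m (LinearMap.ker (modelProj m n).toLinearMap)))

variable (m n) in
/-- The covectors `p^ν_A dy^A ∧ d^{m-1}x_ν` on `ℝᵐ × ℝⁿ`. -/
def dualModelSubmodule : Submodule ℝ ((V m × V n) [⋀^Fin m]→L[ℝ] ℝ) where
  carrier := {α | α ∈ twoVertical m (LinearMap.ker (modelProj m n).toLinearMap) ∧
    α.compContinuousLinearMap (modelHor m n) = 0}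
  add_mem' ha hb := ⟨add_mem ha.1 hb.1, by
    ext v
    have h1 := DFunLike.congr_fun ha.2 v
    have h2 := DFunLike.congr_fun hb.2 v
    exact (congrArg₂ (· + ·) h1 h2).trans (add_zero 0)⟩
  zero_mem' := ⟨zero_mem _, by ext v; simp⟩
  smul_mem' c a ha := ⟨Submodule.smul_mem _ c ha.1, by
    ext v
    have h1 := DFunLike.congr_fun ha.2 v
    exact (congrArg (c * ·) h1).trans (mul_zero c)⟩

variable (m n) in
/-- The typical fibre of `J¹π*`. -/
def DualModel : Type := dualModelSubmodule m n

instance : NormedAddCommGroup (DualModel m n) :=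
  inferInstanceAs (NormedAddCommGroup (dualModelSubmodule m n))

instance : NormedSpace ℝ (DualModel m n) :=
  inferInstanceAs (NormedSpace ℝ (dualModelSubmodule m n))

variable {B} in
/-- The identification of the fibre of `Mπ` with the typical fibre given by an adapted frame. -/
def AdaptedFrame.momentum {y : E} (a : B.AdaptedFrame y) :
    B.MomentumFibre y ≃ MomentumModel m n :=
  twoVerticalCongr m (B.T y) (modelProj m n) a.D a.D₀ a.fst_D

/-- The extended multimomentum bundle, with fibre coordinates `(p^ν_A, p)`. -/
def momentumBundle : NaturalBundle B (fun y => B.MomentumFibre y) (MomentumModel m n) where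
  triv y a := a.momentum
  act _ A' α := (exists_projection (twoVertical m
    (LinearMap.ker (modelProj m n).toLinearMap))).choose (α.1.compContinuousLinearMap A')
  act_smooth := by
    have hs := contDiff_snd (𝕜 := ℝ) (n := ∞) (E := (V m × V n) →L[ℝ] (V m × V n))
      (F := ((V m × V n) →L[ℝ] (V m × V n)) × (MomentumModel m n))
    have hv : ContDiff ℝ ∞ (fun p : ((V m × V n) →L[ℝ] (V m × V n)) ×
        ((V m × V n) →L[ℝ] (V m × V n)) × (MomentumModel m n) => p.2.2.1) :=
      (ContinuousLinearMap.contDiff (F := (V m × V n) [⋀^Fin m]→L[ℝ] ℝ) (E := MomentumModel m n)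
        (twoVertical m (LinearMap.ker (modelProj m n).toLinearMap)).subtypeL).comp hs.snd
    exact (ContinuousLinearMap.contDiff _).comp ((contDiff_pullback (V m × V n) m).comp
      (hv.prodMk hs.fst))
  compat y a b α := ((exists_projection (twoVertical m
    (LinearMap.ker (modelProj m n).toLinearMap))).choose_spec (b.momentum (a.momentum.symm α))).symm

/-- The part `p^ν_A dy^A ∧ d^{m-1}x_ν` of a covector `p^ν_A dy^A ∧ d^{m-1}x_ν + p dᵐx`. -/
def momentumPart (α : MomentumModel m n) : DualModel m n :=
  ⟨α.1 - α.1.compContinuousLinearMap (modelHor m n), by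
    refine ⟨sub_mem α.2 ?_, ?_⟩
    · intro v i j _ hi _
      refine α.1.map_coord_zero i ?_
      have hi' : (v i).1 = 0 := hi
      simp [hi']
    · ext v
      simp [Function.comp_def]⟩

/-- The restricted multimomentum bundle, with fibre coordinates `p^ν_A`. -/
def dualBundle : NaturalBundle B B.DualFibre (DualModel m n) where
  triv y a :=
    { toFun := Quotient.lift (fun α => momentumPart (a.momentum α)) (by
        rintro α α' ⟨β, hβ⟩
        apply Subtype.ext
        ext v
        have key : ∀ w, α.1 w - α'.1 w = β (fun i => B.T y (w i)) :=
          fun w => DFunLike.congr_fun hβ w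
        have hT : ∀ w, B.T y (a.D.symm (modelHor m n w)) = B.T y (a.D.symm w) := by
          intro w
          apply a.D₀.injective
          rw [← a.fst_D, ← a.fst_D]
          simp
        have h1 := key (fun i => a.D.symm (v i))
        have h2 := key (fun i => a.D.symm (modelHor m n (v i)))
        simp only [hT] at h2
        change α.1 (fun i => a.D.symm (v i)) - α.1 (fun i => a.D.symm (modelHor m n (v i))) =
          α'.1 (fun i => a.D.symm (v i)) - α'.1 (fun i => a.D.symm (modelHor m n (v i)))
        linarith)
      invFun := fun q => Quotient.mk _ (a.momentum.symm ⟨q.1, q.2.1⟩)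
      left_inv := by
        intro q
        induction q using Quotient.inductionOn with | _ α => ?_
        apply Quotient.sound
        refine ⟨-(α.1.compContinuousLinearMap (a.D.symm.toContinuousLinearMap.comp
          ((ContinuousLinearMap.inl ℝ (V m) (V n)).comp a.D₀.toContinuousLinearMap))), ?_⟩
        ext v
        change (α.1 (fun i => a.D.symm (a.D (v i))) -
          α.1 (fun i => a.D.symm (modelHor m n (a.D (v i))))) - α.1 v =
          -α.1 (fun i => a.D.symm (a.D₀ (B.T y (v i)), 0))
        simp [a.fst_D]
      right_inv := by
        intro q
        apply Subtype.ext
        ext v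
        have h := DFunLike.congr_fun q.2.2 v
        change q.1 (fun i => a.D (a.D.symm (v i))) -
          q.1 (fun i => a.D (a.D.symm (modelHor m n (v i)))) = q.1 v
        change q.1 (fun i => modelHor m n (v i)) = 0 at h
        simp only [ContinuousLinearEquiv.apply_symm_apply, h, sub_zero] }
  act _ A' q := (exists_projection (dualModelSubmodule m n)).choose
    (q.1.compContinuousLinearMap A' -
      (q.1.compContinuousLinearMap A').compContinuousLinearMap (modelHor m n))
  act_smooth := by
    have hs := contDiff_snd (𝕜 := ℝ) (n := ∞) (E := (V m × V n) →L[ℝ] (V m × V n))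
      (F := ((V m × V n) →L[ℝ] (V m × V n)) × (DualModel m n))
    have hv : ContDiff ℝ ∞ (fun p : ((V m × V n) →L[ℝ] (V m × V n)) ×
        ((V m × V n) →L[ℝ] (V m × V n)) × (DualModel m n) => p.2.2.1) :=
      (ContinuousLinearMap.contDiff (F := (V m × V n) [⋀^Fin m]→L[ℝ] ℝ) (E := DualModel m n)
        (dualModelSubmodule m n).subtypeL).comp hs.snd
    have h1 := (contDiff_pullback (V m × V n) m).comp (hv.prodMk hs.fst)
    have h2 := (contDiff_pullback (V m × V n) m).comp
      (h1.prodMk (contDiff_const (c := modelHor m n)))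
    exact (ContinuousLinearMap.contDiff _).comp (h1.sub h2)
  compat y a b q := ((exists_projection (dualModelSubmodule m n)).choose_spec
    (momentumPart (b.momentum (a.momentum.symm ⟨q.1, q.2.1⟩)))).symm

/-- `Mπ`. -/
abbrev ExtMom : Type _ := B.momentumBundle.Total

/-- `J¹π*`. -/
abbrev J1Dual : Type _ := B.dualBundle.Total

end ConfigurationBundle

open ConfigurationBundle (MomentumModel DualModel)

variable (m n) in
/-- The model space of `J¹π`, with coordinates `(x^ν, y^A, v^A_ν)`. -/
abbrev J1Model : Type := (V m × V n) × (V m →L[ℝ] V n)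

variable (m n) in
/-- The model space of `Mπ`, with coordinates `(x^ν, y^A, p^ν_A, p)`. -/
abbrev ExtMomModel : Type := (V m × V n) × MomentumModel m n

variable (m n) in
/-- The model space of `J¹π*`, with coordinates `(x^ν, y^A, p^ν_A)`. -/
abbrev J1DualModel : Type := (V m × V n) × DualModel m n

variable (m n) in
/-- The model space of `W₀`, with coordinates `(x^ν, y^A, v^A_ν, p^ν_A)`. -/
abbrev W₀Model : Type := (V m × V n) × (V m →L[ℝ] V n) × DualModel m n

/-! ## Sections and their prolongations -/

/-- A (smooth, global) section `φ : M → E` of the configuration bundle. -/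
structure ConfigurationBundle.Section (B : ConfigurationBundle m n E M) where
  toFun : M → E
  smooth : ContMDiff 𝓘(ℝ, V m) 𝓘(ℝ, V (m + n)) ∞ toFun
  proj_toFun : ∀ x, B.proj (toFun x) = x

variable {B : ConfigurationBundle m n E M}

/-- The canonical lift `j¹φ : M → J¹π`, `x ↦ T_x φ`. -/
def j1 (φ : B.Section) (x : M) : B.J1 :=
  ⟨φ.toFun x, ⟨mfderiv 𝓘(ℝ, V m) 𝓘(ℝ, V (m + n)) φ.toFun x, by
    have h1 : HasMFDerivAt 𝓘(ℝ, V m) 𝓘(ℝ, V m) (fun x => B.proj (φ.toFun x)) x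
        ((mfderiv 𝓘(ℝ, V (m + n)) 𝓘(ℝ, V m) B.proj (φ.toFun x)).comp
          (mfderiv 𝓘(ℝ, V m) 𝓘(ℝ, V (m + n)) φ.toFun x)) :=
      ((B.isSubmersion.contMDiff _).mdifferentiableAt (by simp)).hasMFDerivAt.comp x
        ((φ.smooth x).mdifferentiableAt (by simp)).hasMFDerivAt
    have h2 : (fun x => B.proj (φ.toFun x)) = id := funext φ.proj_toFun
    rw [h2] at h1
    exact hasMFDerivAt_unique h1 (hasMFDerivAt_id x)⟩⟩

/-! ## The canonical forms of the multimomentum bundle -/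

/-- The canonical (tautological) `m`-form `Θ` on `Mπ` : at a covector `α` of `T_y E`, it is the
pullback of `α` along the projection `Mπ → E`. -/
def canonicalForm (B : ConfigurationBundle m n E M) :
    DForm (ExtMomModel m n) B.ExtMom m := fun p =>
  (p.fib.1).compContinuousLinearMap
    (mfderiv 𝓘(ℝ, ExtMomModel m n) 𝓘(ℝ, V (m + n))
      (NaturalBundle.Total.base : B.ExtMom → E) p)

/-- The multisymplectic form `Ω = -dΘ` on `Mπ`. -/
def multisymplecticForm (B : ConfigurationBundle m n E M) :
    DForm (ExtMomModel m n) B.ExtMom (m + 1) := fun p => -(canonicalForm B).d p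

/-- The quotient map `μ : Mπ → J¹π* = Mπ / π*Λᵐ T*M`. -/
def quotientMap (p : B.ExtMom) : B.J1Dual := ⟨p.base, Quotient.mk _ p.fib⟩

/-! ## Lagrangian systems and Legendre maps -/

/-- A Lagrangian system: a volume form `ω` on `M` and a Lagrangian function `£` on `J¹π`; the
Lagrangian density is `£ ω`. -/
structure LagrangianSystem (B : ConfigurationBundle m n E M) where
  /-- the volume form `ω` -/
  vol : DForm (V m) M m
  vol_smooth : vol.IsSmooth
  vol_ne_zero : ∀ x, vol x ≠ 0
  /-- the Lagrangian function `£` -/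
  lag : B.J1 → ℝ
  lag_smooth : ContMDiff 𝓘(ℝ, J1Model m n) 𝓘(ℝ, ℝ) ∞ lag

/-- The canonical structure form of `J¹π` : `Z ↦ Z - σ (Tπ Z)`, in coordinates `dy^A - v^A_ν dx^ν`
with values in the vertical vectors. -/
def structureForm (z : B.J1) : V (m + n) →L[ℝ] B.vert z.base :=
  (ContinuousLinearMap.id ℝ (V (m + n)) - z.fib.1.comp (B.T z.base)).codRestrict _ (by
    intro v
    have h : ∀ w, B.T z.base (z.fib.1 w) = w := fun w => DFunLike.congr_fun z.fib.2 w
    simp [h])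

namespace LagrangianSystem

variable (L : LagrangianSystem B)

/-- The volume form at `π y`, as an alternating form on `ℝᵐ = T_{π y} M`. -/
def volAt (y : E) : V m [⋀^Fin m]→L[ℝ] ℝ := L.vol (B.proj y)

/-- The derivative of `£` along the fibres of `J¹π → E`, which are affine spaces modelled on the
linear maps from `T_{π y} M` to `V_y π`. -/
def fibreDeriv (z : B.J1) : (V m →L[ℝ] B.vert z.base) →L[ℝ] ℝ :=
  fderiv ℝ (fun η : V m →L[ℝ] B.vert z.base =>
    L.lag ⟨z.base, ⟨z.fib.1 + (B.vert z.base).subtypeL.comp η, by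
      have h : (B.T z.base).comp ((B.vert z.base).subtypeL.comp η) = 0 := by
        ext1 w
        exact (η w).2
      rw [ContinuousLinearMap.comp_add, h, add_zero]
      exact z.fib.2⟩⟩) 0

/-- The differential of the Lagrangian contracted with the vertical endomorphism, in coordinates
`∂£/∂v^A_ν (dy^A - v^A_ρ dx^ρ) ⊗ ∂/∂x^ν`. -/
def verticalDiff (z : B.J1) : V (m + n) →L[ℝ] V m :=
  ∑ ν : Fin m, ((L.fibreDeriv z).comp
    ((ContinuousLinearMap.smulRightL ℝ (V m) (B.vert z.base)
      (EuclideanSpace.proj ν : V m →L[ℝ] ℝ)).comp (structureForm z))).smulRight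
        (EuclideanSpace.single ν (1 : ℝ))

/-- The covector on `T_y E` given by `i(𝒱)(£ ω) + £ ω` at a point of `J¹π` over `y`, where `𝒱` is the
vertical endomorphism; in coordinates with `ω = dᵐx` it is
`∂£/∂v^A_ν dy^A ∧ d^{m-1}x_ν - (∂£/∂v^A_ν v^A_ν - £) dᵐx`. -/
def covector (z : B.J1) : V (m + n) [⋀^Fin m]→L[ℝ] ℝ :=
  (L.volAt z.base).fderivCompContinuousLinearMap (B.T z.base) (L.verticalDiff z) +
    L.lag z • (L.volAt z.base).compContinuousLinearMap (B.T z.base)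

lemma covector_mem (z : B.J1) : L.covector z ∈ B.MomentumFibre z.base := by
  intro v i j hij hi hj
  have hi' : B.T z.base (v i) = 0 := hi
  have hj' : B.T z.base (v j) = 0 := hj
  have h1 : ((L.volAt z.base).compContinuousLinearMap (B.T z.base)) v = 0 :=
    (L.volAt z.base).map_coord_zero i hi'
  have h2 : (L.volAt z.base).fderivCompContinuousLinearMap (B.T z.base) (L.verticalDiff z) v = 0 := by
    rw [ContinuousAlternatingMap.fderivCompContinuousLinearMap_apply]
    refine Finset.sum_eq_zero fun k _ => ?_
    by_cases hk : i = k
    · have hjk : j ≠ k := fun h => hij (hk.trans h.symm)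
      refine (L.volAt z.base).map_coord_zero j ?_
      simp [Function.update_of_ne hjk, hj']
    · refine (L.volAt z.base).map_coord_zero i ?_
      simp [Function.update_of_ne hk, hi']
  change (L.volAt z.base).fderivCompContinuousLinearMap (B.T z.base) (L.verticalDiff z) v +
    L.lag z • ((L.volAt z.base).compContinuousLinearMap (B.T z.base)) v = 0
  rw [h1, h2]
  simp

/-- The Poincaré–Cartan `m`-form `Θ_L = i(𝒱)(£ ω) + £ ω` on `J¹π`. -/
def ΘL : DForm (J1Model m n) B.J1 m := fun z =>
  (L.covector z).compContinuousLinearMap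
    (mfderiv 𝓘(ℝ, J1Model m n) 𝓘(ℝ, V (m + n))
      (NaturalBundle.Total.base : B.J1 → E) z)

/-- The Poincaré–Cartan `(m+1)`-form `Ω_L = -dΘ_L`. -/
def ΩL : DForm (J1Model m n) B.J1 (m + 1) := fun z => -L.ΘL.d z

/-- The extended Legendre map `J¹π → Mπ`. -/
def extLegendre (z : B.J1) : B.ExtMom := ⟨z.base, ⟨L.covector z, L.covector_mem z⟩⟩

/-- The extended Legendre map is characterised by `(F̃L z)(Tπ¹ Z₁, …, Tπ¹ Zₘ) = Θ_L(Z₁, …, Zₘ)`. -/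
lemma extLegendre_apply (z : B.J1)
    (Z : Fin m → TangentSpace 𝓘(ℝ, J1Model m n) z) :
    (L.extLegendre z).fib.1 (fun i => mfderiv 𝓘(ℝ, J1Model m n) 𝓘(ℝ, V (m + n))
      (NaturalBundle.Total.base : B.J1 → E) z (Z i)) = L.ΘL z Z := rfl

/-- The restricted Legendre map `FL = μ ∘ F̃L : J¹π → J¹π*`. -/
def legendre (z : B.J1) : B.J1Dual := quotientMap (L.extLegendre z)

/-! ## The Hamiltonian submanifold of the jet-multimomentum bundle -/

/-- The fibre of the Hamiltonian submanifold `W₀ ⊂ J¹π ×_E Mπ` : the pairs of a jet `σ` and a covector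
`α` at `y` for which the coupling form `σ^* α` equals the Lagrangian density `£ ω`. -/
abbrev W₀Fibre (y : E) : Type :=
  {p : B.JetFibre y × B.MomentumFibre y //
    L.lag ⟨y, p.1⟩ • L.volAt y = p.2.1.compContinuousLinearMap p.1.1}

/-- The map `W₀ → J¹π ×_E J¹π*` on the fibres. -/
def toRestricted (y : E) (p : L.W₀Fibre y) : B.JetFibre y × B.DualFibre y :=
  (p.1.1, Quotient.mk _ p.1.2)

lemma toRestricted_bijective (y : E) : Bijective (L.toRestricted y) := by
  constructor
  · rintro ⟨⟨σ, α⟩, h⟩ ⟨⟨σ', α'⟩, h'⟩ heq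
    have h1 : σ = σ' := congrArg Prod.fst heq
    subst h1
    have h2 : (Quotient.mk (modPulledBack m (B.T y)) α) = Quotient.mk _ α' := congrArg Prod.snd heq
    obtain ⟨β, hβ⟩ := Quotient.exact h2
    have hσ : ∀ w, B.T y (σ.1 w) = w := fun w => DFunLike.congr_fun σ.2 w
    have h3 : β = 0 := by
      ext v
      have e1 := DFunLike.congr_fun hβ (fun i => σ.1 (v i))
      have e2 : α.1 (fun i => σ.1 (v i)) - α'.1 (fun i => σ.1 (v i)) =
        β (fun i => B.T y (σ.1 (v i))) := e1
      have e3 : α.1 (fun i => σ.1 (v i)) = α'.1 (fun i => σ.1 (v i)) :=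
        DFunLike.congr_fun (h.symm.trans h') v
      simp only [hσ] at e2
      rw [e3, sub_self] at e2
      exact e2.symm
    have h4 : α = α' := by
      apply Subtype.ext
      rw [h3] at hβ
      have : α.1 - α'.1 = 0 := by rw [hβ]; ext v; simp
      exact sub_eq_zero.1 this
    subst h4
    rfl
  · rintro ⟨σ, q⟩
    induction q using Quotient.inductionOn with | _ α => ?_
    have hσ : ∀ w, B.T y (σ.1 w) = w := fun w => DFunLike.congr_fun σ.2 w
    let β : V m [⋀^Fin m]→L[ℝ] ℝ :=
      L.lag ⟨y, σ⟩ • L.volAt y - α.1.compContinuousLinearMap σ.1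
    have hβ : β.compContinuousLinearMap (B.T y) ∈ B.MomentumFibre y := by
      intro v i j _ hi _
      exact β.map_coord_zero i hi
    refine ⟨⟨(σ, ⟨α.1 + β.compContinuousLinearMap (B.T y), add_mem α.2 hβ⟩), ?_⟩, ?_⟩
    · ext v
      change L.lag ⟨y, σ⟩ * L.volAt y v =
        α.1 (fun i => σ.1 (v i)) + (L.lag ⟨y, σ⟩ * L.volAt y (fun i => B.T y (σ.1 (v i))) -
          α.1 (fun i => σ.1 (B.T y (σ.1 (v i)))))
      simp only [hσ]
      ring
    · refine Prod.ext rfl (Quotient.sound ⟨β, ?_⟩)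
      exact add_sub_cancel_left _ _

/-- The Hamiltonian submanifold as a bundle over `E`. Its smooth structure is the one for which the
restriction `W₀ → J¹π ×_E J¹π*` of the projection is a diffeomorphism, so that its coordinates are
`(x^ν, y^A, v^A_ν, p^ν_A)`. -/
def W₀Bundle : NaturalBundle B L.W₀Fibre ((V m →L[ℝ] V n) × DualModel m n) :=
  (B.jetBundle.prod B.dualBundle).congr fun y => Equiv.ofBijective _ (L.toRestricted_bijective y)

/-- The Hamiltonian submanifold `W₀`. -/
abbrev W₀ : Type _ := L.W₀Bundle.Total

/-- The projection `ρ₁⁰ : W₀ → J¹π`. -/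
def ρ₁ (w : L.W₀) : B.J1 := ⟨w.base, w.fib.1.1⟩

/-- The projection `ρ₂⁰ : W₀ → Mπ`. -/
def ρ₂ (w : L.W₀) : B.ExtMom := ⟨w.base, w.fib.1.2⟩

/-- The premultisymplectic form `Ω₀ = (ρ₂⁰)^* Ω` on `W₀`. -/
def Ω₀ : DForm (W₀Model m n) L.W₀ (m + 1) :=
  (multisymplecticForm B).pullback L.ρ₂

/-! ## The three field-theoretic problems -/

/-- A (smooth, global) section of `ρ_M⁰ : W₀ → M`. -/
structure W₀Section where
  toFun : M → L.W₀
  smooth : ContMDiff 𝓘(ℝ, V m) 𝓘(ℝ, W₀Model m n) ∞ toFun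
  proj_toFun : ∀ x, B.proj (toFun x).base = x

/-- `ψ₀^* i(Y) Ω₀ = 0` for all vector fields `Y` on `W₀`. -/
def SolvesUnified (ψ₀ : L.W₀Section) : Prop :=
  FieldEquationOn (F := V m) L.Ω₀ ψ₀.toFun univ

/-- `(j¹φ)^* i(X) Ω_L = 0` for all vector fields `X` on `J¹π`. -/
def SolvesLagrangian (φ : B.Section) : Prop :=
  FieldEquationOn (F := V m) L.ΩL (j1 φ) univ

/-- The Hamiltonian form `Ω_h = h^* Ω` associated with a section `h` of `μ : Mπ → J¹π*`. -/
def hamiltonForm (h : B.J1Dual → B.ExtMom) :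
    DForm (J1DualModel m n) B.J1Dual (m + 1) :=
  (multisymplecticForm B).pullback h

/-- The restricted Legendre map as a map onto its image `P`. -/
def legendreOnto : B.J1 → range L.legendre := rangeFactorization L.legendre

/-- The map `h_P : P → Mπ` with `h_P ∘ FL = F̃L`, for Lagrangians whose `F̃L` is constant on the fibres
of `FL` (which is so for almost-regular Lagrangians). -/
def hamiltonSectionOnImage (q : range L.legendre) : B.ExtMom := L.extLegendre q.2.choose

/-- Almost-regular Lagrangians, for a given manifold structure of dimension `d` on the image `P` of
`FL`: `P` is a closed embedded submanifold of `J¹π*`, `FL` is a submersion onto it, and the fibres of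
`FL` are connected. -/
structure IsAlmostRegular (d : ℕ) [ChartedSpace (V d) (range L.legendre)]
    [IsManifold 𝓘(ℝ, V d) ∞ (range L.legendre)] : Prop where
  isClosed_range : IsClosed (range L.legendre)
  isSmoothEmbedding : IsSmoothEmbedding 𝓘(ℝ, V d) 𝓘(ℝ, J1DualModel m n) ∞
    (Subtype.val : range L.legendre → B.J1Dual)
  isSubmersion : IsSubmersion 𝓘(ℝ, J1Model m n) 𝓘(ℝ, V d) ∞ L.legendreOnto
  isConnected_fibre : ∀ z, IsConnected (L.legendre ⁻¹' {L.legendre z})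

/-- `FL ∘ j¹φ` is a solution of the Hamiltonian problem: it is a smooth section `ψ` of `J¹π* → M` with
`ψ^* i(X) Ω_h = 0` for all vector fields `X`, where the Hamiltonian form `Ω_h = h^* Ω` is
* the one of `h = F̃L ∘ FL⁻¹` if `FL` is a diffeomorphism (hyper-regular Lagrangians);
* the one of `h = F̃L ∘ Φ⁻¹`, over the domain of `Φ`, for each restriction `Φ` of `FL` which is a
  diffeomorphism between open sets (for regular Lagrangians such domains cover `J¹π`);
* the form `h_P^* Ω` on the image `P` of `FL`, for almost-regular Lagrangians. -/
structure SolvesHamiltonian (φ : B.Section) : Prop where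
  smooth : ContMDiff 𝓘(ℝ, V m) 𝓘(ℝ, J1DualModel m n) ∞ (fun x => L.legendre (j1 φ x))
  proj_eq : ∀ x, B.proj (L.legendre (j1 φ x)).base = x
  hyperRegular : ∀ Φ : Diffeomorph 𝓘(ℝ, J1Model m n)
      𝓘(ℝ, J1DualModel m n) B.J1 B.J1Dual ∞, (∀ z, Φ z = L.legendre z) →
    FieldEquationOn (F := V m) (hamiltonForm fun q => L.extLegendre (Φ.symm q)) (fun x => L.legendre (j1 φ x))
      univ
  regular : ∀ Φ : PartialDiffeomorph 𝓘(ℝ, J1Model m n)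
      𝓘(ℝ, J1DualModel m n) B.J1 B.J1Dual ∞, (∀ z ∈ Φ.source, Φ z = L.legendre z) →
    FieldEquationOn (F := V m) (hamiltonForm fun q => L.extLegendre (Φ.symm q)) (fun x => L.legendre (j1 φ x))
      {x | j1 φ x ∈ Φ.source}
  almostRegular : ∀ (d : ℕ) [ChartedSpace (V d) (range L.legendre)]
      [IsManifold 𝓘(ℝ, V d) ∞ (range L.legendre)], L.IsAlmostRegular d →
    ContMDiff 𝓘(ℝ, V m) 𝓘(ℝ, V d) ∞ (fun x => L.legendreOnto (j1 φ x)) ∧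
    FieldEquationOn (F := V m) (F' := V d)
      ((multisymplecticForm B).pullback L.hamiltonSectionOnImage)
      (fun x => L.legendreOnto (j1 φ x)) univ

end LagrangianSystem

end Bundle

end FieldTheory

end

noncomputable section

namespace FieldTheory

/-! ## Linear algebra of the pairing between restricted multimomenta and jets -/

open ConfigurationBundle

/-! In adapted coordinates `W₀` has coordinates $(x^\nu,y^A,v^A_\nu,p^\nu_A)$. The constraint
$\sigma^*\alpha=\pounds\omega$ solves for the remaining coordinate of `Mπ`: when $\omega=d^mx$,
$p=\pounds-p^\nu_Av^A_\nu$. For general $\omega$ this is the formula `localMomentum`, and $\Omega_0$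
is minus the alternating sum built from its derivative (`Ω₀_apply`). Everything else is read off
from this formula.

A smooth vector field can take any prescribed value at a point, so the field equations are pointwise
(`fieldEquationOn_iff`). Contracting $\Omega_0$ with $\partial/\partial p^\nu_A$ along a section
gives the pairing of that momentum with the difference between the jet of the base section and the
jet component of $\psi_0$. The pairing is nondegenerate, so $\psi_0$ is holonomic
(`holonomic_of_unified`). Contracting with $\partial/\partial v^A_\nu$ gives
$\partial\pounds/\partial v^A_\nu-p^\nu_A$, so $\psi_0$ lies in the graph of the Legendre map
(`eq_liftW₀_of_unified`).

The graph map `liftW₀` is a section of $\rho_1^0$ with $\rho_2^0\circ$ `liftW₀`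
$=\widetilde{\mathcal{FL}}$, whence $\Omega_{\mathcal L}$ is the pullback of $\Omega_0$ by it. At a
point of the graph each tangent vector of `W₀` is a vector tangent to the graph plus a variation of
the momenta. The latter contributes nothing along a holonomic section, so the unified and Lagrangian
equations coincide there (`unified_iff_lagrangian`).

For the Hamiltonian problem, suppose $h\circ\mathcal{FL}=\widetilde{\mathcal{FL}}$ and
$h=\widetilde{\mathcal{FL}}\circ s$ locally, with $s$ smooth. Then the equation for $h^*\Omega$
tested on $v$ is the Lagrangian equation tested on $Ts\,v$ (`hamilton_of_lagrangian`). In the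
regular cases $s$ is the inverse of the diffeomorphism; in the almost-regular case it is a local
section of the submersion onto $P$. There $h_P$ is well defined because along a fibre of
$\mathcal{FL}$ the momenta are constant and $d(\pounds-p^\nu_Av^A_\nu)=(\partial\pounds/\partial
v^A_\nu-p^\nu_A)\,dv^A_\nu=0$, and the fibres are connected. -/

lemma map_add_of_mem_twoVertical {W : Type*} [NormedAddCommGroup W] [NormedSpace ℝ W] {k : ℕ}
    {K : Submodule ℝ W} {α : W [⋀^Fin k]→L[ℝ] ℝ} (hα : α ∈ twoVertical k K) (u h : Fin k → W)
    (hh : ∀ i, h i ∈ K) : α (u + h) = α u + ∑ i, α (update u i (h i)) := by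
  classical
  -- `w s` adds `h` only in the slots of `s`; the formula follows by enlarging `s` one slot at a
  -- time up to `univ`.
  let w : Finset (Fin k) → Fin k → W := fun s j => u j + if j ∈ s then h j else 0
  have w_insert : ∀ (s : Finset (Fin k)) (a : Fin k), a ∉ s →
      w (insert a s) = update (w s) a (u a + h a) := by
    intro s a ha
    ext1 j
    by_cases hj : j = a
    · subst hj; simp [w]
    · simp [w, hj]
  have w_self : ∀ (s : Finset (Fin k)) (a : Fin k), a ∉ s → update (w s) a (u a) = w s := by
    intro s a ha
    apply update_eq_self_iff.2
    simp [w, ha]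
  -- With `h a` already in slot `a`, each further summand `h b` puts a second vector of `K` into
  -- `α`, so only the entries of `u` matter in the other slots.
  have inner : ∀ (a : Fin k) (s : Finset (Fin k)), a ∉ s →
      α (update (w s) a (h a)) = α (update u a (h a)) := by
    intro a s
    induction s using Finset.induction_on with
    | empty => intro _; simp [w]
    | insert b s hb ih =>
      intro ha
      rw [Finset.mem_insert, not_or] at ha
      rw [w_insert s b hb, update_comm (Ne.symm ha.1), α.map_update_add, update_comm ha.1,
        w_self s b hb, ih ha.2, add_eq_left]
      refine hα _ a b ha.1 ?_ ?_
      · simpa [update_of_ne ha.1] using hh a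
      · simpa using hh b
  have outer : ∀ s : Finset (Fin k), α (w s) = α u + ∑ i ∈ s, α (update u i (h i)) := by
    intro s
    induction s using Finset.induction_on with
    | empty => simp [w]
    | insert a s ha ih =>
      rw [w_insert s a ha, α.map_update_add, w_self s a ha, inner a s ha, ih,
        Finset.sum_insert ha]
      ring
  have := outer Finset.univ
  simpa [w, Pi.add_def] using this

variable {m n : ℕ}

/-- The pairing `(p^ν_A, v^A_ν) ↦ p^ν_A v^A_ν dᵐx`. -/
def pairing (m n : ℕ) :
    ((V m × V n) [⋀^Fin m]→L[ℝ] ℝ) →L[ℝ] (V m →L[ℝ] V n) →L[ℝ] (V m [⋀^Fin m]→L[ℝ] ℝ) :=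
  (ContinuousLinearMap.precomp (V m [⋀^Fin m]→L[ℝ] ℝ)
    (ContinuousLinearMap.postcomp (V m) (ContinuousLinearMap.inr ℝ (V m) (V n)))).comp
    (ContinuousAlternatingMap.fderivCompContinuousLinearMapCLM ℝ
      (ContinuousLinearMap.inl ℝ (V m) (V n)))

/-- `pairing` is the derivative of $f\mapsto f^*\alpha$ at the horizontal inclusion in the direction
of the vertical map `v`; the Leibniz rule replaces one slot at a time. -/
lemma pairing_apply (α : (V m × V n) [⋀^Fin m]→L[ℝ] ℝ) (v : V m →L[ℝ] V n) (u : Fin m → V m) :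
    pairing m n α v u = ∑ i, α (update (fun j => (u j, 0)) i (0, v (u i))) := by
  change α.fderivCompContinuousLinearMap (ContinuousLinearMap.inl ℝ (V m) (V n))
    ((ContinuousLinearMap.inr ℝ (V m) (V n)).comp v) u = _
  rw [ContinuousAlternatingMap.fderivCompContinuousLinearMap_apply]
  refine Finset.sum_congr rfl fun i _ => ?_
  congr 1
  ext1 j
  by_cases hj : j = i
  · subst hj; simp
  · simp [update_of_ne hj]

/-- A covector of `Λᵐ₂`, pulled back along the graph of `v`. -/
lemma compContinuousLinearMap_graph {α : (V m × V n) [⋀^Fin m]→L[ℝ] ℝ}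
    (hα : α ∈ twoVertical m (LinearMap.ker (modelProj m n).toLinearMap)) (v : V m →L[ℝ] V n) :
    α.compContinuousLinearMap ((ContinuousLinearMap.id ℝ (V m)).prod v) =
      α.compContinuousLinearMap (ContinuousLinearMap.inl ℝ (V m) (V n)) + pairing m n α v := by
  ext u
  have h := map_add_of_mem_twoVertical hα (fun j => (u j, 0)) (fun j => (0, v (u j)))
    (fun i => rfl)
  have e : (fun j => (u j, (0 : V n))) + (fun j => ((0 : V m), v (u j))) =
      fun j => (u j, v (u j)) := by ext1 j; simp
  rw [e] at h
  change α (fun j => (u j, v (u j))) = α (fun j => (u j, 0)) + pairing m n α v u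
  rw [h, pairing_apply]

lemma dualModel_comp_inl (q : DualModel m n) :
    q.1.compContinuousLinearMap (ContinuousLinearMap.inl ℝ (V m) (V n)) = 0 := by
  ext u
  have := DFunLike.congr_fun q.2.2 (fun i => (u i, 0))
  exact this

lemma dualModel_comp_graph (q : DualModel m n) (v : V m →L[ℝ] V n) :
    q.1.compContinuousLinearMap ((ContinuousLinearMap.id ℝ (V m)).prod v) = pairing m n q.1 v := by
  rw [compContinuousLinearMap_graph q.2.1, dualModel_comp_inl, zero_add]

/-- The infinitesimal form of the transformation law of a volume form. -/
lemma sum_map_update_eq_trace_smul (vol : V m [⋀^Fin m]→L[ℝ] ℝ) (A : V m →L[ℝ] V m)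
    (u : Fin m → V m) :
    ∑ i, vol (update u i (A (u i))) =
      (∑ ν, A (EuclideanSpace.single ν 1) ν) * vol u := by
  let e := (EuclideanSpace.basisFun (Fin m) ℝ).toBasis
  have he : ∀ i, e i = EuclideanSpace.single i 1 := fun i => by simp [e]
  have key : vol.fderivCompContinuousLinearMap (ContinuousLinearMap.id ℝ (V m)) A =
      (∑ ν, A (EuclideanSpace.single ν 1) ν) • vol := by
    apply ContinuousAlternatingMap.toAlternatingMap_injective
    -- Both sides are alternating, so only tuples of distinct basis vectors need checking; such a
    -- tuple is a permutation `k` of the basis, and the trace is reindexed along it.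
    refine Module.Basis.ext_alternating e fun k hk => ?_
    change vol.fderivCompContinuousLinearMap _ A (fun i => e (k i)) =
      (∑ ν, A (EuclideanSpace.single ν 1) ν) * vol (fun i => e (k i))
    rw [ContinuousAlternatingMap.fderivCompContinuousLinearMap_apply, Finset.sum_mul,
      ← (Equiv.ofBijective k (Finite.injective_iff_bijective.1 hk)).sum_comp
        (fun ν => A (EuclideanSpace.single ν 1) ν * vol fun i => e (k i))]
    refine Finset.sum_congr rfl fun i _ => ?_
    have h1 : (fun j => update (fun _ => ContinuousLinearMap.id ℝ (V m)) i A j (e (k j))) =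
        update (fun j => e (k j)) i (A (e (k i))) := by
      ext1 j
      by_cases hj : j = i
      · subst hj; simp
      · simp [update_of_ne hj]
    have hsum : ∀ (g : Fin m → V m), vol (update (fun j => e (k j)) i (∑ l, g l)) =
        ∑ l, vol (update (fun j => e (k j)) i (g l)) := fun g =>
      vol.toMultilinearMap.map_update_sum Finset.univ i g _
    -- Only the diagonal coefficient survives: any other basis vector put in slot `i` already occurs
    -- in another slot.
    rw [h1, ← e.sum_repr (A (e (k i))), hsum, Finset.sum_eq_single (k i)]
    · rw [ContinuousAlternatingMap.map_update_smul]
      have : update (fun j => e (k j)) i (e (k i)) = fun j => e (k j) := update_eq_self i _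
      rw [this, smul_eq_mul]
      simp [e]
    · intro l _ hl
      obtain ⟨j, rfl⟩ := (Finite.injective_iff_bijective.1 hk).2 l
      have hji : j ≠ i := fun h => hl (h ▸ rfl)
      rw [ContinuousAlternatingMap.map_update_smul]
      refine smul_eq_zero_of_right _ (vol.map_eq_zero_of_eq _ (i := j) (j := i) ?_ hji)
      simp [update_of_ne hji]
    · simp
  have h := DFunLike.congr_fun key u
  rw [ContinuousAlternatingMap.fderivCompContinuousLinearMap_apply] at h
  refine Eq.trans (Finset.sum_congr rfl fun i _ => ?_) h
  congr 1
  ext1 j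
  by_cases hj : j = i
  · subst hj; simp
  · simp [update_of_ne hj]

/-- Evaluate `q` on tuples of product basis vectors. Two vertical entries give zero by membership in
`twoVertical`, none gives zero because `q` vanishes on horizontal vectors, and exactly one is
recovered by pairing with a suitable rank-one `v`. -/
lemma pairing_eq_zero_left (q : DualModel m n) (h : ∀ v, pairing m n q.1 v = 0) : q = 0 := by
  let e := (EuclideanSpace.basisFun (Fin m) ℝ).toBasis
  let f := (EuclideanSpace.basisFun (Fin n) ℝ).toBasis
  have he : ∀ i, e i = EuclideanSpace.single i 1 := fun i => by simp [e]
  apply Subtype.ext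
  apply ContinuousAlternatingMap.toAlternatingMap_injective
  refine Module.Basis.ext_alternating (e.prod f) fun k hk => ?_
  change q.1 (fun i => e.prod f (k i)) = 0
  by_cases hv : ∃ i A, k i = Sum.inr A
  · obtain ⟨i, A, hi⟩ := hv
    by_cases hv' : ∃ j A', j ≠ i ∧ k j = Sum.inr A'
    · obtain ⟨j, A', hji, hj⟩ := hv'
      refine q.2.1 _ i j hji.symm ?_ ?_
      · change (e.prod f (k i)).1 = 0
        simp [hi]
      · change (e.prod f (k j)).1 = 0
        simp [hj]
    · push Not at hv'
      have hl : ∀ j, j ≠ i → ∃ l, k j = Sum.inl l := fun j hj => by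
        rcases hkj : k j with l | A'
        · exact ⟨l, rfl⟩
        · exact absurd hkj (hv' j A' hj)
      -- The value at `i` is irrelevant, since that slot is always overwritten.
      let l : Fin m → Fin m := fun j => if hj : j ≠ i then (hl j hj).choose else i
      have hlk : ∀ j, j ≠ i → k j = Sum.inl (l j) := fun j hj => by
        simp only [l, dif_pos hj]
        exact (hl j hj).choose_spec
      -- The other $m-1$ slots cannot exhaust $m$ indices: otherwise a choice of preimages would be
      -- an injective self-map of `Fin m` missing `i`.
      obtain ⟨ν, hν⟩ : ∃ ν, ∀ j, j ≠ i → l j ≠ ν := by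
        by_contra hcon
        push Not at hcon
        choose g hg hlg using hcon
        have hginj : Injective g := fun a b hab => by rw [← hlg a, ← hlg b, hab]
        obtain ⟨a, ha⟩ := (Finite.injective_iff_surjective.1 hginj) i
        exact hg a ha
      -- This is $dx^\nu\otimes f_A$. It kills the horizontal entries of the other slots and sends
      -- `e ν` to the vertical entry of slot `i`, so the pairing has a single nonzero term at most.
      let v : V m →L[ℝ] V n := (EuclideanSpace.proj ν : V m →L[ℝ] ℝ).smulRight (f A)
      have hveq : ∀ j, j ≠ i → v (e (l j)) = 0 := fun j hj => by
        simp [v, he, (hν j hj).symm]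
      have h1 := DFunLike.congr_fun (h v) (update (fun j => e (l j)) i (e ν))
      rw [pairing_apply, Finset.sum_eq_single i] at h1
      · refine Eq.trans ?_ h1
        congr 1
        ext1 j
        by_cases hj : j = i
        · subst hj
          simp [hi, v, he]
        · simp [update_of_ne hj, hlk j hj]
      · intro j _ hj
        refine q.1.map_coord_zero j ?_
        simp [update_of_ne hj, hveq j hj]
      · simp
  · push Not at hv
    have hl : ∀ j, ∃ l, k j = Sum.inl l := fun j => by
      rcases hkj : k j with l | A'
      · exact ⟨l, rfl⟩
      · exact absurd hkj (hv j A')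
    choose l hl using hl
    have h1 := DFunLike.congr_fun (dualModel_comp_inl q) (fun j => e (l j))
    refine Eq.trans ?_ h1
    change _ = q.1 (fun j => (e (l j), (0 : V n)))
    congr 1
    ext1 j
    simp [hl]

/-- The covector `B^ν_A dy^A ∧ d^{m-1}x_ν`, where `d^{m-1}x_ν = i(∂/∂x^ν) ω`. -/
def dualOfMap (vol : V m [⋀^Fin m]→L[ℝ] ℝ) (b : V n →L[ℝ] V m) : DualModel m n :=
  ⟨vol.fderivCompContinuousLinearMap (modelProj m n) (b.comp (ContinuousLinearMap.snd ℝ (V m) (V n))),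
    by
    have key : ∀ w, vol.fderivCompContinuousLinearMap (modelProj m n)
        (b.comp (ContinuousLinearMap.snd ℝ (V m) (V n))) w =
        ∑ i, vol (update (fun j => (w j).1) i (b (w i).2)) := by
      intro w
      rw [ContinuousAlternatingMap.fderivCompContinuousLinearMap_apply]
      refine Finset.sum_congr rfl fun i _ => ?_
      congr 1
      ext1 j
      by_cases hj : j = i
      · subst hj; simp
      · simp [update_of_ne hj]
    refine ⟨fun w i j hij hi hj => ?_, ?_⟩
    · rw [key]
      refine Finset.sum_eq_zero fun k _ => ?_
      have hi' : (w i).1 = 0 := hi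
      have hj' : (w j).1 = 0 := hj
      by_cases hk : i = k
      · have hjk : j ≠ k := fun h => hij (hk.trans h.symm)
        exact vol.map_coord_zero j (by simp [update_of_ne hjk, hj'])
      · exact vol.map_coord_zero i (by simp [update_of_ne hk, hi'])
    · ext w
      refine (key _).trans (Finset.sum_eq_zero fun k _ => ?_)
      exact vol.map_coord_zero k (by simp)⟩

lemma dualOfMap_apply (vol : V m [⋀^Fin m]→L[ℝ] ℝ) (b : V n →L[ℝ] V m) (w : Fin m → V m × V n) :
    (dualOfMap vol b).1 w = ∑ i, vol (update (fun j => (w j).1) i (b (w i).2)) := by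
  change vol.fderivCompContinuousLinearMap (modelProj m n)
        (b.comp (ContinuousLinearMap.snd ℝ (V m) (V n))) w = _
  rw [ContinuousAlternatingMap.fderivCompContinuousLinearMap_apply]
  refine Finset.sum_congr rfl fun i _ => ?_
  congr 1
  ext1 j
  by_cases hj : j = i
  · subst hj; simp
  · simp [update_of_ne hj]

/-- Pulling back along the graph of `v` turns the covector into the infinitesimal action of `b ∘ v`
on the volume form, which is multiplication by the trace. -/
lemma pairing_dualOfMap (vol : V m [⋀^Fin m]→L[ℝ] ℝ) (b : V n →L[ℝ] V m) (v : V m →L[ℝ] V n) :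
    pairing m n (dualOfMap vol b).1 v = (∑ ν, b (v (EuclideanSpace.single ν 1)) ν) • vol := by
  rw [← dualModel_comp_graph]
  ext u
  change (dualOfMap vol b).1 (fun j => (u j, v (u j))) = _ * vol u
  rw [dualOfMap_apply]
  exact sum_map_update_eq_trace_smul vol (b.comp v) u

/-- Taking $b=dy^A\otimes e_\rho$ in `dualOfMap`, the trace of `b ∘ v` is the single coefficient
$v^A_\rho$; a nonzero volume form detects it. -/
lemma pairing_eq_zero_right {vol : V m [⋀^Fin m]→L[ℝ] ℝ} (hvol : vol ≠ 0) (v : V m →L[ℝ] V n)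
    (h : ∀ q : DualModel m n, pairing m n q.1 v = 0) : v = 0 := by
  have key : ∀ ρ A, v (EuclideanSpace.single ρ 1) A = 0 := by
    intro ρ A
    have h1 := h (dualOfMap vol ((EuclideanSpace.proj A : V n →L[ℝ] ℝ).smulRight
      (EuclideanSpace.single ρ (1 : ℝ))))
    rw [pairing_dualOfMap] at h1
    have h2 := (smul_eq_zero.1 h1).resolve_right hvol
    simpa [Pi.single_apply] using h2
  apply ContinuousLinearMap.coe_injective
  refine (EuclideanSpace.basisFun (Fin m) ℝ).toBasis.ext fun ρ => ?_
  ext A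
  simpa using key ρ A

/-! ### Linear left inverses on the typical fibres -/

instance : FiniteDimensional ℝ (DualModel m n) := by
  have := finiteDimensional_covectors (V m × V n) m
  exact inferInstanceAs (FiniteDimensional ℝ (dualModelSubmodule m n))

/-- The inclusion of the typical fibre of `J¹π*` into the covectors. -/
def DualModel.incl (m n : ℕ) : DualModel m n →L[ℝ] ((V m × V n) [⋀^Fin m]→L[ℝ] ℝ) :=
  (dualModelSubmodule m n).subtypeL

/-- The inclusion of the typical fibre of `Mπ` into the covectors. -/
def MomentumModel.incl (m n : ℕ) : MomentumModel m n →L[ℝ] ((V m × V n) [⋀^Fin m]→L[ℝ] ℝ) :=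
  (twoVertical m (LinearMap.ker (modelProj m n).toLinearMap)).subtypeL

/-- The pairing, on the typical fibre of `J¹π*`. -/
def pairingDual (m n : ℕ) :
    DualModel m n →L[ℝ] (V m →L[ℝ] V n) →L[ℝ] (V m [⋀^Fin m]→L[ℝ] ℝ) :=
  (pairing m n).comp (DualModel.incl m n)

lemma ContinuousLinearMap.exists_leftInverse_of_injective' {A C : Type*} [NormedAddCommGroup A]
    [NormedSpace ℝ A] [NormedAddCommGroup C] [NormedSpace ℝ C] [FiniteDimensional ℝ C]
    (g : A →L[ℝ] C) (hg : Injective g) : ∃ r : C →L[ℝ] A, ∀ a, r (g a) = a := by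
  obtain ⟨r, hr⟩ := LinearMap.exists_leftInverse_of_injective g.toLinearMap
    (LinearMap.ker_eq_bot.2 hg)
  exact ⟨LinearMap.toContinuousLinearMap r, fun a => DFunLike.congr_fun hr a⟩

/-- Finite dimension and nondegeneracy allow the momenta to be recovered from their pairings by a
fixed continuous linear map. The Legendre momenta thereby become a visibly smooth function of
$\partial\pounds/\partial v$ and the volume form. -/
lemma exists_pairing_leftInverse (m n : ℕ) :
    ∃ r : ((V m →L[ℝ] V n) →L[ℝ] (V m [⋀^Fin m]→L[ℝ] ℝ)) →L[ℝ] DualModel m n,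
      ∀ q : DualModel m n, r (pairingDual m n q) = q := by
  have := finiteDimensional_covectors (V m) m
  refine ContinuousLinearMap.exists_leftInverse_of_injective' (A := DualModel m n)
    (C := (V m →L[ℝ] V n) →L[ℝ] (V m [⋀^Fin m]→L[ℝ] ℝ)) (pairingDual m n) ?_
  rw [injective_iff_map_eq_zero]
  exact fun q hq => pairing_eq_zero_left q fun v => DFunLike.congr_fun hq v

lemma exists_momentumModel_retraction (m n : ℕ) :
    ∃ P : ((V m × V n) [⋀^Fin m]→L[ℝ] ℝ) →L[ℝ] MomentumModel m n,
      ∀ q : MomentumModel m n, P (MomentumModel.incl m n q) = q :=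
  exists_projection (twoVertical m (LinearMap.ker (modelProj m n).toLinearMap))

/-! ## Pointwise form of the field equations -/

section Pointwise

variable {F : Type*} [NormedAddCommGroup F] [NormedSpace ℝ F]
  {X : Type*} [TopologicalSpace X] [ChartedSpace F X]
  {F' : Type*} [NormedAddCommGroup F'] [NormedSpace ℝ F']
  {Y : Type*} [TopologicalSpace Y] [ChartedSpace F' Y] [IsManifold 𝓘(ℝ, F') ∞ Y]

/-- Every tangent vector is a value of a smooth vector field. -/
lemma exists_isSmoothVectorField [FiniteDimensional ℝ F'] [T2Space Y] (y : Y)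
    (v : TangentSpace 𝓘(ℝ, F') y) :
    ∃ Z : (y : Y) → TangentSpace 𝓘(ℝ, F') y, IsSmoothVectorField Z ∧ Z y = v := by
  have : IsManifold 𝓘(ℝ, F') (∞ + 1) Y := by simpa using ‹IsManifold 𝓘(ℝ, F') ∞ Y›
  obtain ⟨s, hs, hsv⟩ := FiberBundle.exists_contMDiffOn_extend (k := ∞) 𝓘(ℝ, F') F'
    (V := (TangentSpace 𝓘(ℝ, F') : Y → Type _)) (x₀ := y) v
  -- The local extension of `v` is smooth only near `y`. A bump function supported in that
  -- neighbourhood, equal to one at `y`, makes it global; this uses that `Y` is Hausdorff.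
  obtain ⟨f, -, hf⟩ := (SmoothBumpFunction.nhds_basis_tsupport (I := 𝓘(ℝ, F')) y).mem_iff.1
    (interior_mem_nhds.2 hs)
  refine ⟨fun y' => f y' • FiberBundle.extend F' v y', ?_, ?_⟩
  · refine ContMDiffOn.smul_section_of_tsupport (u := interior s) ?_ isOpen_interior hf
      (hsv.mono interior_subset)
    exact f.contMDiff.contMDiffOn
  · change f y • FiberBundle.extend F' v y = v
    rw [f.eq_one, FiberBundle.extend_apply_self, one_smul]

/-- The field equation at each point. -/
def PointwiseFieldEquationOn {k : ℕ} (Ω : DForm F' Y (k + 1)) (ψ : X → Y) (S : Set X) : Prop :=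
  ∀ x ∈ S, ∀ (v : TangentSpace 𝓘(ℝ, F') (ψ x)) (u : Fin k → TangentSpace 𝓘(ℝ, F) x),
    Ω (ψ x) (Fin.cons v (fun i => mfderiv 𝓘(ℝ, F) 𝓘(ℝ, F') ψ x (u i))) = 0

lemma PointwiseFieldEquationOn.fieldEquationOn {k : ℕ} {Ω : DForm F' Y (k + 1)} {ψ : X → Y}
    {S : Set X} (h : PointwiseFieldEquationOn (F := F) Ω ψ S) : FieldEquationOn (F := F) Ω ψ S :=
  fun Z _ x hx u => h x hx (Z (ψ x)) u

/-- The contraction at `x` depends only on the value of the field at `ψ x`, and every tangent vector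
there is such a value. -/
lemma fieldEquationOn_iff [FiniteDimensional ℝ F'] [T2Space Y] {k : ℕ} {Ω : DForm F' Y (k + 1)}
    {ψ : X → Y} {S : Set X} :
    FieldEquationOn (F := F) Ω ψ S ↔ PointwiseFieldEquationOn (F := F) Ω ψ S := by
  refine ⟨fun h x hx v u => ?_, fun h => h.fieldEquationOn⟩
  obtain ⟨Z, hZ, rfl⟩ := exists_isSmoothVectorField (ψ x) v
  exact h Z hZ x hx u

end Pointwise

/-! ## Submersions -/

/-- A submersion is locally a projection `H' × F → H'`, in smooth coordinates `(k ∘ f, ·)` with inverse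
`Γ` on a ball. -/
lemma exists_localProjection {H H' : Type*} [NormedAddCommGroup H] [NormedSpace ℝ H]
    [NormedAddCommGroup H'] [NormedSpace ℝ H']
    {X : Type*} [TopologicalSpace X] [ChartedSpace H X] [IsManifold 𝓘(ℝ, H) ∞ X]
    {Y : Type*} [TopologicalSpace Y] [ChartedSpace H' Y] [IsManifold 𝓘(ℝ, H') ∞ Y]
    {F : Type*} [NormedAddCommGroup F] [NormedSpace ℝ F] {f : X → Y} {x : X}
    (hf : IsSubmersionAtOfComplement F 𝓘(ℝ, H) 𝓘(ℝ, H') ∞ f x) :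
    ∃ (Γ : H' × F → X) (k : OpenPartialHomeomorph Y H') (s₀ : F) (r : ℝ), 0 < r ∧
      f x ∈ k.source ∧ ContMDiffOn 𝓘(ℝ, H') 𝓘(ℝ, H') ∞ k k.source ∧ Γ (k (f x), s₀) = x ∧
      ContMDiffOn 𝓘(ℝ, H' × F) 𝓘(ℝ, H) ∞ Γ (Metric.ball (k (f x)) r ×ˢ Metric.ball s₀ r) ∧
      (∀ p ∈ Metric.ball (k (f x)) r ×ˢ Metric.ball s₀ r,
        f (Γ p) ∈ k.source ∧ k (f (Γ p)) = p.1) ∧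
      ∀ᶠ z in 𝓝 x, ∃ s ∈ Metric.ball s₀ r, z = Γ (k (f z), s) := by
  let c := hf.domChart
  let k := hf.codChart
  let e := hf.equiv
  have hx : x ∈ c.source := hf.mem_domChart_source
  have hfx : f x ∈ k.source := hf.mem_codChart_source
  have hw : ∀ z ∈ c.source, k (f z) = (e (c z)).1 := by
    intro z hz
    have hzt : c z ∈ (c.extend 𝓘(ℝ, H)).target := by simpa using c.map_source hz
    have h := hf.writtenInCharts hzt
    change k (f (c.symm (c z))) = (e (c z)).1 at h
    rwa [c.left_inv hz] at h
  have hmaps : ∀ z ∈ c.source, f z ∈ k.source := fun z hz =>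
    hf.mapsto_domChart_source_codChart_source hz
  have hT : IsOpen (e.symm ⁻¹' c.target) := c.open_target.preimage e.symm.continuous
  -- The first coordinate of `x` in the domain chart is the coordinate of its image, so `s₀` must be
  -- the second coordinate of `x`.
  have hp : (k (f x), (e (c x)).2) = e (c x) := Prod.ext (hw x hx) rfl
  have hpT : (k (f x), (e (c x)).2) ∈ e.symm ⁻¹' c.target := by
    rw [hp, mem_preimage, e.symm_apply_apply]
    exact c.map_source hx
  obtain ⟨r, hr, hball⟩ := Metric.isOpen_iff.1 hT _ hpT
  rw [← ball_prod_same] at hball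
  refine ⟨fun p => c.symm (e.symm p), k, (e (c x)).2, r, hr, hfx,
    contMDiffOn_of_mem_maximalAtlas hf.codChart_mem_maximalAtlas, ?_, ?_, ?_, ?_⟩
  · change c.symm (e.symm (k (f x), (e (c x)).2)) = x
    rw [hp, e.symm_apply_apply, c.left_inv hx]
  · exact (contMDiffOn_symm_of_mem_maximalAtlas hf.domChart_mem_maximalAtlas).comp
      e.symm.contDiff.contMDiff.contMDiffOn hball
  · intro p hp
    have h1 := c.map_target (hball hp)
    refine ⟨hmaps _ h1, ?_⟩
    rw [hw _ h1, c.right_inv (hball hp), e.apply_symm_apply]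
  · have hcont : ContinuousAt (fun z => (e (c z)).2) x :=
      ContinuousAt.comp (g := fun y => (e y).2) (continuous_snd.comp e.continuous).continuousAt
        (c.continuousAt hx)
    filter_upwards [c.open_source.mem_nhds hx, hcont.preimage_mem_nhds
      (Metric.ball_mem_nhds _ hr)] with z hz hz'
    refine ⟨(e (c z)).2, hz', ?_⟩
    have h1 : (k (f z), (e (c z)).2) = e (c z) := Prod.ext (hw z hz) rfl
    rw [h1, e.symm_apply_apply, c.left_inv hz]

section Bundle

variable {m n : ℕ} {E M : Type*}
  [TopologicalSpace E] [ChartedSpace (V (m + n)) E] [IsManifold 𝓘(ℝ, V (m + n)) ∞ E]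
  [TopologicalSpace M] [ChartedSpace (V m) M] [IsManifold 𝓘(ℝ, V m) ∞ M]

namespace NaturalBundle

variable {B : ConfigurationBundle m n E M} {S : E → Type}
  {F : Type} [NormedAddCommGroup F] [NormedSpace ℝ F] (N : NaturalBundle B S F)

/-! ## Smooth maps into and out of the total spaces -/

/-- The chart `N.chart e` as a partial homeomorphism. -/
def homeoChart (e : E) : OpenPartialHomeomorph N.Total ((V m × V n) × F) :=
  N.core.openPartialHomeomorph (N.chart e) (mem_range_self e)

lemma homeoChart_mem_maximalAtlas (e : E) :
    N.homeoChart e ∈ IsManifold.maximalAtlas 𝓘(ℝ, (V m × V n) × F) ∞ N.Total := by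
  -- The chart indexed by `e` is the preferred chart at every point over `e`; the zero fibre
  -- coordinate only supplies one such point.
  exact IsManifold.chart_mem_maximalAtlas (⟨e, (N.triv e ((B.chartNear e).frame
    (B.mem_chartNear e))).symm 0⟩ : N.Total)

lemma contMDiffOn_coord (e : E) :
    ContMDiffOn 𝓘(ℝ, (V m × V n) × F) 𝓘(ℝ, (V m × V n) × F) ∞ (N.coord e)
      {p | p.base ∈ (B.chartNear e).c.source} :=
  contMDiffOn_of_mem_maximalAtlas (N.homeoChart_mem_maximalAtlas e)

lemma contMDiffOn_ofCoord (e : E) :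
    ContMDiffOn 𝓘(ℝ, (V m × V n) × F) 𝓘(ℝ, (V m × V n) × F) ∞ (N.ofCoord e)
      {z | z.1 ∈ (B.chartNear e).c.target} :=
  contMDiffOn_symm_of_mem_maximalAtlas (N.homeoChart_mem_maximalAtlas e)

lemma isOpen_coord_source (e : E) : IsOpen {p : N.Total | p.base ∈ (B.chartNear e).c.source} :=
  (N.homeoChart e).open_source

lemma isOpen_coord_target (B : ConfigurationBundle m n E M) (F : Type) [NormedAddCommGroup F]
    (e : E) : IsOpen {z : (V m × V n) × F | z.1 ∈ (B.chartNear e).c.target} :=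
  (B.chartNear e).c.open_target.preimage continuous_fst

lemma contMDiffAt_coord {e : E} {p : N.Total} (h : p.base ∈ (B.chartNear e).c.source) :
    ContMDiffAt 𝓘(ℝ, (V m × V n) × F) 𝓘(ℝ, (V m × V n) × F) ∞ (N.coord e) p :=
  (N.contMDiffOn_coord e).contMDiffAt ((N.isOpen_coord_source e).mem_nhds h)

lemma contMDiffAt_ofCoord {e : E} {z : (V m × V n) × F} (h : z.1 ∈ (B.chartNear e).c.target) :
    ContMDiffAt 𝓘(ℝ, (V m × V n) × F) 𝓘(ℝ, (V m × V n) × F) ∞ (N.ofCoord e) z :=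
  (N.contMDiffOn_ofCoord e).contMDiffAt ((isOpen_coord_target B F e).mem_nhds h)

lemma ofCoord_coord {e : E} {p : N.Total} (h : p.base ∈ (B.chartNear e).c.source) :
    N.ofCoord e (N.coord e p) = p :=
  (N.homeoChart e).left_inv h

lemma coord_ofCoord {e : E} {z : (V m × V n) × F} (h : z.1 ∈ (B.chartNear e).c.target) :
    N.coord e (N.ofCoord e z) = z :=
  (N.homeoChart e).right_inv h

lemma base_ofCoord {e : E} {z : (V m × V n) × F} (h : z.1 ∈ (B.chartNear e).c.target) :
    (N.ofCoord e z).base = (B.chartNear e).c.symm z.1 := by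
  rw [N.ofCoord_of_mem h]

lemma contMDiff_base : ContMDiff 𝓘(ℝ, (V m × V n) × F) 𝓘(ℝ, V (m + n)) ∞
    (Total.base : N.Total → E) := by
  intro p
  have hp := B.mem_chartNear p.base
  have h1 : ContMDiffAt 𝓘(ℝ, (V m × V n) × F) 𝓘(ℝ, V m × V n) ∞
      (fun q : N.Total => (N.coord p.base q).1) p :=
    (contDiff_fst (𝕜 := ℝ) (E := V m × V n) (F := F)).contMDiff.contMDiffAt.comp p
      (N.contMDiffAt_coord hp)
  have h2 : ContMDiffAt 𝓘(ℝ, V m × V n) 𝓘(ℝ, V (m + n)) ∞ (B.chartNear p.base).c.symm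
      ((N.coord p.base p).1) :=
    (B.chartNear p.base).smooth_symm.contMDiffAt
      ((B.chartNear p.base).c.open_target.mem_nhds ((B.chartNear p.base).c.map_source hp))
  refine (h2.comp p h1).congr_of_eventuallyEq ?_
  filter_upwards [(N.isOpen_coord_source p.base).mem_nhds hp] with q hq
  exact ((B.chartNear p.base).c.left_inv hq).symm

section Maps

variable {H : Type*} [NormedAddCommGroup H] [NormedSpace ℝ H]
  {X : Type*} [TopologicalSpace X] [ChartedSpace H X]

/-- The first coordinate is a chart of `E` applied to the base map. Smoothness of the base map also
supplies the continuity that keeps nearby values inside the chart. -/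
lemma contMDiffAt_iff_coord {f : X → N.Total} {x : X} {e : E}
    (he : (f x).base ∈ (B.chartNear e).c.source)
    (hb : ContMDiffAt 𝓘(ℝ, H) 𝓘(ℝ, V (m + n)) ∞ (fun x => (f x).base) x)
    (hf : ContMDiffAt 𝓘(ℝ, H) 𝓘(ℝ, F) ∞ (fun x => (N.coord e (f x)).2) x) :
    ContMDiffAt 𝓘(ℝ, H) 𝓘(ℝ, (V m × V n) × F) ∞ f x := by
  have h1 : ContMDiffAt 𝓘(ℝ, H) 𝓘(ℝ, V m × V n) ∞ (fun x => (N.coord e (f x)).1) x :=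
    ContMDiffAt.comp (g := (B.chartNear e).c) x
      ((B.chartNear e).smooth.contMDiffAt ((B.chartNear e).c.open_source.mem_nhds he)) hb
  have h2 : ContMDiffAt 𝓘(ℝ, H) 𝓘(ℝ, (V m × V n) × F) ∞ (fun x => N.coord e (f x)) x :=
    h1.prodMk_space hf
  have h3 := (N.contMDiffAt_ofCoord (e := e) (z := N.coord e (f x))
    ((B.chartNear e).c.map_source he)).comp x h2
  refine h3.congr_of_eventuallyEq ?_
  filter_upwards [hb.continuousAt.preimage_mem_nhds ((B.chartNear e).c.open_source.mem_nhds he)]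
    with x' hx'
  exact (N.ofCoord_coord hx').symm

/-- The tangent space of the total space at `p` is identified with its model by the chart at `p`. -/
lemma mfderiv_coord_self (p : N.Total) :
    mfderiv 𝓘(ℝ, (V m × V n) × F) 𝓘(ℝ, (V m × V n) × F) (N.coord p.base) p =
      ContinuousLinearMap.id ℝ ((V m × V n) × F) := by
  have := mfderiv_extChartAt_self (I := 𝓘(ℝ, (V m × V n) × F)) (x := p)
  exact this

lemma hasMFDerivAt_coord_self (p : N.Total) :
    HasMFDerivAt 𝓘(ℝ, (V m × V n) × F) 𝓘(ℝ, (V m × V n) × F) (N.coord p.base) p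
      (ContinuousLinearMap.id ℝ ((V m × V n) × F)) := by
  rw [← N.mfderiv_coord_self p]
  exact ((N.contMDiffAt_coord (B.mem_chartNear p.base)).mdifferentiableAt (by simp)).hasMFDerivAt

/-- The derivative of a map into the total space is that of its coordinates. -/
lemma mfderiv_eq_mfderiv_coord {f : X → N.Total} {x : X}
    (hf : MDifferentiableAt 𝓘(ℝ, H) 𝓘(ℝ, (V m × V n) × F) f x) :
    mfderiv 𝓘(ℝ, H) 𝓘(ℝ, (V m × V n) × F) f x =
      mfderiv 𝓘(ℝ, H) 𝓘(ℝ, (V m × V n) × F) (fun x' => N.coord (f x).base (f x')) x :=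
  (HasMFDerivAt.comp x (N.hasMFDerivAt_coord_self (f x)) hf.hasMFDerivAt).mfderiv.symm

lemma hasMFDerivAt_of_coord {f : N.Total → X} {p : N.Total} {g : (V m × V n) × F → X}
    {g' : (V m × V n) × F →L[ℝ] H}
    (hg : HasMFDerivAt 𝓘(ℝ, (V m × V n) × F) 𝓘(ℝ, H) g (N.coord p.base p) g')
    (hfg : ∀ q : N.Total, q.base ∈ (B.chartNear p.base).c.source → f q = g (N.coord p.base q)) :
    HasMFDerivAt 𝓘(ℝ, (V m × V n) × F) 𝓘(ℝ, H) f p g' := by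
  have h := HasMFDerivAt.comp p hg (N.hasMFDerivAt_coord_self p)
  refine HasMFDerivAt.congr_of_eventuallyEq h ?_
  filter_upwards [(N.isOpen_coord_source p.base).mem_nhds (B.mem_chartNear p.base)] with q hq
  exact hfg q hq

end Maps

/-- Points in the same fibre are separated within one chart, points in different fibres by their
projections. Through this `W₀` and `J¹π` inherit the Hausdorff property needed for bump functions.
-/
instance [T2Space E] : T2Space N.Total := by
  refine ⟨fun p p' hpp' => ?_⟩
  by_cases hb : p.base = p'.base
  · have hp := B.mem_chartNear p.base
    have hp' : p'.base ∈ (B.chartNear p.base).c.source := hb ▸ hp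
    have hne : N.homeoChart p.base p ≠ N.homeoChart p.base p' := fun h =>
      hpp' ((N.homeoChart p.base).injOn hp hp' h)
    obtain ⟨u, v, hu, hv, hpu, hpv, huv⟩ := t2_separation hne
    refine ⟨_, _, (N.homeoChart p.base).isOpen_inter_preimage hu,
      (N.homeoChart p.base).isOpen_inter_preimage hv, ⟨hp, hpu⟩, ⟨hp', hpv⟩, ?_⟩
    exact (huv.preimage _).mono inter_subset_right inter_subset_right
  · obtain ⟨u, v, hu, hv, hpu, hpv, huv⟩ := t2_separation hb
    exact ⟨_, _, hu.preimage N.contMDiff_base.continuous, hv.preimage N.contMDiff_base.continuous,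
      hpu, hpv, huv.preimage _⟩

end NaturalBundle

open ConfigurationBundle

namespace NaturalBundle

variable {B : ConfigurationBundle m n E M} {S : E → Type}
  {F : Type} [NormedAddCommGroup F] [NormedSpace ℝ F] (N : NaturalBundle B S F)

/-! ## Pullbacks of the canonical forms in coordinates -/

/-- The form `∑ᵢ (-1)ⁱ A(wᵢ)(pr w₀, …, omit i, …, pr wₘ)`: the value of the exterior derivative
of a form `z ↦ α(z) ∘ pr` with `A = Dα`. -/
def altSum {G : Type*} [NormedAddCommGroup G] [NormedSpace ℝ G]
    (A : (V m × V n) × G →L[ℝ] ((V m × V n) [⋀^Fin m]→L[ℝ] ℝ))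
    (w : Fin (m + 1) → (V m × V n) × G) : ℝ :=
  ∑ i : Fin (m + 1), (-1) ^ (i : ℕ) • A (w i) (fun j => (w (i.succAbove j)).1)

/-- The coordinate expression of a family of multimomenta on the total space of a bundle. -/
def symbol (f : ∀ p : N.Total, B.MomentumFibre p.base) (e : E) (z : (V m × V n) × F) :
    MomentumModel m n :=
  (B.momentumBundle.coord e ⟨(N.ofCoord e z).base, f (N.ofCoord e z)⟩).2

/-- The form on the total space defined by a family of multimomenta. -/
def tautForm (f : ∀ p : N.Total, B.MomentumFibre p.base) : DForm ((V m × V n) × F) N.Total m :=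
  fun p => (f p).1.compContinuousLinearMap
    (mfderiv 𝓘(ℝ, (V m × V n) × F) 𝓘(ℝ, V (m + n)) (Total.base : N.Total → E) p)

lemma symbol_apply (f : ∀ p : N.Total, B.MomentumFibre p.base) {e : E} {z : (V m × V n) × F}
    (hz' : (N.ofCoord e z).base ∈ (B.chartNear e).c.source) :
    (N.symbol f e z).1 = (f (N.ofCoord e z)).1.compContinuousLinearMap
      ((B.chartNear e).frame hz').D.symm.toContinuousLinearMap := by
  unfold symbol
  rw [B.momentumBundle.coord_of_mem (p := ⟨(N.ofCoord e z).base, f (N.ofCoord e z)⟩) hz']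
  rfl

lemma base_ofCoord_mem {e : E} {z : (V m × V n) × F} (hz : z.1 ∈ (B.chartNear e).c.target) :
    (N.ofCoord e z).base ∈ (B.chartNear e).c.source := by
  rw [N.base_ofCoord hz]
  exact (B.chartNear e).c.map_target hz

/-- In coordinates the projection to `E` is `c.symm` after the first projection, and the derivative
of `c.symm` is the inverse of the frame. -/
lemma mfderiv_base_comp_mfderiv_ofCoord {e : E} {z : (V m × V n) × F}
    (hz : z.1 ∈ (B.chartNear e).c.target)
    (hz' : (N.ofCoord e z).base ∈ (B.chartNear e).c.source) :
    (mfderiv 𝓘(ℝ, (V m × V n) × F) 𝓘(ℝ, V (m + n)) (Total.base : N.Total → E)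
      (N.ofCoord e z)).comp
      (mfderiv 𝓘(ℝ, (V m × V n) × F) 𝓘(ℝ, (V m × V n) × F) (N.ofCoord e) z) =
    (((B.chartNear e).frame hz').D.symm.toContinuousLinearMap).comp
      (ContinuousLinearMap.fst ℝ (V m × V n) F) := by
  have h1 := HasMFDerivAt.comp z
    ((N.contMDiff_base (N.ofCoord e z)).mdifferentiableAt (by simp)).hasMFDerivAt
    ((N.contMDiffAt_ofCoord hz).mdifferentiableAt (by simp)).hasMFDerivAt
  have h2 : HasMFDerivAt 𝓘(ℝ, (V m × V n) × F) 𝓘(ℝ, V (m + n))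
      (fun z' : (V m × V n) × F => (B.chartNear e).c.symm z'.1) z
      ((mfderiv 𝓘(ℝ, V m × V n) 𝓘(ℝ, V (m + n)) (B.chartNear e).c.symm z.1).comp
        (ContinuousLinearMap.fst ℝ (V m × V n) F)) :=
    HasMFDerivAt.comp z ((B.chartNear e).mdiff.mdifferentiableAt_symm hz).hasMFDerivAt
      (ContinuousLinearMap.fst ℝ (V m × V n) F).hasMFDerivAt
  have h3 : (fun z' : (V m × V n) × F => (B.chartNear e).c.symm z'.1) =ᶠ[𝓝 z]
      (Total.base : N.Total → E) ∘ N.ofCoord e := by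
    filter_upwards [(isOpen_coord_target B F e).mem_nhds hz] with z' hz''
    exact (N.base_ofCoord hz'').symm
  have h4 := hasMFDerivAt_unique h1 (h2.congr_of_eventuallyEq h3.symm)
  rw [h4]
  -- The inverse frame is the derivative of `c.symm` at the coordinates of the base point, which
  -- have to be identified with `z.1`.
  have h5 : (B.chartNear e).c (N.ofCoord e z).base = z.1 := by
    rw [N.base_ofCoord hz, (B.chartNear e).c.right_inv hz]
  congr 1
  change _ = mfderiv 𝓘(ℝ, V m × V n) 𝓘(ℝ, V (m + n)) (B.chartNear e).c.symm
    ((B.chartNear e).c (N.ofCoord e z).base)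
  rw [h5]

/-- The frame in the symbol cancels against the derivative of the chart. What remains is the symbol
composed with a constant projection, so only the coefficients get differentiated. -/
lemma tautForm_inChart (f : ∀ p : N.Total, B.MomentumFibre p.base) (p : N.Total)
    {z : (V m × V n) × F} (hz : z.1 ∈ (B.chartNear p.base).c.target) :
    (N.tautForm f).inChart p z = (N.symbol f p.base z).1.compContinuousLinearMap
      (ContinuousLinearMap.fst ℝ (V m × V n) F) := by
  have hz' := N.base_ofCoord_mem hz
  have h := N.mfderiv_base_comp_mfderiv_ofCoord hz hz'
  rw [N.symbol_apply f hz']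
  ext w
  change (f (N.ofCoord p.base z)).1 (fun i => ((mfderiv 𝓘(ℝ, (V m × V n) × F) 𝓘(ℝ, V (m + n))
    (Total.base : N.Total → E) (N.ofCoord p.base z)).comp
      (mfderiv 𝓘(ℝ, (V m × V n) × F) 𝓘(ℝ, (V m × V n) × F) (N.ofCoord p.base) z)) (w i)) = _
  rw [h]
  rfl

/-- The exterior derivative of the form defined by a family of multimomenta. -/
lemma d_tautForm (f : ∀ p : N.Total, B.MomentumFibre p.base) (p : N.Total)
    {A : (V m × V n) × F →L[ℝ] ((V m × V n) [⋀^Fin m]→L[ℝ] ℝ)}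
    (hA : HasFDerivAt (fun z => MomentumModel.incl m n (N.symbol f p.base z)) A
      (N.coord p.base p)) (w : Fin (m + 1) → (V m × V n) × F) :
    (N.tautForm f).d p w = altSum A w := by
  have hp := B.mem_chartNear p.base
  have h1 : (N.tautForm f).inChart p =ᶠ[𝓝 (N.coord p.base p)] fun z =>
      (MomentumModel.incl m n (N.symbol f p.base z)).compContinuousLinearMap
        (ContinuousLinearMap.fst ℝ (V m × V n) F) := by
    filter_upwards [(isOpen_coord_target B F p.base).mem_nhds
      ((B.chartNear p.base).c.map_source hp)] with z hz
    exact N.tautForm_inChart f p hz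
  let pr : ((V m × V n) [⋀^Fin m]→L[ℝ] ℝ) →L[ℝ] (((V m × V n) × F) [⋀^Fin m]→L[ℝ] ℝ) :=
    ContinuousAlternatingMap.compContinuousLinearMapCLM (ContinuousLinearMap.fst ℝ (V m × V n) F)
  have h2 := pr.hasFDerivAt.comp _ hA
  have h3 := h2.congr_of_eventuallyEq h1
  have h4 : (N.tautForm f).d p w = extDeriv ((N.tautForm f).inChart p) (N.coord p.base p)
      (fun i => mfderiv 𝓘(ℝ, (V m × V n) × F) 𝓘(ℝ, (V m × V n) × F) (N.coord p.base) p (w i)) :=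
    rfl
  -- The exterior derivative at `p` is taken in the preferred chart at `p`, whose differential there
  -- is the identity.
  rw [h4, N.mfderiv_coord_self]
  refine (extDeriv_apply h3.differentiableAt w).trans ?_
  unfold altSum
  refine Finset.sum_congr rfl fun i _ => ?_
  congr 1
  rw [fderiv_continuousAlternatingMap_apply_const_apply h3.differentiableAt, h3.fderiv]
  rfl

end NaturalBundle

variable (B : ConfigurationBundle m n E M)

lemma canonicalForm_eq_tautForm :
    canonicalForm B = B.momentumBundle.tautForm fun p => p.fib := rfl

/-- The symbol of the tautological family is the fibre coordinate itself, so its derivative is a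
constant linear projection. -/
lemma multisymplecticForm_apply (p : B.ExtMom) (w : Fin (m + 1) → ExtMomModel m n) :
    multisymplecticForm B p w = -NaturalBundle.altSum
      ((MomentumModel.incl m n).comp
        (ContinuousLinearMap.snd ℝ (V m × V n) (MomentumModel m n))) w := by
  change -((canonicalForm B).d p w) = _
  rw [canonicalForm_eq_tautForm, NaturalBundle.d_tautForm]
  refine HasFDerivAt.congr_of_eventuallyEq (ContinuousLinearMap.hasFDerivAt
    ((MomentumModel.incl m n).comp (ContinuousLinearMap.snd ℝ (V m × V n) (MomentumModel m n)))) ?_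
  filter_upwards [(NaturalBundle.isOpen_coord_target B (MomentumModel m n) p.base).mem_nhds
    ((B.chartNear p.base).c.map_source (B.mem_chartNear p.base))] with z hz
  change MomentumModel.incl m n (B.momentumBundle.coord p.base
    (B.momentumBundle.ofCoord p.base z)).2 = _
  rw [B.momentumBundle.coord_ofCoord hz]
  rfl

namespace NaturalBundle

variable {B} {S : E → Type}
  {F : Type} [NormedAddCommGroup F] [NormedSpace ℝ F] (N : NaturalBundle B S F)

/-- The derivative of the map into `Mπ` given by a family of multimomenta. -/
lemma mfderiv_toExtMom (f : ∀ p : N.Total, B.MomentumFibre p.base) (p : N.Total)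
    {A : (V m × V n) × F →L[ℝ] MomentumModel m n}
    (hA : HasFDerivAt (N.symbol f p.base) A (N.coord p.base p))
    (hf : MDifferentiableAt 𝓘(ℝ, (V m × V n) × F) 𝓘(ℝ, ExtMomModel m n)
      (fun q : N.Total => (⟨q.base, f q⟩ : B.ExtMom)) p) :
    mfderiv 𝓘(ℝ, (V m × V n) × F) 𝓘(ℝ, ExtMomModel m n)
      (fun q : N.Total => (⟨q.base, f q⟩ : B.ExtMom)) p =
      (ContinuousLinearMap.fst ℝ (V m × V n) F).prod A := by
  rw [B.momentumBundle.mfderiv_eq_mfderiv_coord hf]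
  refine HasMFDerivAt.mfderiv (N.hasMFDerivAt_of_coord
    (g := fun z => (z.1, N.symbol f p.base z)) ?_ ?_)
  · exact ((ContinuousLinearMap.fst ℝ (V m × V n) F).hasFDerivAt.prodMk hA).hasMFDerivAt
  · intro q hq
    have h := N.ofCoord_coord hq
    unfold symbol
    rw [h]
    rfl

/-- The pullback of the multisymplectic form by a map over `E`. -/
lemma multisymplecticForm_pullback (f : ∀ p : N.Total, B.MomentumFibre p.base) (p : N.Total)
    {A : (V m × V n) × F →L[ℝ] MomentumModel m n}
    (hA : HasFDerivAt (N.symbol f p.base) A (N.coord p.base p))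
    (hf : MDifferentiableAt 𝓘(ℝ, (V m × V n) × F) 𝓘(ℝ, ExtMomModel m n)
      (fun q : N.Total => (⟨q.base, f q⟩ : B.ExtMom)) p)
    (w : Fin (m + 1) → (V m × V n) × F) :
    (multisymplecticForm B).pullback (fun q : N.Total => (⟨q.base, f q⟩ : B.ExtMom)) p w =
      -altSum ((MomentumModel.incl m n).comp A) w := by
  change multisymplecticForm B _ (fun i => mfderiv 𝓘(ℝ, (V m × V n) × F) 𝓘(ℝ, ExtMomModel m n)
      (fun q : N.Total => (⟨q.base, f q⟩ : B.ExtMom)) p (w i)) = _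
  refine (multisymplecticForm_apply B _ _).trans ?_
  rw [N.mfderiv_toExtMom f p hA hf]
  rfl

/-- `f^*Ω = -d(f^*Θ)`. -/
lemma neg_d_tautForm (f : ∀ p : N.Total, B.MomentumFibre p.base) (p : N.Total)
    {A : (V m × V n) × F →L[ℝ] MomentumModel m n}
    (hA : HasFDerivAt (N.symbol f p.base) A (N.coord p.base p))
    (hf : MDifferentiableAt 𝓘(ℝ, (V m × V n) × F) 𝓘(ℝ, ExtMomModel m n)
      (fun q : N.Total => (⟨q.base, f q⟩ : B.ExtMom)) p) :
    -(N.tautForm f).d p =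
      (multisymplecticForm B).pullback (fun q : N.Total => (⟨q.base, f q⟩ : B.ExtMom)) p := by
  ext w
  refine Eq.trans ?_ (N.multisymplecticForm_pullback f p hA hf w).symm
  exact congrArg Neg.neg (N.d_tautForm f p ((MomentumModel.incl m n).hasFDerivAt.comp _ hA) w)

end NaturalBundle

end Bundle

section Lagrangian

variable {m n : ℕ} {E M : Type*}
  [TopologicalSpace E] [ChartedSpace (V (m + n)) E] [IsManifold 𝓘(ℝ, V (m + n)) ∞ E]
  [TopologicalSpace M] [ChartedSpace (V m) M] [IsManifold 𝓘(ℝ, V m) ∞ M]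

open ConfigurationBundle

variable {B : ConfigurationBundle m n E M}

lemma ConfigurationBundle.AdaptedFrame.T_D_symm {y : E} (a : B.AdaptedFrame y) (w : V m × V n) :
    B.T y (a.D.symm w) = a.D₀.symm w.1 := by
  apply a.D₀.injective
  rw [← a.fst_D]
  simp

lemma HasFDerivAt.fderiv_comp_affine {W X : Type*} [NormedAddCommGroup W] [NormedSpace ℝ W]
    [NormedAddCommGroup X] [NormedSpace ℝ X] {g : X → ℝ} {g' : X →L[ℝ] ℝ} {c : X}
    (hg : HasFDerivAt g g' c) (Φ : W →L[ℝ] X) :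
    fderiv ℝ (fun η => g (c + Φ η)) 0 = g'.comp Φ := by
  have h1 : HasFDerivAt (fun η => c + Φ η) Φ 0 := Φ.hasFDerivAt.const_add c
  have h2 : HasFDerivAt g g' (c + Φ 0) := by rwa [map_zero, add_zero]
  exact (h2.comp 0 h1).fderiv

namespace LagrangianSystem

variable (L : LagrangianSystem B)

/-! ## The Lagrangian in adapted coordinates -/

/-- The Lagrangian function in the coordinates around `e`. -/
def localLag (e : E) (z : J1Model m n) : ℝ := L.lag (B.jetBundle.ofCoord e z)

/-- The volume form in the coordinates around `e`. -/
def localVol (e : E) (s : V m) : V m [⋀^Fin m]→L[ℝ] ℝ :=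
  (L.vol ((B.chartNear e).c₀.symm s)).compContinuousLinearMap
    (mfderiv 𝓘(ℝ, V m) 𝓘(ℝ, V m) (B.chartNear e).c₀.symm s)

/-- The volume form in an adapted frame. -/
def frameVol {y : E} (a : B.AdaptedFrame y) : V m [⋀^Fin m]→L[ℝ] ℝ :=
  (L.volAt y).compContinuousLinearMap a.D₀.symm.toContinuousLinearMap

lemma frameVol_ne_zero {y : E} (a : B.AdaptedFrame y) : L.frameVol a ≠ 0 := by
  intro h
  refine L.vol_ne_zero (B.proj y) ?_
  ext u
  have h1 := DFunLike.congr_fun h (fun i => a.D₀ (u i))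
  refine Eq.trans (congrArg (L.vol (B.proj y)) (funext fun i => ?_)) h1
  exact (a.D₀.symm_apply_apply (u i)).symm

lemma localVol_eq_frameVol {e y : E} (hy : y ∈ (B.chartNear e).c.source) :
    L.localVol e ((B.chartNear e).c y).1 = L.frameVol ((B.chartNear e).frame hy) := by
  have h1 := (B.chartNear e).fst_eq y hy
  have h2 := (B.chartNear e).c₀.left_inv ((B.chartNear e).mapsTo hy)
  -- The point `c₀.symm (c₀ (π y))` equals `π y` only propositionally, while the type of `L.vol`
  -- depends on it; with a free point the equality can be substituted.
  have key : ∀ x : M, x = B.proj y → (L.vol x).compContinuousLinearMap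
      (mfderiv 𝓘(ℝ, V m) 𝓘(ℝ, V m) (B.chartNear e).c₀.symm ((B.chartNear e).c₀ (B.proj y))) =
      L.frameVol ((B.chartNear e).frame hy) := by
    rintro _ rfl
    rfl
  rw [h1]
  exact key _ h2

lemma contDiffOn_localLag (e : E) :
    ContDiffOn ℝ ∞ (L.localLag e) {z | z.1 ∈ (B.chartNear e).c.target} := by
  rw [← contMDiffOn_iff_contDiffOn]
  exact L.lag_smooth.comp_contMDiffOn (B.jetBundle.contMDiffOn_ofCoord e)

/-- Smoothness of the volume form is given in the preferred charts of `M`. Its expression in `c₀` is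
the pullback of one of these along the smooth change of coordinates `κ`. -/
lemma contDiffOn_localVol (e : E) :
    ContDiffOn ℝ ∞ (L.localVol e) (B.chartNear e).c₀.target := by
  intro s hs
  apply ContDiffAt.contDiffWithinAt
  set c₀ := (B.chartNear e).c₀ with hc₀
  set x := c₀.symm s with hx
  have hxs : x ∈ c₀.source := c₀.map_target hs
  let κ : V m → V m := chartAt (V m) x ∘ c₀.symm
  have hopen : IsOpen (c₀.target ∩ c₀.symm ⁻¹' (chartAt (V m) x).source) :=
    c₀.isOpen_inter_preimage_symm (chartAt (V m) x).open_source
  have hmem : s ∈ c₀.target ∩ c₀.symm ⁻¹' (chartAt (V m) x).source :=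
    ⟨hs, mem_chart_source (V m) x⟩
  have hκ : ContDiffOn ℝ ∞ κ (c₀.target ∩ c₀.symm ⁻¹' (chartAt (V m) x).source) := by
    rw [← contMDiffOn_iff_contDiffOn]
    refine (contMDiffOn_chart (I := 𝓘(ℝ, V m)) (x := x) (n := ∞)).comp
      ((B.chartNear e).smooth₀_symm.mono inter_subset_left) fun _ h => h.2
  have hκ' := hκ.fderiv_of_isOpen (m := ∞) hopen (by simp)
  have hvol := (L.vol_smooth x).comp hκ (fun t ht => (chartAt (V m) x).map_source ht.2)
  have hcomp := ((contDiff_pullback (V m) m).comp_contDiffOn (hvol.prodMk hκ')).contDiffAt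
    (hopen.mem_nhds hmem)
  refine hcomp.congr_of_eventuallyEq ?_
  filter_upwards [hopen.mem_nhds hmem] with t ht
  have hl : (chartAt (V m) x).symm (κ t) = c₀.symm t := (chartAt (V m) x).left_inv ht.2
  have hκt : HasFDerivAt κ (fderiv ℝ κ t) t :=
    ((hκ.contDiffAt (hopen.mem_nhds ht)).differentiableAt (by simp)).hasFDerivAt
  have hd : MDifferentiableAt 𝓘(ℝ, V m) 𝓘(ℝ, V m) (chartAt (V m) x).symm (κ t) :=
    mdifferentiableAt_atlas_symm (chart_mem_atlas _ x) ((chartAt (V m) x).map_source ht.2)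
  have h1 := HasMFDerivAt.comp t hd.hasMFDerivAt hκt.hasMFDerivAt
  have h2 : (chartAt (V m) x).symm ∘ κ =ᶠ[𝓝 t] c₀.symm := by
    filter_upwards [hopen.mem_nhds ht] with t' ht'
    exact (chartAt (V m) x).left_inv ht'.2
  have h3 := (h1.congr_of_eventuallyEq h2.symm).mfderiv
  have key : ∀ (x' : M), x' = c₀.symm t → (L.vol (c₀.symm t)).compContinuousLinearMap
      (mfderiv 𝓘(ℝ, V m) 𝓘(ℝ, V m) c₀.symm t) =
      (L.vol x').compContinuousLinearMap (mfderiv 𝓘(ℝ, V m) 𝓘(ℝ, V m) c₀.symm t) := by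
    rintro _ rfl
    rfl
  refine (key _ hl).trans ?_
  rw [h3]
  rfl

/-! ## The fibre derivative and the Legendre map in an adapted frame -/

/-- The fibre coordinates of a vertical vector-valued map. -/
def vertCoord {y : E} (a : B.AdaptedFrame y) : (V m →L[ℝ] B.vert y) →L[ℝ] (V m →L[ℝ] V n) :=
  (ContinuousLinearMap.precomp (V n) a.D₀.symm.toContinuousLinearMap).comp
    (ContinuousLinearMap.postcomp (V m) ((ContinuousLinearMap.snd ℝ (V m) (V n)).comp
      (a.D.toContinuousLinearMap.comp (B.vert y).subtypeL)))

lemma vertCoord_apply {y : E} (a : B.AdaptedFrame y) (η : V m →L[ℝ] B.vert y) (u : V m) :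
    vertCoord a η u = (a.D (η (a.D₀.symm u))).2 := rfl

/-- The derivative of the Lagrangian in the fibre coordinates. -/
def localFibreDeriv (e : E) (z : J1Model m n) : (V m →L[ℝ] V n) →L[ℝ] ℝ :=
  (fderiv ℝ (L.localLag e) z).comp (ContinuousLinearMap.inr ℝ (V m × V n) (V m →L[ℝ] V n))

lemma hasFDerivAt_localLag {e : E} {z : J1Model m n} (hz : z.1 ∈ (B.chartNear e).c.target) :
    HasFDerivAt (L.localLag e) (fderiv ℝ (L.localLag e) z) z :=
  (((L.contDiffOn_localLag e).contDiffAt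
    ((NaturalBundle.isOpen_coord_target B _ e).mem_nhds hz)).differentiableAt
      (by simp)).hasFDerivAt

/-- Adding a vertical-valued map to a jet translates the fibre coordinates by `vertCoord`, so the
derivative along the affine fibre becomes the partial derivative in $v^A_\nu$. -/
lemma fibreDeriv_eq_localFibreDeriv {e : E} (z : B.J1)
    (hz : z.base ∈ (B.chartNear e).c.source) (η : V m →L[ℝ] B.vert z.base) :
    L.fibreDeriv z η = L.localFibreDeriv e (B.jetBundle.coord e z)
      (vertCoord ((B.chartNear e).frame hz) η) := by
  have ht : (B.jetBundle.coord e z).1 ∈ (B.chartNear e).c.target :=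
    (B.chartNear e).c.map_source hz
  let Φ : (V m →L[ℝ] B.vert z.base) →L[ℝ] J1Model m n :=
    (ContinuousLinearMap.inr ℝ (V m × V n) (V m →L[ℝ] V n)).comp
      (vertCoord ((B.chartNear e).frame hz))
  have h3 := HasFDerivAt.fderiv_comp_affine (W := V m →L[ℝ] B.vert z.base)
    (X := J1Model m n) (L.hasFDerivAt_localLag ht) Φ
  unfold fibreDeriv
  refine Eq.trans ?_ (DFunLike.congr_fun h3 η)
  congr 2
  ext1 η
  symm
  change L.lag (B.jetBundle.ofCoord e _) = _
  congr 1
  refine Eq.trans ?_ (B.jetBundle.ofCoord_coord (e := e) ?_)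
  rotate_left
  · exact hz
  congr 1
  refine Eq.trans ?_ (B.jetBundle.coord_of_mem ?_).symm
  rotate_left
  · exact hz
  rw [B.jetBundle.coord_of_mem hz]
  refine Prod.ext ?_ ?_
  · simp [Φ]
  · ext1 u
    simp only [jetBundle, Prod.snd_add, _root_.add_apply]
    simp
    rfl

/-- The structure form is the identity on vertical vectors, so contracting the vertical differential
with one leaves $\partial\pounds/\partial v^A_\nu\,h^A$. -/
lemma D₀_verticalDiff {e : E} (z : B.J1) (hz : z.base ∈ (B.chartNear e).c.source) (h : V n)
    (ν : Fin m) :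
    ((B.chartNear e).frame hz).D₀ (L.verticalDiff z
      (((B.chartNear e).frame hz).D.symm (0, h))) ν =
    L.localFibreDeriv e (B.jetBundle.coord e z)
      ((EuclideanSpace.proj ν : V m →L[ℝ] ℝ).smulRight h) := by
  set a := (B.chartNear e).frame hz with ha
  have hT : B.T z.base (a.D.symm (0, h)) = 0 := by rw [a.T_D_symm]; simp
  let w : B.vert z.base := ⟨a.D.symm (0, h), hT⟩
  have hw : structureForm z (a.D.symm (0, h)) = w := by
    apply Subtype.ext
    change a.D.symm (0, h) - z.fib.1 (B.T z.base (a.D.symm (0, h))) = a.D.symm (0, h)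
    rw [hT, map_zero, sub_zero]
  have h1 : L.verticalDiff z (a.D.symm (0, h)) = ∑ ρ : Fin m,
      L.fibreDeriv z ((EuclideanSpace.proj ρ : V m →L[ℝ] ℝ).smulRight w) •
        EuclideanSpace.single ρ (1 : ℝ) := by
    unfold verticalDiff
    rw [_root_.sum_apply]
    refine Finset.sum_congr rfl fun ρ _ => ?_
    rw [← hw]
    rfl
  -- `verticalDiff` is a sum over the standard basis of `V m`, whereas the component wanted is the
  -- `ν`-th one in the frame `D₀`. Expanding this covector in standard coordinates passes from one
  -- to the other.
  let μ : V m →L[ℝ] ℝ := (EuclideanSpace.proj ν : V m →L[ℝ] ℝ).comp a.D₀.toContinuousLinearMap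
  have h2 : (∑ ρ : Fin m, μ (EuclideanSpace.single ρ 1) •
      (EuclideanSpace.proj ρ : V m →L[ℝ] ℝ).smulRight w) = μ.smulRight w := by
    apply ContinuousLinearMap.ext
    intro u
    have hu : μ u = ∑ ρ, u ρ * μ (EuclideanSpace.single ρ 1) := by
      conv_lhs => rw [← (EuclideanSpace.basisFun (Fin m) ℝ).sum_repr u]
      simp
    rw [_root_.sum_apply]
    simp only [_root_.smul_apply, ContinuousLinearMap.smulRight_apply, hu,
      Finset.sum_smul, smul_smul]
    refine Finset.sum_congr rfl fun ρ _ => ?_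
    rw [mul_comm]
    rfl
  have h3 : a.D₀ (L.verticalDiff z (a.D.symm (0, h))) ν = L.fibreDeriv z (μ.smulRight w) := by
    change μ (L.verticalDiff z (a.D.symm (0, h))) = _
    rw [h1, ← h2, map_sum, map_sum]
    refine Finset.sum_congr rfl fun ρ _ => ?_
    rw [map_smul, map_smul, smul_eq_mul, smul_eq_mul, mul_comm]
  rw [h3, L.fibreDeriv_eq_localFibreDeriv z hz]
  congr 1
  ext1 u
  rw [vertCoord_apply]
  change (a.D (a.D₀ (a.D₀.symm u) ν • a.D.symm (0, h))).2 = u ν • h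
  simp

lemma covector_apply (z : B.J1) (w : Fin m → V (m + n)) :
    L.covector z w = (∑ i, L.volAt z.base (update (fun j => B.T z.base (w j)) i
      (L.verticalDiff z (w i)))) + L.lag z * L.volAt z.base (fun j => B.T z.base (w j)) := by
  change (L.volAt z.base).fderivCompContinuousLinearMap (B.T z.base) (L.verticalDiff z) w +
    L.lag z * L.volAt z.base (fun j => B.T z.base (w j)) = _
  rw [ContinuousAlternatingMap.fderivCompContinuousLinearMap_apply]
  congr 1
  refine Finset.sum_congr rfl fun i _ => ?_
  congr 1
  ext1 j
  by_cases hj : j = i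
  · subst hj; simp
  · simp [update_of_ne hj]

/-- The structure form kills the image of the jet, so the vertical term drops out and only
$\pounds\omega$ remains. This places the graph of the extended Legendre map inside `W₀`. -/
lemma covector_comp_jet (z : B.J1) :
    L.lag z • L.volAt z.base = (L.covector z).compContinuousLinearMap z.fib.1 := by
  have hσ : ∀ u, B.T z.base (z.fib.1 u) = u := fun u => DFunLike.congr_fun z.fib.2 u
  have hs : ∀ u, L.verticalDiff z (z.fib.1 u) = 0 := by
    intro u
    have h0 : structureForm z (z.fib.1 u) = 0 := by
      apply Subtype.ext
      change z.fib.1 u - z.fib.1 (B.T z.base (z.fib.1 u)) = 0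
      rw [hσ, sub_self]
    unfold verticalDiff
    rw [_root_.sum_apply]
    refine Finset.sum_eq_zero fun ρ _ => ?_
    change L.fibreDeriv z ((EuclideanSpace.proj ρ : V m →L[ℝ] ℝ).smulRight
      (structureForm z (z.fib.1 u))) • EuclideanSpace.single ρ (1 : ℝ) = 0
    rw [h0]
    have h00 : (EuclideanSpace.proj ρ : V m →L[ℝ] ℝ).smulRight (0 : B.vert z.base) = 0 := by
      ext1 x
      simp
    rw [h00, map_zero, zero_smul]
  ext u
  change L.lag z * L.volAt z.base u = L.covector z (fun i => z.fib.1 (u i))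
  rw [covector_apply, Finset.sum_eq_zero, zero_add]
  · simp only [hσ]
  · intro i _
    exact (L.volAt z.base).map_coord_zero i (by simp [hs])

/-- The momenta `p^ν_A = ∂£/∂v^A_ν` of the Legendre map. -/
lemma pairing_legendre {e : E} (z : B.J1) (hz : z.base ∈ (B.chartNear e).c.source)
    (η : V m →L[ℝ] V n) :
    pairing m n (((B.chartNear e).frame hz).momentum (L.extLegendre z).fib).1 η =
      L.localFibreDeriv e (B.jetBundle.coord e z) η • L.frameVol ((B.chartNear e).frame hz) := by
  set a := (B.chartNear e).frame hz with ha
  ext u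
  -- An endomorphism of the model of $TM$ whose trace is the derivative of $\pounds$ along `η`; the
  -- sum over slots then becomes this trace times the volume.
  let A : V m →L[ℝ] V m := a.D₀.toContinuousLinearMap.comp ((L.verticalDiff z).comp
    (a.D.symm.toContinuousLinearMap.comp ((ContinuousLinearMap.inr ℝ (V m) (V n)).comp η)))
  have hA : ∑ ν, A (EuclideanSpace.single ν 1) ν =
      L.localFibreDeriv e (B.jetBundle.coord e z) η := by
    have h1 : ∑ ν : Fin m, (EuclideanSpace.proj ν : V m →L[ℝ] ℝ).smulRight
        (η (EuclideanSpace.single ν 1)) = η := by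
      ext1 u
      rw [_root_.sum_apply]
      conv_rhs => rw [← (EuclideanSpace.basisFun (Fin m) ℝ).sum_repr u]
      simp
    conv_rhs => rw [← h1, map_sum]
    exact Finset.sum_congr rfl fun ν _ => L.D₀_verticalDiff z hz _ ν
  change _ = L.localFibreDeriv e (B.jetBundle.coord e z) η * L.frameVol a u
  rw [pairing_apply, ← hA, ← sum_map_update_eq_trace_smul]
  refine Finset.sum_congr rfl fun i _ => ?_
  change L.covector z (fun j => a.D.symm (update (fun j => (u j, (0 : V n))) i (0, η (u i)) j)) =
    L.volAt z.base (fun j => a.D₀.symm (update u i (A (u i)) j))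
  rw [covector_apply]
  -- Slot `i` holds a vertical vector: the density term vanishes, and so does every Leibniz term
  -- except the one that differentiates slot `i`.
  have hTi : B.T z.base (a.D.symm (update (fun j => (u j, (0 : V n))) i (0, η (u i)) i)) = 0 := by
    rw [update_self, a.T_D_symm]
    simp
  rw [(L.volAt z.base).map_coord_zero (m := fun j => B.T z.base (a.D.symm
    (update (fun j => (u j, (0 : V n))) i (0, η (u i)) j))) i hTi, mul_zero, add_zero,
    Finset.sum_eq_single i]
  · congr 1
    ext1 j
    by_cases hj : j = i
    · subst hj
      simp [A]
    · simp [update_of_ne hj, a.T_D_symm]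
  · intro k _ hk
    refine (L.volAt z.base).map_coord_zero i ?_
    rw [update_of_ne (Ne.symm hk)]
    exact hTi
  · simp

/-! ## The projections and the Legendre maps in coordinates -/

/-- Each term of the pairing has one vertical argument, which a pulled-back covector annihilates.
Hence the pairing depends only on the class in `J¹π*`. -/
lemma pairing_pulledBack (β : V m [⋀^Fin m]→L[ℝ] ℝ) (v : V m →L[ℝ] V n) :
    pairing m n (β.compContinuousLinearMap (modelProj m n)) v = 0 := by
  ext u
  rw [pairing_apply]
  refine Finset.sum_eq_zero fun i _ => ?_
  exact β.map_coord_zero i (by simp)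

/-- A covector of `Λᵐ₂` is determined by its momenta and its pullback along a graph. -/
lemma momentum_eq_of_graph {α : MomentumModel m n} {v : V m →L[ℝ] V n} {β : V m [⋀^Fin m]→L[ℝ] ℝ}
    (h : α.1.compContinuousLinearMap ((ContinuousLinearMap.id ℝ (V m)).prod v) = β) :
    MomentumModel.incl m n α = DualModel.incl m n (momentumPart α) +
      (β - pairingDual m n (momentumPart α) v).compContinuousLinearMap (modelProj m n) := by
  have h1 : α.1 = (momentumPart α).1 + (α.1.compContinuousLinearMap
      (ContinuousLinearMap.inl ℝ (V m) (V n))).compContinuousLinearMap (modelProj m n) :=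
    (sub_add_cancel _ _).symm
  have h2 : β = pairingDual m n (momentumPart α) v + α.1.compContinuousLinearMap
      (ContinuousLinearMap.inl ℝ (V m) (V n)) := by
    rw [← h]
    change _ = pairing m n (momentumPart α).1 v + _
    rw [← dualModel_comp_graph]
    ext u
    have := DFunLike.congr_fun h1 (fun i => (u i, v (u i)))
    exact this
  rw [h2, add_sub_cancel_left]
  exact h1

lemma pairing_momentumPart (α : MomentumModel m n) (v : V m →L[ℝ] V n) :
    pairingDual m n (momentumPart α) v = pairing m n α.1 v := by
  change pairing m n (α.1 - α.1.compContinuousLinearMap (modelHor m n)) v = _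
  rw [map_sub]
  have := pairing_pulledBack (α.1.compContinuousLinearMap
    (ContinuousLinearMap.inl ℝ (V m) (V n))) v
  change pairing m n α.1 v - pairing m n ((α.1.compContinuousLinearMap
    (ContinuousLinearMap.inl ℝ (V m) (V n))).compContinuousLinearMap (modelProj m n)) v = _
  rw [this, sub_zero]

/-- The covector with momenta `q` in `W₀` over the jet with coordinates `z`. -/
def localMomentum (e : E) (z : W₀Model m n) : (V m × V n) [⋀^Fin m]→L[ℝ] ℝ :=
  DualModel.incl m n z.2.2 + (L.localLag e (z.1, z.2.1) • L.localVol e z.1.1 -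
    pairingDual m n z.2.2 z.2.1).compContinuousLinearMap (modelProj m n)

/-- Since a jet is a right inverse of the tangent projection, in an adapted frame it is the graph of
its fibre coordinates. -/
lemma triv_jet_eq {y : E} (a : B.AdaptedFrame y) (σ : B.JetFibre y) :
    ((ContinuousLinearMap.id ℝ (V m)).prod (B.jetBundle.triv y a σ)) =
      a.D.toContinuousLinearMap.comp (σ.1.comp a.D₀.symm.toContinuousLinearMap) := by
  ext1 u
  have h : B.T y (σ.1 (a.D₀.symm u)) = a.D₀.symm u := DFunLike.congr_fun σ.2 _
  refine Prod.ext ?_ rfl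
  change u = (a.D (σ.1 (a.D₀.symm u))).1
  rw [a.fst_D, h, a.D₀.apply_symm_apply]

/-- The defining constraint of `W₀`, transported to an adapted frame; it is the hypothesis that
`momentum_eq_of_graph` needs to solve for the last momentum coordinate. -/
lemma momentum_comp_graph {y : E} (a : B.AdaptedFrame y) (w : L.W₀Fibre y) :
    (a.momentum w.1.2).1.compContinuousLinearMap ((ContinuousLinearMap.id ℝ (V m)).prod
      (B.jetBundle.triv y a w.1.1)) = L.lag ⟨y, w.1.1⟩ • L.frameVol a := by
  rw [triv_jet_eq]
  ext u
  have h := DFunLike.congr_fun w.2 (fun i => a.D₀.symm (u i))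
  change w.1.2.1 (fun i => a.D.symm (a.D (w.1.1.1 (a.D₀.symm (u i))))) =
    L.lag ⟨y, w.1.1⟩ * L.volAt y (fun i => a.D₀.symm (u i))
  simp only [a.D.symm_apply_apply]
  exact h.symm

lemma localLag_coord {e : E} {z : B.J1} (hz : z.base ∈ (B.chartNear e).c.source) :
    L.localLag e (B.jetBundle.coord e z) = L.lag z := by
  unfold localLag
  rw [B.jetBundle.ofCoord_coord hz]

lemma coord_W₀ {e : E} {w : L.W₀} (hw : w.base ∈ (B.chartNear e).c.source) :
    L.W₀Bundle.coord e w = ((B.chartNear e).c w.base,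
      B.jetBundle.triv w.base ((B.chartNear e).frame hw) w.fib.1.1,
      momentumPart (((B.chartNear e).frame hw).momentum w.fib.1.2)) := by
  rw [L.W₀Bundle.coord_of_mem hw]
  rfl

/-- `ρ₂⁰` in coordinates. -/
lemma coord_ρ₂ {e : E} {w : L.W₀} (hw : w.base ∈ (B.chartNear e).c.source) :
    MomentumModel.incl m n (B.momentumBundle.coord e (L.ρ₂ w)).2 =
      L.localMomentum e (L.W₀Bundle.coord e w) := by
  have hz : (L.ρ₁ w).base ∈ (B.chartNear e).c.source := hw
  have h1 := momentum_eq_of_graph (L.momentum_comp_graph ((B.chartNear e).frame hw) w.fib)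
  rw [B.momentumBundle.coord_of_mem (p := L.ρ₂ w) hw, L.coord_W₀ hw]
  refine h1.trans ?_
  unfold localMomentum
  rw [← L.localVol_eq_frameVol hw]
  have h2 := L.localLag_coord hz
  rw [B.jetBundle.coord_of_mem hz] at h2
  have h3 : L.localLag e ((B.chartNear e).c w.base, B.jetBundle.triv w.base
      ((B.chartNear e).frame hw) w.fib.1.1) = L.lag ⟨w.base, w.fib.1.1⟩ := h2
  simp only [h3]

/-- The lift of the extended Legendre map to `W₀`. -/
def liftW₀ (z : B.J1) : L.W₀ := ⟨z.base, ⟨(z.fib, (L.extLegendre z).fib), L.covector_comp_jet z⟩⟩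

/-- A choice of the momenta with given pairings. -/
def momentaOfPairing (m n : ℕ) :
    ((V m →L[ℝ] V n) →L[ℝ] (V m [⋀^Fin m]→L[ℝ] ℝ)) →L[ℝ] DualModel m n :=
  (exists_pairing_leftInverse m n).choose

lemma momentaOfPairing_pairing (q : DualModel m n) :
    momentaOfPairing m n (pairingDual m n q) = q :=
  (exists_pairing_leftInverse m n).choose_spec q

/-- The momenta of the Legendre map in coordinates. -/
def localLegendre (e : E) (z : J1Model m n) : DualModel m n :=
  momentaOfPairing m n ((L.localFibreDeriv e z).smulRight (L.localVol e z.1.1))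

/-- Momenta are determined by their pairings, and those of the Legendre covector are
$\partial\pounds/\partial v$ times the volume form. -/
lemma momentumPart_extLegendre {e : E} {z : B.J1} (hz : z.base ∈ (B.chartNear e).c.source) :
    momentumPart (((B.chartNear e).frame hz).momentum (L.extLegendre z).fib) =
      L.localLegendre e (B.jetBundle.coord e z) := by
  unfold localLegendre
  rw [← momentaOfPairing_pairing (momentumPart _)]
  congr 1
  ext1 η
  rw [pairing_momentumPart, L.pairing_legendre z hz, ← L.localVol_eq_frameVol hz]
  rfl

/-- `momentaOfPairing` is only a left inverse, so this needs its argument to be the pairing of some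
momenta; those of the Legendre covector serve. -/
lemma pairing_localLegendre {e : E} {z : B.J1} (hz : z.base ∈ (B.chartNear e).c.source)
    (η : V m →L[ℝ] V n) :
    pairingDual m n (L.localLegendre e (B.jetBundle.coord e z)) η =
      L.localFibreDeriv e (B.jetBundle.coord e z) η •
        L.localVol e (B.jetBundle.coord e z).1.1 := by
  rw [← L.momentumPart_extLegendre hz, pairing_momentumPart, L.pairing_legendre z hz,
    ← L.localVol_eq_frameVol hz]
  rfl

lemma coord_liftW₀ {e : E} {z : B.J1} (hz : z.base ∈ (B.chartNear e).c.source) :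
    L.W₀Bundle.coord e (L.liftW₀ z) = ((B.jetBundle.coord e z).1, (B.jetBundle.coord e z).2,
      L.localLegendre e (B.jetBundle.coord e z)) := by
  rw [L.coord_W₀ (w := L.liftW₀ z) hz, ← L.momentumPart_extLegendre hz,
    B.jetBundle.coord_of_mem hz]
  rfl

lemma coord_legendre {e : E} {z : B.J1} (hz : z.base ∈ (B.chartNear e).c.source) :
    B.dualBundle.coord e (L.legendre z) = ((B.jetBundle.coord e z).1,
      L.localLegendre e (B.jetBundle.coord e z)) := by
  rw [B.dualBundle.coord_of_mem (p := L.legendre z) hz, ← L.momentumPart_extLegendre hz,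
    B.jetBundle.coord_of_mem hz]
  rfl

lemma mapsTo_target (e : E) : MapsTo (fun z : V m × V n => z.1) (B.chartNear e).c.target
    (B.chartNear e).c₀.target := by
  intro z hz
  have h := (B.chartNear e).c.map_target hz
  have h1 := (B.chartNear e).fst_eq _ h
  rw [(B.chartNear e).c.right_inv hz] at h1
  change z.1 ∈ _
  rw [h1]
  exact (B.chartNear e).c₀.map_source ((B.chartNear e).mapsTo h)

lemma contDiffOn_localFibreDeriv (e : E) :
    ContDiffOn ℝ ∞ (L.localFibreDeriv e) {z | z.1 ∈ (B.chartNear e).c.target} := by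
  have h := (L.contDiffOn_localLag e).fderiv_of_isOpen (m := ∞)
    (NaturalBundle.isOpen_coord_target B _ e) (by simp)
  exact h.clm_comp contDiffOn_const

lemma contDiffOn_localVol_fst (e : E) {F : Type*} [NormedAddCommGroup F] [NormedSpace ℝ F] :
    ContDiffOn ℝ ∞ (fun z : (V m × V n) × F => L.localVol e z.1.1)
      {z | z.1 ∈ (B.chartNear e).c.target} :=
  (L.contDiffOn_localVol e).comp (contDiff_fst.comp contDiff_fst).contDiffOn
    fun _ hz => mapsTo_target e hz

lemma contDiffOn_localLegendre (e : E) :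
    ContDiffOn ℝ ∞ (L.localLegendre e) {z | z.1 ∈ (B.chartNear e).c.target} := by
  have h1 : ContDiffOn ℝ ∞ (fun z : J1Model m n =>
      (L.localFibreDeriv e z).smulRight (L.localVol e z.1.1))
      {z | z.1 ∈ (B.chartNear e).c.target} :=
    (L.contDiffOn_localFibreDeriv e).smulRight (L.contDiffOn_localVol_fst e)
  exact (ContinuousLinearMap.contDiff (momentaOfPairing m n)).comp_contDiffOn h1

lemma contDiff_pairingDual : ContDiff ℝ ∞ (pairingDual m n) := by
  have h := ContinuousLinearMap.contDiff (n := ∞) (𝕜 := ℝ) (E := DualModel m n)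
    (F := (V m →L[ℝ] V n) →L[ℝ] (V m [⋀^Fin m]→L[ℝ] ℝ)) (pairingDual m n)
  exact h

lemma contDiff_dualModel_incl : ContDiff ℝ ∞ (DualModel.incl m n) :=
  ContinuousLinearMap.contDiff (E := DualModel m n)
    (F := (V m × V n) [⋀^Fin m]→L[ℝ] ℝ) (DualModel.incl m n)

lemma contDiffOn_localMomentum (e : E) :
    ContDiffOn ℝ ∞ (L.localMomentum e) {z | z.1 ∈ (B.chartNear e).c.target} := by
  have hq : ContDiff ℝ ∞ (fun z : W₀Model m n => z.2.2) := contDiff_snd.comp contDiff_snd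
  have hv : ContDiff ℝ ∞ (fun z : W₀Model m n => z.2.1) := contDiff_fst.comp contDiff_snd
  have h1 : ContDiffOn ℝ ∞ (fun z : W₀Model m n => L.localLag e (z.1, z.2.1))
      {z | z.1 ∈ (B.chartNear e).c.target} :=
    (L.contDiffOn_localLag e).comp (contDiff_fst.prodMk hv).contDiffOn fun _ hz => hz
  have h2 : ContDiff ℝ ∞ (fun z : W₀Model m n => pairingDual m n z.2.2) :=
    contDiff_pairingDual.comp hq
  have h3 : ContDiff ℝ ∞ (fun z : W₀Model m n => pairingDual m n z.2.2 z.2.1) := h2.clm_apply hv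
  have h4 : ContDiffOn ℝ ∞ (fun z : W₀Model m n => L.localLag e (z.1, z.2.1) •
      L.localVol e z.1.1) {z | z.1 ∈ (B.chartNear e).c.target} :=
    h1.smul (L.contDiffOn_localVol_fst e)
  have h5 := h4.sub h3.contDiffOn
  have h6 : ContDiff ℝ ∞ (fun z : W₀Model m n => DualModel.incl m n z.2.2) :=
    contDiff_dualModel_incl.comp hq
  let pr : (V m [⋀^Fin m]→L[ℝ] ℝ) →L[ℝ] ((V m × V n) [⋀^Fin m]→L[ℝ] ℝ) :=
    ContinuousAlternatingMap.compContinuousLinearMapCLM (modelProj m n)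
  exact h6.contDiffOn.add (pr.contDiff.comp_contDiffOn h5)

end LagrangianSystem

/-! ### Velocities of maps into a total space and contractions with fibre vectors -/

namespace NaturalBundle

variable {S : E → Type} {F : Type} [NormedAddCommGroup F] [NormedSpace ℝ F]
  (N : NaturalBundle B S F)

lemma differentiableAt_symbol (f : ∀ p : N.Total, B.MomentumFibre p.base) (p : N.Total)
    (hf : ContMDiff 𝓘(ℝ, (V m × V n) × F) 𝓘(ℝ, ExtMomModel m n) ∞
      (fun q : N.Total => (⟨q.base, f q⟩ : B.ExtMom))) :
    HasFDerivAt (N.symbol f p.base) (fderiv ℝ (N.symbol f p.base) (N.coord p.base p))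
      (N.coord p.base p) := by
  have hp := B.mem_chartNear p.base
  have ht : (N.coord p.base p).1 ∈ (B.chartNear p.base).c.target :=
    (B.chartNear p.base).c.map_source hp
  have h1 := (N.contMDiffAt_ofCoord ht)
  have h2 : ContMDiffAt 𝓘(ℝ, (V m × V n) × F) 𝓘(ℝ, ExtMomModel m n) ∞
      (fun z => (⟨(N.ofCoord p.base z).base, f (N.ofCoord p.base z)⟩ : B.ExtMom))
      (N.coord p.base p) := hf.contMDiffAt.comp _ h1
  have h3 := ContMDiffAt.comp (g := B.momentumBundle.coord p.base) (N.coord p.base p)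
    (B.momentumBundle.contMDiffAt_coord (N.base_ofCoord_mem ht)) h2
  have h4 := h3.contDiffAt.snd
  exact (h4.differentiableAt (by simp)).hasFDerivAt

/-- The horizontal part of the velocity of a map into the total space. -/
lemma mfderiv_fst {H : Type*} [NormedAddCommGroup H] [NormedSpace ℝ H]
    {X : Type*} [TopologicalSpace X] [ChartedSpace H X] {f : X → N.Total} {x : X}
    (hf : MDifferentiableAt 𝓘(ℝ, H) 𝓘(ℝ, (V m × V n) × F) f x) (u : TangentSpace 𝓘(ℝ, H) x) :
    Prod.fst (mfderiv 𝓘(ℝ, H) 𝓘(ℝ, (V m × V n) × F) f x u : (V m × V n) × F) =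
      ((B.chartNear (f x).base).frame (B.mem_chartNear (f x).base)).D
        (mfderiv 𝓘(ℝ, H) 𝓘(ℝ, V (m + n)) (fun x' => (f x').base) x u) := by
  have h1 := HasMFDerivAt.comp x
    ((N.contMDiff_base (f x)).mdifferentiableAt (by simp)).hasMFDerivAt hf.hasMFDerivAt
  have h2 := HasMFDerivAt.comp x ((B.chartNear (f x).base).mdiff.mdifferentiableAt
    (B.mem_chartNear (f x).base)).hasMFDerivAt h1
  have h3 := HasMFDerivAt.comp x (ContinuousLinearMap.fst ℝ (V m × V n) F).hasMFDerivAt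
    (HasMFDerivAt.comp x (N.hasMFDerivAt_coord_self (f x)) hf.hasMFDerivAt)
  have h4 := hasMFDerivAt_unique h3 h2
  have h5 := DFunLike.congr_fun h4 u
  refine Eq.trans h5 ?_
  have h6 : mfderiv 𝓘(ℝ, H) 𝓘(ℝ, V (m + n)) (fun x' => (f x').base) x = _ := h1.mfderiv
  rw [h6]
  rfl

/-- In every term but the zeroth the fibre vector is an argument of the covector, where its
projection is zero. -/
lemma altSum_cons_vertical {G : Type*} [NormedAddCommGroup G] [NormedSpace ℝ G]
    (A : (V m × V n) × G →L[ℝ] ((V m × V n) [⋀^Fin m]→L[ℝ] ℝ)) (g : G)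
    (w : Fin m → (V m × V n) × G) :
    altSum A (Fin.cons (0, g) w) = A (0, g) (fun j => (w j).1) := by
  unfold altSum
  rw [Fin.sum_univ_succ, Finset.sum_eq_zero, add_zero]
  · simp
  · intro i _
    refine smul_eq_zero_of_right _ ?_
    have hm : 0 < m := i.pos
    -- A term beyond the zeroth exists only for $m>0$, and then the covector has a first slot, which
    -- holds the fibre vector.
    have : NeZero m := ⟨hm.ne'⟩
    refine (A _).map_coord_zero 0 ?_
    have h : i.succ.succAbove (0 : Fin m) = 0 := Fin.succ_succAbove_zero i
    rw [h]
    rfl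

end NaturalBundle

/-! ## Smoothness of the projections, Legendre maps and prolongations -/

namespace NaturalBundle

variable {S S' : E → Type} {F F' : Type} [NormedAddCommGroup F] [NormedSpace ℝ F]
  [NormedAddCommGroup F'] [NormedSpace ℝ F']
  (N : NaturalBundle B S F) (N' : NaturalBundle B S' F')

/-- A map over `E` is smooth if its coordinate expressions are. -/
lemma contMDiff_of_coord {f : N.Total → N'.Total} (hb : ∀ p, (f p).base = p.base)
    {g : E → (V m × V n) × F → F'}
    (hg : ∀ e, ContDiffOn ℝ ∞ (g e) {z | z.1 ∈ (B.chartNear e).c.target})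
    (hfg : ∀ e (p : N.Total), p.base ∈ (B.chartNear e).c.source →
      (N'.coord e (f p)).2 = g e (N.coord e p)) :
    ContMDiff 𝓘(ℝ, (V m × V n) × F) 𝓘(ℝ, (V m × V n) × F') ∞ f := by
  intro p
  have hp := B.mem_chartNear p.base
  refine N'.contMDiffAt_iff_coord (e := p.base) (by rw [hb]; exact hp) ?_ ?_
  · have : (fun p => (f p).base) = (Total.base : N.Total → E) := funext hb
    rw [this]
    exact N.contMDiff_base p
  · have h1 : ContMDiffAt 𝓘(ℝ, (V m × V n) × F) 𝓘(ℝ, F') ∞ (g p.base) (N.coord p.base p) :=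
      ((hg p.base).contDiffAt ((isOpen_coord_target B F p.base).mem_nhds
        ((B.chartNear p.base).c.map_source hp))).contMDiffAt
    refine (h1.comp p (N.contMDiffAt_coord hp)).congr_of_eventuallyEq ?_
    filter_upwards [(N.isOpen_coord_source p.base).mem_nhds hp] with q hq
    exact hfg p.base q hq

end NaturalBundle

namespace LagrangianSystem

variable (L : LagrangianSystem B)

lemma contMDiff_ρ₁ : ContMDiff 𝓘(ℝ, W₀Model m n) 𝓘(ℝ, J1Model m n) ∞ L.ρ₁ := by
  refine L.W₀Bundle.contMDiff_of_coord B.jetBundle (fun _ => rfl) (g := fun _ z => z.2.1)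
    (fun e => (contDiff_fst.comp contDiff_snd).contDiffOn) fun e w hw => ?_
  have hz : (L.ρ₁ w).base ∈ (B.chartNear e).c.source := hw
  rw [L.coord_W₀ hw, B.jetBundle.coord_of_mem hz]
  rfl

/-- A projection of covectors onto the typical fibre of `Mπ`. -/
def momentumRetraction (m n : ℕ) : ((V m × V n) [⋀^Fin m]→L[ℝ] ℝ) →L[ℝ] MomentumModel m n :=
  (exists_momentumModel_retraction m n).choose

lemma momentumRetraction_incl (α : MomentumModel m n) :
    momentumRetraction m n (MomentumModel.incl m n α) = α :=
  (exists_momentumModel_retraction m n).choose_spec α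

lemma contMDiff_ρ₂ : ContMDiff 𝓘(ℝ, W₀Model m n) 𝓘(ℝ, ExtMomModel m n) ∞ L.ρ₂ := by
  refine L.W₀Bundle.contMDiff_of_coord B.momentumBundle (fun _ => rfl)
    (g := fun e z => momentumRetraction m n (L.localMomentum e z)) (fun e => ?_) fun e w hw => ?_
  · have h := ContinuousLinearMap.contDiff (n := ∞) (𝕜 := ℝ)
      (E := (V m × V n) [⋀^Fin m]→L[ℝ] ℝ) (F := MomentumModel m n) (momentumRetraction m n)
    exact h.comp_contDiffOn (L.contDiffOn_localMomentum e)
  · rw [← L.coord_ρ₂ hw, momentumRetraction_incl]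

lemma contMDiff_liftW₀ : ContMDiff 𝓘(ℝ, J1Model m n) 𝓘(ℝ, W₀Model m n) ∞ L.liftW₀ := by
  refine B.jetBundle.contMDiff_of_coord L.W₀Bundle (fun _ => rfl)
    (g := fun e z => (z.2, L.localLegendre e z)) (fun e => ?_) fun e z hz => ?_
  · exact contDiff_snd.contDiffOn.prodMk (L.contDiffOn_localLegendre e)
  · rw [L.coord_liftW₀ hz]

lemma contMDiff_extLegendre :
    ContMDiff 𝓘(ℝ, J1Model m n) 𝓘(ℝ, ExtMomModel m n) ∞ L.extLegendre :=
  L.contMDiff_ρ₂.comp L.contMDiff_liftW₀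

lemma contMDiff_legendre :
    ContMDiff 𝓘(ℝ, J1Model m n) 𝓘(ℝ, J1DualModel m n) ∞ L.legendre := by
  refine B.jetBundle.contMDiff_of_coord B.dualBundle (fun _ => rfl)
    (g := fun e z => L.localLegendre e z) (fun e => L.contDiffOn_localLegendre e) fun e z hz => ?_
  rw [L.coord_legendre hz]

end LagrangianSystem

/-- The fibre coordinates of the jet of a section. -/
def jetCoord (φ : B.Section) (x : M) : V m →L[ℝ] V n :=
  B.jetBundle.triv (φ.toFun x)
    ((B.chartNear (φ.toFun x)).frame (B.mem_chartNear (φ.toFun x))) (j1 φ x).fib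

/-- Around any point the fibre coordinate of the jet is the ordinary derivative of the coordinate
representative `g` of `φ`, taken in one fixed adapted chart. -/
lemma contMDiff_j1 (φ : B.Section) : ContMDiff 𝓘(ℝ, V m) 𝓘(ℝ, J1Model m n) ∞ (j1 φ) := by
  intro x
  set e := φ.toFun x with he
  have hx : φ.toFun x ∈ (B.chartNear e).c.source := B.mem_chartNear e
  have hx₀ : x ∈ (B.chartNear e).c₀.source := by
    have := (B.chartNear e).mapsTo hx
    rwa [φ.proj_toFun] at this
  refine B.jetBundle.contMDiffAt_iff_coord (e := e) hx (φ.smooth x) ?_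
  set c := (B.chartNear e).c with hc
  set c₀ := (B.chartNear e).c₀ with hc₀
  let W : Set (V m) := c₀.target ∩ c₀.symm ⁻¹' (φ.toFun ⁻¹' c.source)
  have hW : IsOpen W :=
    c₀.isOpen_inter_preimage_symm (c.open_source.preimage φ.smooth.continuous)
  let g : V m → V n := fun s => (c (φ.toFun (c₀.symm s))).2
  have hg' : ContMDiffOn 𝓘(ℝ, V m) 𝓘(ℝ, V m × V n) ∞ (fun s => c (φ.toFun (c₀.symm s))) W := by
    refine (B.chartNear e).smooth.comp (t := c.source) (s := W)
      (f := fun s => φ.toFun (c₀.symm s)) ?_ fun s hs => hs.2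
    exact φ.smooth.comp_contMDiffOn ((B.chartNear e).smooth₀_symm.mono inter_subset_left)
  have hg : ContDiffOn ℝ ∞ g W := (contMDiffOn_iff_contDiffOn.1 hg').snd
  have hdg := hg.fderiv_of_isOpen (m := ∞) hW (by simp)
  have hxW : c₀ x ∈ W := by
    refine ⟨c₀.map_source hx₀, ?_⟩
    change φ.toFun (c₀.symm (c₀ x)) ∈ c.source
    rw [c₀.left_inv hx₀]
    exact hx
  have h1 : ContMDiffAt 𝓘(ℝ, V m) 𝓘(ℝ, V m →L[ℝ] V n) ∞ (fderiv ℝ g) (c₀ x) :=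
    (hdg.contDiffAt (hW.mem_nhds hxW)).contMDiffAt
  have h2 := h1.comp x ((B.chartNear e).smooth₀.contMDiffAt (c₀.open_source.mem_nhds hx₀))
  refine h2.congr_of_eventuallyEq ?_
  filter_upwards [c₀.open_source.mem_nhds hx₀,
    (c.open_source.preimage φ.smooth.continuous).mem_nhds hx] with x' hx'₀ hx'
  have hxW' : c₀ x' ∈ W := by
    refine ⟨c₀.map_source hx'₀, ?_⟩
    change φ.toFun (c₀.symm (c₀ x')) ∈ c.source
    rw [c₀.left_inv hx'₀]
    exact hx'
  have hb : (j1 φ x').base ∈ (B.chartNear e).c.source := hx'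
  rw [B.jetBundle.coord_of_mem hb]
  change B.jetBundle.triv (φ.toFun x') ((B.chartNear e).frame hb) (j1 φ x').fib =
    fderiv ℝ g (c₀ x')
  have hd : HasFDerivAt g (fderiv ℝ g (c₀ x')) (c₀ x') :=
    ((hg.contDiffAt (hW.mem_nhds hxW')).differentiableAt (by simp)).hasFDerivAt
  have hs : HasMFDerivAt 𝓘(ℝ, V m) 𝓘(ℝ, V m) c₀.symm (c₀ x')
      (mfderiv 𝓘(ℝ, V m) 𝓘(ℝ, V m) c₀.symm (c₀ x')) :=
    ((B.chartNear e).mdiff₀.mdifferentiableAt_symm (c₀.map_source hx'₀)).hasMFDerivAt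
  have hφ : HasMFDerivAt 𝓘(ℝ, V m) 𝓘(ℝ, V (m + n)) φ.toFun (c₀.symm (c₀ x'))
      (mfderiv 𝓘(ℝ, V m) 𝓘(ℝ, V (m + n)) φ.toFun (c₀.symm (c₀ x'))) :=
    ((φ.smooth _).mdifferentiableAt (by simp)).hasMFDerivAt
  have hcd : HasMFDerivAt 𝓘(ℝ, V (m + n)) 𝓘(ℝ, V m × V n) c (φ.toFun (c₀.symm (c₀ x')))
      (mfderiv 𝓘(ℝ, V (m + n)) 𝓘(ℝ, V m × V n) c (φ.toFun (c₀.symm (c₀ x')))) :=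
    ((B.chartNear e).mdiff.mdifferentiableAt hxW'.2).hasMFDerivAt
  have hcomp := HasMFDerivAt.comp (c₀ x') (ContinuousLinearMap.snd ℝ (V m) (V n)).hasMFDerivAt
    (HasMFDerivAt.comp (c₀ x') hcd (HasMFDerivAt.comp (c₀ x') hφ hs))
  have huniq := hasMFDerivAt_unique hd.hasMFDerivAt hcomp
  refine Eq.trans ?_ huniq.symm
  -- The chain rule produces derivatives at `c₀.symm (c₀ x')`; the point is freed so that it can be
  -- replaced by `x'` inside dependent types.
  have key : ∀ x'' : M, x'' = x' → ∀ hb' : φ.toFun x' ∈ (B.chartNear e).c.source,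
      B.jetBundle.triv (φ.toFun x') ((B.chartNear e).frame hb') (j1 φ x').fib =
      (ContinuousLinearMap.snd ℝ (V m) (V n)).comp
        ((mfderiv 𝓘(ℝ, V (m + n)) 𝓘(ℝ, V m × V n) c (φ.toFun x'')).comp
          ((mfderiv 𝓘(ℝ, V m) 𝓘(ℝ, V (m + n)) φ.toFun x'').comp
            (mfderiv 𝓘(ℝ, V m) 𝓘(ℝ, V m) c₀.symm (c₀ x')))) := by
    intro y h hb'; subst h
    have hp : B.proj (φ.toFun y) = y := φ.proj_toFun y
    change _ = (ContinuousLinearMap.snd ℝ (V m) (V n)).comp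
        ((mfderiv 𝓘(ℝ, V (m + n)) 𝓘(ℝ, V m × V n) c (φ.toFun y)).comp
          ((mfderiv 𝓘(ℝ, V m) 𝓘(ℝ, V (m + n)) φ.toFun y).comp
            (mfderiv 𝓘(ℝ, V m) 𝓘(ℝ, V m) c₀.symm (c₀ y))))
    have h0 : mfderiv 𝓘(ℝ, V m) 𝓘(ℝ, V m) c₀.symm (c₀ y) =
        mfderiv 𝓘(ℝ, V m) 𝓘(ℝ, V m) c₀.symm (c₀ (B.proj (φ.toFun y))) := by rw [hp]
    rw [h0]
    rfl
  exact key _ (c₀.left_inv hx'₀) hx'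

/-! ## The field equations in coordinates -/

namespace NaturalBundle

variable {S : E → Type} {F : Type} [NormedAddCommGroup F] [NormedSpace ℝ F]
  (N : NaturalBundle B S F)

/-- The section of `π` underlying a section of a bundle over `E`. -/
def baseSection {N : NaturalBundle B S F} {ψ : M → N.Total}
    (hψ : ContMDiff 𝓘(ℝ, V m) 𝓘(ℝ, (V m × V n) × F) ∞ ψ)
    (hπ : ∀ x, B.proj (ψ x).base = x) : B.Section where
  toFun x := (ψ x).base
  smooth := N.contMDiff_base.comp hψ
  proj_toFun := hπ

/-- The frame at the base point given by the chart at the point. -/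
abbrev frameAt {N : NaturalBundle B S F} (p : N.Total) : B.AdaptedFrame p.base :=
  (B.chartNear p.base).frame (B.mem_chartNear p.base)

/-- The projected velocity is the differential of the underlying section, that is, its jet, and jets
are graphs in an adapted frame. -/
lemma velocity_fst {N : NaturalBundle B S F} {ψ : M → N.Total}
    (hψ : ContMDiff 𝓘(ℝ, V m) 𝓘(ℝ, (V m × V n) × F) ∞ ψ) (hπ : ∀ x, B.proj (ψ x).base = x)
    (x : M) (u : V m) :
    Prod.fst (mfderiv 𝓘(ℝ, V m) 𝓘(ℝ, (V m × V n) × F) ψ x u : (V m × V n) × F) =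
      ((frameAt (ψ x)).D₀ u, jetCoord (baseSection hψ hπ) x ((frameAt (ψ x)).D₀ u)) := by
  refine (N.mfderiv_fst ((hψ x).mdifferentiableAt (by simp)) u).trans ?_
  have h := DFunLike.congr_fun (LagrangianSystem.triv_jet_eq (frameAt (ψ x))
    (j1 (baseSection hψ hπ) x).fib) ((frameAt (ψ x)).D₀ u)
  refine Eq.trans ?_ h.symm
  change _ = (frameAt (ψ x)).D (mfderiv 𝓘(ℝ, V m) 𝓘(ℝ, V (m + n)) (fun x' => (ψ x').base) x
    ((frameAt (ψ x)).D₀.symm ((frameAt (ψ x)).D₀ u)))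
  rw [(frameAt (ψ x)).D₀.symm_apply_apply]

end NaturalBundle

namespace LagrangianSystem

open NaturalBundle

variable (L : LagrangianSystem B)

lemma hasFDerivAt_localMomentum {e : E} {z : W₀Model m n}
    (hz : z.1 ∈ (B.chartNear e).c.target) :
    HasFDerivAt (L.localMomentum e) (fderiv ℝ (L.localMomentum e) z) z :=
  (((L.contDiffOn_localMomentum e).contDiffAt
    ((NaturalBundle.isOpen_coord_target B _ e).mem_nhds hz)).differentiableAt
      (by simp)).hasFDerivAt

/-- Of the fibre coordinates only $v$ varies, and it enters through $\pounds\omega-p\cdot v$; this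
is the source of the equation $p=\partial\pounds/\partial v$. -/
lemma fderiv_localMomentum_velocity {e : E} {z : W₀Model m n}
    (hz : z.1 ∈ (B.chartNear e).c.target) (η : V m →L[ℝ] V n) :
    fderiv ℝ (L.localMomentum e) z (0, (η, 0)) =
      (L.localFibreDeriv e (z.1, z.2.1) η • L.localVol e z.1.1 -
        pairingDual m n z.2.2 η).compContinuousLinearMap (modelProj m n) := by
  -- Differentiability being known, the value is found by restricting to the line in direction `η`
  -- and comparing with the derivative of the explicit expression.
  have h1 := (L.hasFDerivAt_localMomentum hz).hasLineDerivAt (0, (η, 0))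
  have h2 := (L.hasFDerivAt_localLag (z := (z.1, z.2.1)) hz).hasLineDerivAt (0, η)
  let pr : (V m [⋀^Fin m]→L[ℝ] ℝ) →L[ℝ] ((V m × V n) [⋀^Fin m]→L[ℝ] ℝ) :=
    ContinuousAlternatingMap.compContinuousLinearMapCLM (modelProj m n)
  have h3 : HasDerivAt (fun t : ℝ => L.localLag e ((z.1, z.2.1) + t • (0, η)))
      (L.localFibreDeriv e (z.1, z.2.1) η) 0 := h2
  have h4 : HasDerivAt (fun t : ℝ => pairingDual m n z.2.2 z.2.1 + t • pairingDual m n z.2.2 η)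
      (pairingDual m n z.2.2 η) 0 := by
    simpa using ((hasDerivAt_id (0 : ℝ)).smul_const (pairingDual m n z.2.2 η)).const_add
      (pairingDual m n z.2.2 z.2.1)
  have h5 := pr.hasFDerivAt.comp_hasDerivAt (0 : ℝ) ((h3.smul_const (L.localVol e z.1.1)).sub h4)
  have h6 := h5.const_add (DualModel.incl m n z.2.2)
  refine HasDerivAt.unique h1 (h6.congr_of_eventuallyEq (Filter.Eventually.of_forall fun t => ?_))
  have e1 : (z + t • ((0, (η, 0)) : W₀Model m n)).1 = z.1 := by simp
  have e2 : (z + t • ((0, (η, 0)) : W₀Model m n)).2.1 = z.2.1 + t • η := by simp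
  have e3 : (z + t • ((0, (η, 0)) : W₀Model m n)).2.2 = z.2.2 := by simp
  have e4 : ((z.1, z.2.1) : J1Model m n) + t • (0, η) = (z.1, z.2.1 + t • η) := by simp
  change L.localMomentum e (z + t • ((0, (η, 0)) : W₀Model m n)) = DualModel.incl m n z.2.2 +
    pr (L.localLag e ((z.1, z.2.1) + t • (0, η)) • L.localVol e z.1.1 -
      (pairingDual m n z.2.2 z.2.1 + t • pairingDual m n z.2.2 η))
  unfold localMomentum
  rw [e1, e2, e3, e4, map_add, map_smul]
  rfl

/-- The local formula is affine in the momenta, so its restriction to the line is exactly linear in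
`t` plus a constant. The result is the source of the holonomy condition. -/
lemma fderiv_localMomentum_momenta {e : E} {z : W₀Model m n}
    (hz : z.1 ∈ (B.chartNear e).c.target) (q : DualModel m n) :
    fderiv ℝ (L.localMomentum e) z (0, (0, q)) =
      DualModel.incl m n q -
        (pairingDual m n q z.2.1).compContinuousLinearMap (modelProj m n) := by
  have h1 := (L.hasFDerivAt_localMomentum hz).hasLineDerivAt (0, (0, q))
  have h2 : HasDerivAt (fun t : ℝ => L.localMomentum e z + t • (DualModel.incl m n q -
      (pairingDual m n q z.2.1).compContinuousLinearMap (modelProj m n)))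
      (DualModel.incl m n q -
        (pairingDual m n q z.2.1).compContinuousLinearMap (modelProj m n)) 0 := by
    simpa using ((hasDerivAt_id (0 : ℝ)).smul_const _).const_add (L.localMomentum e z)
  refine HasDerivAt.unique h1 (h2.congr_of_eventuallyEq (Filter.Eventually.of_forall fun t => ?_))
  have e1 : (z + t • ((0, (0, q)) : W₀Model m n)).1 = z.1 := by simp
  have e2 : (z + t • ((0, (0, q)) : W₀Model m n)).2.1 = z.2.1 := by
    ext1 u
    change z.2.1 u + t • (0 : V n) = z.2.1 u
    rw [smul_zero, add_zero]
  have e3 : (z + t • ((0, (0, q)) : W₀Model m n)).2.2 = z.2.2 + t • q := by simp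
  let pr : (V m [⋀^Fin m]→L[ℝ] ℝ) →L[ℝ] ((V m × V n) [⋀^Fin m]→L[ℝ] ℝ) :=
    ContinuousAlternatingMap.compContinuousLinearMapCLM (modelProj m n)
  change L.localMomentum e (z + t • ((0, (0, q)) : W₀Model m n)) =
    DualModel.incl m n z.2.2 + pr (L.localLag e (z.1, z.2.1) • L.localVol e z.1.1 -
      pairingDual m n z.2.2 z.2.1) + t • (DualModel.incl m n q - pr (pairingDual m n q z.2.1))
  have e4 : L.localMomentum e (z + t • ((0, (0, q)) : W₀Model m n)) =
      DualModel.incl m n (z.2.2 + t • q) + pr (L.localLag e (z.1, z.2.1) • L.localVol e z.1.1 -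
        pairingDual m n (z.2.2 + t • q) z.2.1) := by
    unfold localMomentum
    rw [e1, e2, e3]
    rfl
  have e5 : DualModel.incl m n (z.2.2 + t • q) =
      DualModel.incl m n z.2.2 + t • DualModel.incl m n q := rfl
  have e6 : pairingDual m n (z.2.2 + t • q) z.2.1 =
      pairingDual m n z.2.2 z.2.1 + t • pairingDual m n q z.2.1 := by
    rw [map_add, map_smul]
    rfl
  rw [e4, e5, e6]
  simp only [map_sub, map_add, map_smul, smul_sub]
  abel

/-- The symbol of the family of multimomenta carried by `W₀` is `localMomentum`; they agree near the
point, hence have the same derivative. -/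
lemma Ω₀_apply (w : L.W₀) (u : Fin (m + 1) → W₀Model m n) :
    L.Ω₀ w u = -altSum (fderiv ℝ (L.localMomentum w.base) (L.W₀Bundle.coord w.base w)) u := by
  have hw := B.mem_chartNear w.base
  have ht : (L.W₀Bundle.coord w.base w).1 ∈ (B.chartNear w.base).c.target :=
    (B.chartNear w.base).c.map_source hw
  have hA := L.W₀Bundle.differentiableAt_symbol (fun w => w.fib.1.2) w L.contMDiff_ρ₂
  have h1 := L.W₀Bundle.multisymplecticForm_pullback (fun w => w.fib.1.2) w hA
    ((L.contMDiff_ρ₂ w).mdifferentiableAt (by simp)) u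
  refine h1.trans ?_
  have h2 := (MomentumModel.incl m n).hasFDerivAt.comp _ hA
  have h3 : L.localMomentum w.base =ᶠ[𝓝 (L.W₀Bundle.coord w.base w)]
      MomentumModel.incl m n ∘ L.W₀Bundle.symbol (fun w => w.fib.1.2) w.base := by
    filter_upwards [(isOpen_coord_target B _ w.base).mem_nhds ht] with z hz
    have h4 := L.coord_ρ₂ (L.W₀Bundle.base_ofCoord_mem hz)
    rw [L.W₀Bundle.coord_ofCoord hz] at h4
    exact h4.symm
  rw [(h2.congr_of_eventuallyEq h3).fderiv]

/-- The contraction of `Ω₀` with a vector tangent to the fibres of `W₀ → E`. -/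
lemma Ω₀_vertical {ψ : M → L.W₀} (hψ : ContMDiff 𝓘(ℝ, V m) 𝓘(ℝ, W₀Model m n) ∞ ψ)
    (hπ : ∀ x, B.proj (ψ x).base = x) (x : M) (g : (V m →L[ℝ] V n) × DualModel m n)
    (u : Fin m → V m) :
    L.Ω₀ (ψ x) (Fin.cons ((0, g) : W₀Model m n)
      (fun i => mfderiv 𝓘(ℝ, V m) 𝓘(ℝ, W₀Model m n) ψ x (u i))) =
    -((fderiv ℝ (L.localMomentum (ψ x).base) (L.W₀Bundle.coord (ψ x).base (ψ x))
      (0, g)).compContinuousLinearMap ((ContinuousLinearMap.id ℝ (V m)).prod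
        (jetCoord (baseSection hψ hπ) x))) (fun i => (frameAt (ψ x)).D₀ (u i)) := by
  refine (L.Ω₀_apply (ψ x) _).trans ?_
  refine congrArg Neg.neg ((altSum_cons_vertical _ g _).trans ?_)
  refine congrArg (fderiv ℝ (L.localMomentum (ψ x).base) (L.W₀Bundle.coord (ψ x).base (ψ x))
      (0, g)) (funext fun j => ?_)
  exact velocity_fst hψ hπ x (u j)

/-! ## The unified and the Lagrangian problem -/

lemma ContinuousAlternatingMap.comp_proj_comp_graph (β : V m [⋀^Fin m]→L[ℝ] ℝ)
    (v : V m →L[ℝ] V n) :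
    (β.compContinuousLinearMap (modelProj m n)).compContinuousLinearMap
      ((ContinuousLinearMap.id ℝ (V m)).prod v) = β := rfl

lemma coord_target (w : L.W₀) :
    (L.W₀Bundle.coord w.base w).1 ∈ (B.chartNear w.base).c.target :=
  (B.chartNear w.base).c.map_source (B.mem_chartNear w.base)

/-- The contraction of `Ω₀` with a vertical velocity. -/
lemma Ω₀_velocity {ψ : M → L.W₀} (hψ : ContMDiff 𝓘(ℝ, V m) 𝓘(ℝ, W₀Model m n) ∞ ψ)
    (hπ : ∀ x, B.proj (ψ x).base = x) (x : M) (η : V m →L[ℝ] V n) (u : Fin m → V m) :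
    L.Ω₀ (ψ x) (Fin.cons ((0, (η, 0)) : W₀Model m n)
      (fun i => mfderiv 𝓘(ℝ, V m) 𝓘(ℝ, W₀Model m n) ψ x (u i))) =
    -(L.localFibreDeriv (ψ x).base (B.jetBundle.coord (ψ x).base (L.ρ₁ (ψ x))) η •
        L.localVol (ψ x).base ((B.chartNear (ψ x).base).c (ψ x).base).1 -
      pairingDual m n (L.W₀Bundle.coord (ψ x).base (ψ x)).2.2 η)
        (fun i => (frameAt (ψ x)).D₀ (u i)) := by
  rw [L.Ω₀_vertical hψ hπ, L.fderiv_localMomentum_velocity (L.coord_target (ψ x)),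
    ContinuousAlternatingMap.comp_proj_comp_graph]
  have hz : (L.ρ₁ (ψ x)).base ∈ (B.chartNear (ψ x).base).c.source := B.mem_chartNear (ψ x).base
  have h : B.jetBundle.coord (ψ x).base (L.ρ₁ (ψ x)) =
      ((L.W₀Bundle.coord (ψ x).base (ψ x)).1, (L.W₀Bundle.coord (ψ x).base (ψ x)).2.1) := by
    rw [B.jetBundle.coord_of_mem hz, L.coord_W₀ hz]
    rfl
  rw [h]
  rfl

/-- The contraction of `Ω₀` with a variation of the momenta. -/
lemma Ω₀_momenta {ψ : M → L.W₀} (hψ : ContMDiff 𝓘(ℝ, V m) 𝓘(ℝ, W₀Model m n) ∞ ψ)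
    (hπ : ∀ x, B.proj (ψ x).base = x) (x : M) (q : DualModel m n) (u : Fin m → V m) :
    L.Ω₀ (ψ x) (Fin.cons ((0, (0, q)) : W₀Model m n)
      (fun i => mfderiv 𝓘(ℝ, V m) 𝓘(ℝ, W₀Model m n) ψ x (u i))) =
    -(pairing m n q.1 (jetCoord (baseSection hψ hπ) x -
      B.jetBundle.triv (ψ x).base (frameAt (ψ x)) (ψ x).fib.1.1))
        (fun i => (frameAt (ψ x)).D₀ (u i)) := by
  rw [L.Ω₀_vertical hψ hπ, L.fderiv_localMomentum_momenta (L.coord_target (ψ x)), map_sub,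
    ← dualModel_comp_graph q (jetCoord (baseSection hψ hπ) x),
    L.coord_W₀ (B.mem_chartNear (ψ x).base)]
  rfl

lemma eq_zero_of_frame {y : E} (a : B.AdaptedFrame y) {β : V m [⋀^Fin m]→L[ℝ] ℝ}
    (h : ∀ u : Fin m → V m, -β (fun i => a.D₀ (u i)) = 0) : β = 0 := by
  ext u
  have h1 := neg_eq_zero.1 (h fun i => a.D₀.symm (u i))
  refine Eq.trans (congrArg β (funext fun i => ?_)) h1
  exact (a.D₀.apply_symm_apply (u i)).symm

/-- A solution of the unified problem takes values in the graph of the Legendre map. -/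
lemma eq_liftW₀_of_unified {ψ : M → L.W₀} (hψ : ContMDiff 𝓘(ℝ, V m) 𝓘(ℝ, W₀Model m n) ∞ ψ)
    (hπ : ∀ x, B.proj (ψ x).base = x)
    (h : PointwiseFieldEquationOn (F := V m) L.Ω₀ ψ univ) (x : M) :
    ψ x = L.liftW₀ (L.ρ₁ (ψ x)) := by
  have hz : (L.ρ₁ (ψ x)).base ∈ (B.chartNear (ψ x).base).c.source := B.mem_chartNear (ψ x).base
  -- Testing with the velocity directions $\partial/\partial v^A_\nu$.
  have h1 : ∀ η, L.localFibreDeriv (ψ x).base (B.jetBundle.coord (ψ x).base (L.ρ₁ (ψ x))) η •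
        L.localVol (ψ x).base ((B.chartNear (ψ x).base).c (ψ x).base).1 -
      pairingDual m n (L.W₀Bundle.coord (ψ x).base (ψ x)).2.2 η = 0 := fun η =>
    eq_zero_of_frame (frameAt (ψ x)) fun u =>
      (L.Ω₀_velocity hψ hπ x η u).symm.trans (h x (mem_univ x) _ u)
  have h2 : (L.W₀Bundle.coord (ψ x).base (ψ x)).2.2 =
      L.localLegendre (ψ x).base (B.jetBundle.coord (ψ x).base (L.ρ₁ (ψ x))) := by
    rw [← momentaOfPairing_pairing (L.W₀Bundle.coord (ψ x).base (ψ x)).2.2]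
    unfold localLegendre
    congr 1
    ext1 η
    exact (sub_eq_zero.1 (h1 η)).symm
  have h3 : L.W₀Bundle.coord (ψ x).base (ψ x) =
      L.W₀Bundle.coord (ψ x).base (L.liftW₀ (L.ρ₁ (ψ x))) := by
    rw [L.coord_liftW₀ hz, ← h2, B.jetBundle.coord_of_mem hz, L.coord_W₀ hz]
    rfl
  exact (L.W₀Bundle.ofCoord_coord (B.mem_chartNear (ψ x).base)).symm.trans
    ((congrArg _ h3).trans
      (L.W₀Bundle.ofCoord_coord (e := (ψ x).base) (p := L.liftW₀ (L.ρ₁ (ψ x))) hz))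

/-- A solution of the unified problem is holonomic. -/
lemma holonomic_of_unified {ψ : M → L.W₀} (hψ : ContMDiff 𝓘(ℝ, V m) 𝓘(ℝ, W₀Model m n) ∞ ψ)
    (hπ : ∀ x, B.proj (ψ x).base = x)
    (h : PointwiseFieldEquationOn (F := V m) L.Ω₀ ψ univ) (x : M) :
    L.ρ₁ (ψ x) = j1 (baseSection hψ hπ) x := by
  -- Testing with the momentum directions $\partial/\partial p^\nu_A$.
  have h1 : ∀ q : DualModel m n, pairing m n q.1 (jetCoord (baseSection hψ hπ) x -
      B.jetBundle.triv (ψ x).base (frameAt (ψ x)) (ψ x).fib.1.1) = 0 := fun q =>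
    eq_zero_of_frame (frameAt (ψ x)) fun u =>
      (L.Ω₀_momenta hψ hπ x q u).symm.trans (h x (mem_univ x) _ u)
  have h2 := sub_eq_zero.1 (pairing_eq_zero_right (L.frameVol_ne_zero (frameAt (ψ x))) _ h1)
  have h3 : (j1 (baseSection hψ hπ) x).fib = (ψ x).fib.1.1 :=
    (B.jetBundle.triv (ψ x).base (frameAt (ψ x))).injective h2
  change (⟨(ψ x).base, (ψ x).fib.1.1⟩ : B.J1) = ⟨(ψ x).base, (j1 (baseSection hψ hπ) x).fib⟩
  rw [h3]

/-- $\Theta_{\mathcal L}$ is the form attached to the family of multimomenta given by the extended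
Legendre map, and for such forms the exterior derivative commutes with the pullback. -/
lemma ΩL_eq_pullback_extLegendre (z : B.J1) :
    L.ΩL z = (multisymplecticForm B).pullback L.extLegendre z :=
  B.jetBundle.neg_d_tautForm (fun z => (L.extLegendre z).fib) z
    (B.jetBundle.differentiableAt_symbol (fun z => (L.extLegendre z).fib) z
      L.contMDiff_extLegendre)
    ((L.contMDiff_extLegendre z).mdifferentiableAt (by simp))

lemma ΩL_apply (z : B.J1) (w : Fin (m + 1) → J1Model m n) :
    L.ΩL z w = multisymplecticForm B (L.extLegendre z)
      (fun i => mfderiv 𝓘(ℝ, J1Model m n) 𝓘(ℝ, ExtMomModel m n) L.extLegendre z (w i)) := by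
  rw [ΩL_eq_pullback_extLegendre]
  rfl

lemma mfderiv_extLegendre (z : B.J1) :
    mfderiv 𝓘(ℝ, J1Model m n) 𝓘(ℝ, ExtMomModel m n) L.extLegendre z =
      (mfderiv 𝓘(ℝ, W₀Model m n) 𝓘(ℝ, ExtMomModel m n) L.ρ₂ (L.liftW₀ z)).comp
        (mfderiv 𝓘(ℝ, J1Model m n) 𝓘(ℝ, W₀Model m n) L.liftW₀ z) :=
  (HasMFDerivAt.comp z
    ((L.contMDiff_ρ₂ (L.liftW₀ z)).mdifferentiableAt (by simp)).hasMFDerivAt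
    ((L.contMDiff_liftW₀ z).mdifferentiableAt (by simp)).hasMFDerivAt).mfderiv

/-- `Ω_L` is the pullback of `Ω₀` by the graph of the extended Legendre map. -/
lemma ΩL_eq_pullback_Ω₀ (z : B.J1) (w : Fin (m + 1) → J1Model m n) :
    L.ΩL z w = L.Ω₀ (L.liftW₀ z)
      (fun i => mfderiv 𝓘(ℝ, J1Model m n) 𝓘(ℝ, W₀Model m n) L.liftW₀ z (w i)) := by
  rw [ΩL_apply, mfderiv_extLegendre]
  rfl

/-- In coordinates $\rho_1^0$ forgets the momenta, and both charts have identity differential at the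
point. So the kernel consists of pure variations of the momenta. -/
lemma mfderiv_ρ₁_apply (w : L.W₀) (v : W₀Model m n) :
    mfderiv 𝓘(ℝ, W₀Model m n) 𝓘(ℝ, J1Model m n) L.ρ₁ w v = (v.1, v.2.1) := by
  have h1 := B.jetBundle.mfderiv_eq_mfderiv_coord ((L.contMDiff_ρ₁ w).mdifferentiableAt (by simp))
  let g : W₀Model m n →L[ℝ] J1Model m n := (ContinuousLinearMap.fst ℝ (V m × V n) _).prod
    ((ContinuousLinearMap.fst ℝ (V m →L[ℝ] V n) (DualModel m n)).comp
      (ContinuousLinearMap.snd ℝ (V m × V n) _))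
  have h2 := L.W₀Bundle.hasMFDerivAt_of_coord (p := w)
    (f := fun w' => B.jetBundle.coord (L.ρ₁ w).base (L.ρ₁ w')) (g := g) (g' := g)
    g.hasMFDerivAt (fun w' hw' => by
      have hz : (L.ρ₁ w').base ∈ (B.chartNear w.base).c.source := hw'
      rw [L.coord_W₀ hw']
      exact B.jetBundle.coord_of_mem hz)
  rw [h1, h2.mfderiv]
  rfl

lemma mfderiv_ρ₁_mfderiv_liftW₀ (z : B.J1) (v : J1Model m n) :
    mfderiv 𝓘(ℝ, W₀Model m n) 𝓘(ℝ, J1Model m n) L.ρ₁ (L.liftW₀ z)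
      (mfderiv 𝓘(ℝ, J1Model m n) 𝓘(ℝ, W₀Model m n) L.liftW₀ z v) = v := by
  have h := HasMFDerivAt.comp z
    ((L.contMDiff_ρ₁ (L.liftW₀ z)).mdifferentiableAt (by simp)).hasMFDerivAt
    ((L.contMDiff_liftW₀ z).mdifferentiableAt (by simp)).hasMFDerivAt
  exact DFunLike.congr_fun (hasMFDerivAt_unique h (hasMFDerivAt_id z)) v

lemma mfderiv_liftW₀_j1 (φ : B.Section) (x : M) (u : V m) :
    mfderiv 𝓘(ℝ, V m) 𝓘(ℝ, W₀Model m n) (fun x => L.liftW₀ (j1 φ x)) x u =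
      mfderiv 𝓘(ℝ, J1Model m n) 𝓘(ℝ, W₀Model m n) L.liftW₀ (j1 φ x)
        (mfderiv 𝓘(ℝ, V m) 𝓘(ℝ, J1Model m n) (j1 φ) x u) :=
  DFunLike.congr_fun (HasMFDerivAt.comp x
    ((L.contMDiff_liftW₀ (j1 φ x)).mdifferentiableAt (by simp)).hasMFDerivAt
    ((contMDiff_j1 φ x).mdifferentiableAt (by simp)).hasMFDerivAt).mfderiv u

lemma contMDiff_liftW₀_j1 (φ : B.Section) :
    ContMDiff 𝓘(ℝ, V m) 𝓘(ℝ, W₀Model m n) ∞ (fun x => L.liftW₀ (j1 φ x)) :=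
  L.contMDiff_liftW₀.comp (contMDiff_j1 φ)

lemma ΩL_cons (φ : B.Section) (x : M) (v : J1Model m n) (u : Fin m → V m) :
    L.ΩL (j1 φ x) (Fin.cons v
      (fun i => mfderiv 𝓘(ℝ, V m) 𝓘(ℝ, J1Model m n) (j1 φ) x (u i))) =
    L.Ω₀ (L.liftW₀ (j1 φ x)) (Fin.cons
      (mfderiv 𝓘(ℝ, J1Model m n) 𝓘(ℝ, W₀Model m n) L.liftW₀ (j1 φ x) v)
      (fun i => mfderiv 𝓘(ℝ, V m) 𝓘(ℝ, W₀Model m n) (fun x => L.liftW₀ (j1 φ x)) x (u i))) := by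
  refine (L.ΩL_eq_pullback_Ω₀ _ _).trans (congrArg (L.Ω₀ (L.liftW₀ (j1 φ x))) ?_)
  refine funext fun i => ?_
  induction i using Fin.cases with
  | zero => rfl
  | succ i => exact (L.mfderiv_liftW₀_j1 φ x (u i)).symm

/-- On the prolongation of a section, the unified and the Lagrangian equations agree. -/
lemma unified_iff_lagrangian (φ : B.Section) :
    PointwiseFieldEquationOn (F := V m) L.Ω₀ (fun x => L.liftW₀ (j1 φ x)) univ ↔
      PointwiseFieldEquationOn (F := V m) L.ΩL (j1 φ) univ := by
  constructor
  · intro h x hx v u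
    exact (L.ΩL_cons φ x v u).trans (h x hx _ u)
  · intro h x hx v u
    -- Since $\rho_1^0\circ$ `liftW₀` is the identity, `D ∘ R` projects onto the tangent space of
    -- the graph, and `v - D (R v)` lies in the kernel of `R`.
    let D := mfderiv 𝓘(ℝ, J1Model m n) 𝓘(ℝ, W₀Model m n) L.liftW₀ (j1 φ x)
    let R := mfderiv 𝓘(ℝ, W₀Model m n) 𝓘(ℝ, J1Model m n) L.ρ₁ (L.liftW₀ (j1 φ x))
    have h1 : R (v - D (R v)) = 0 := by
      rw [map_sub]
      exact sub_eq_zero.2 (L.mfderiv_ρ₁_mfderiv_liftW₀ (j1 φ x) (R v)).symm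
    let y : W₀Model m n := v - D (R v)
    have h2 : ((y.1, y.2.1) : J1Model m n) = 0 :=
      (L.mfderiv_ρ₁_apply (L.liftW₀ (j1 φ x)) y).symm.trans h1
    have h2' : y.1 = 0 ∧ y.2.1 = 0 := Prod.mk.inj h2
    let q : DualModel m n := y.2.2
    have hq : y = ((0, (0, q)) : W₀Model m n) := Prod.ext h2'.1 (Prod.ext h2'.2 rfl)
    let v' : W₀Model m n := v
    let d : W₀Model m n := D (R v)
    have h3 : v' = d + ((0, (0, q)) : W₀Model m n) := eq_add_of_sub_eq' hq
    have h4 := (L.Ω₀ (L.liftW₀ (j1 φ x))).toMultilinearMap.cons_add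
      (fun i => mfderiv 𝓘(ℝ, V m) 𝓘(ℝ, W₀Model m n) (fun x => L.liftW₀ (j1 φ x)) x (u i))
      (D (R v)) ((0, (0, q)) : W₀Model m n)
    refine (congrArg (fun w : W₀Model m n => L.Ω₀ (L.liftW₀ (j1 φ x)) (Fin.cons w
      (fun i => mfderiv 𝓘(ℝ, V m) 𝓘(ℝ, W₀Model m n) (fun x => L.liftW₀ (j1 φ x)) x (u i))))
      h3).trans ?_
    refine h4.trans ?_
    have h5 := (L.ΩL_cons φ x (R v) u).symm.trans (h x hx (R v) u)
    have h6 := L.Ω₀_momenta (L.contMDiff_liftW₀_j1 φ) (fun x => φ.proj_toFun x) x q u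
    -- The jet component of the lifted section is the jet of its own base section, so every
    -- variation of the momenta contracts to zero.
    have h7 : jetCoord (baseSection (L.contMDiff_liftW₀_j1 φ) (fun x => φ.proj_toFun x)) x -
      B.jetBundle.triv (L.liftW₀ (j1 φ x)).base (frameAt (L.liftW₀ (j1 φ x)))
        (L.liftW₀ (j1 φ x)).fib.1.1 = 0 := sub_self _
    rw [h7, map_zero] at h6
    refine (congrArg₂ (· + ·) h5 h6).trans ?_
    simp

end LagrangianSystem

namespace LagrangianSystem
variable (L : LagrangianSystem B)

/-! ## The Hamiltonian problem -/

/-- The extended Legendre map is constant along connected families of jets on which the Legendre map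
is constant. -/
lemma extLegendre_eq_of_legendre_eq {W : Type*} [NormedAddCommGroup W] [NormedSpace ℝ W]
    {S : Set W} (hS : IsOpen S) (hS' : IsPreconnected S) {γ : W → B.J1}
    (hγ : ContMDiffOn 𝓘(ℝ, W) 𝓘(ℝ, J1Model m n) ∞ γ S) {s₀ : W} (hs₀ : s₀ ∈ S)
    (hc : ∀ s ∈ S, L.legendre (γ s) = L.legendre (γ s₀)) {s : W} (hs : s ∈ S) :
    L.extLegendre (γ s) = L.extLegendre (γ s₀) := by
  let e := (γ s₀).base
  have he : ∀ s ∈ S, (γ s).base = e := fun s hs =>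
    congrArg (NaturalBundle.Total.base : B.J1Dual → E) (hc s hs)
  have hes : ∀ s ∈ S, (γ s).base ∈ (B.chartNear e).c.source := fun s hs => by
    rw [he s hs]; exact B.mem_chartNear e
  let z₀ := (B.chartNear e).c e
  have hz₀ : z₀ ∈ (B.chartNear e).c.target := (B.chartNear e).c.map_source (B.mem_chartNear e)
  let v : W → (V m →L[ℝ] V n) := fun s => (B.jetBundle.coord e (γ s)).2
  have hv1 : ∀ s ∈ S, B.jetBundle.coord e (γ s) = (z₀, v s) := fun s hs => by
    refine Prod.ext ?_ rfl
    change (B.chartNear e).c (γ s).base = _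
    rw [he s hs]
  have hv : DifferentiableOn ℝ v S := by
    have h := (B.jetBundle.contMDiffOn_coord e).comp hγ hes
    exact (contMDiffOn_iff_contDiffOn.1 h).snd.differentiableOn (by simp)
  -- The momenta do not change along `S`, so only the velocities `v s` move.
  let q : DualModel m n := L.localLegendre e (z₀, v s₀)
  have hq : ∀ s ∈ S, L.localLegendre e (z₀, v s) = q := by
    intro s hs
    have h := congrArg (fun p => (B.dualBundle.coord e p).2) (hc s hs)
    change (B.dualBundle.coord e (L.legendre (γ s))).2 =
      (B.dualBundle.coord e (L.legendre (γ s₀))).2 at h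
    rw [L.coord_legendre (hes s hs), L.coord_legendre (hes s₀ hs₀), hv1 s hs, hv1 s₀ hs₀] at h
    exact h
  let i : (V m →L[ℝ] V n) →L[ℝ] W₀Model m n := (ContinuousLinearMap.inr ℝ (V m × V n) _).comp
    (ContinuousLinearMap.inl ℝ (V m →L[ℝ] V n) (DualModel m n))
  let w : W → W₀Model m n := fun s => (z₀, (v s, q))
  -- The derivative along `S` is $(\partial\pounds/\partial v-q)\,dv$, which vanishes because `q`
  -- equals the Legendre momenta at every point of `S`.
  have hd : ∀ s ∈ S, HasFDerivAt (𝕜 := ℝ) (fun s => L.localMomentum e (w s)) 0 s := by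
    intro s hs
    have h1 : HasFDerivAt w (i.comp (fderiv ℝ v s)) s := by
      have h := i.hasFDerivAt.comp s ((hv s hs).differentiableAt (hS.mem_nhds hs)).hasFDerivAt
      have h' := h.const_add ((z₀, (0, q)) : W₀Model m n)
      refine h'.congr_of_eventuallyEq (Filter.Eventually.of_forall fun t => ?_)
      refine Prod.ext (add_zero _).symm (Prod.ext (zero_add _).symm (add_zero _).symm)
    have h2 := (L.hasFDerivAt_localMomentum (e := e) (z := w s) hz₀).comp s h1
    refine h2.congr_fderiv ?_
    ext1 t
    refine (L.fderiv_localMomentum_velocity (e := e) (z := w s) hz₀ (fderiv ℝ v s t)).trans ?_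
    have h3 := L.pairing_localLegendre (hes s hs) (fderiv ℝ v s t)
    rw [hv1 s hs, hq s hs] at h3
    have h4 : L.localFibreDeriv e ((w s).1, (w s).2.1) (fderiv ℝ v s t) • L.localVol e (w s).1.1 -
      pairingDual m n (w s).2.2 (fderiv ℝ v s t) = 0 := sub_eq_zero.2 h3.symm
    rw [h4]
    rfl
  have hconst := hS.is_const_of_fderiv_eq_zero hS'
    (fun s hs => (hd s hs).differentiableAt.differentiableWithinAt)
    (fun s hs => (hd s hs).fderiv) hs hs₀
  have hm : ∀ s ∈ S, MomentumModel.incl m n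
      (B.momentumBundle.coord e (L.extLegendre (γ s))).2 = L.localMomentum e (w s) := by
    intro s hs
    have h1 : (L.liftW₀ (γ s)).base ∈ (B.chartNear e).c.source := hes s hs
    refine (L.coord_ρ₂ h1).trans ?_
    rw [L.coord_liftW₀ (hes s hs), hv1 s hs, hq s hs]
  have h1 : (B.momentumBundle.coord e (L.extLegendre (γ s))).2 =
      (B.momentumBundle.coord e (L.extLegendre (γ s₀))).2 := by
    rw [← momentumRetraction_incl (B.momentumBundle.coord e (L.extLegendre (γ s))).2,
      hm s hs, hconst, ← hm s₀ hs₀, momentumRetraction_incl]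
  have h2 : B.momentumBundle.coord e (L.extLegendre (γ s)) =
      B.momentumBundle.coord e (L.extLegendre (γ s₀)) :=
    Prod.ext (congrArg (B.chartNear e).c (he s hs)) h1
  have h3 : (L.extLegendre (γ s)).base ∈ (B.chartNear e).c.source := hes s hs
  have h4 : (L.extLegendre (γ s₀)).base ∈ (B.chartNear e).c.source := hes s₀ hs₀
  rw [← B.momentumBundle.ofCoord_coord h3, h2, B.momentumBundle.ofCoord_coord h4]

/-- If `h` is locally the composition of the extended Legendre map with a section of `ℱ`, then
solutions of the Lagrangian equation are mapped by `ℱ` to solutions of the equation of `h^* Ω`. -/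
lemma hamilton_of_lagrangian {F' : Type*} [NormedAddCommGroup F'] [NormedSpace ℝ F']
    {Y : Type*} [TopologicalSpace Y] [ChartedSpace F' Y] {φ : B.Section} {x : M}
    (hL : ∀ (v : J1Model m n) (u : Fin m → V m), L.ΩL (j1 φ x) (Fin.cons v
      (fun i => mfderiv 𝓘(ℝ, V m) 𝓘(ℝ, J1Model m n) (j1 φ) x (u i))) = 0)
    {f : B.J1 → Y} {s : Y → B.J1} {h : Y → B.ExtMom}
    (hf : MDifferentiableAt 𝓘(ℝ, J1Model m n) 𝓘(ℝ, F') f (j1 φ x))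
    (hs : MDifferentiableAt 𝓘(ℝ, F') 𝓘(ℝ, J1Model m n) s (f (j1 φ x)))
    (hsf : s (f (j1 φ x)) = j1 φ x)
    (hh : h =ᶠ[𝓝 (f (j1 φ x))] fun y => L.extLegendre (s y))
    (hhf : (fun z => h (f z)) =ᶠ[𝓝 (j1 φ x)] L.extLegendre)
    (v : F') (u : Fin m → V m) :
    (multisymplecticForm B).pullback h (f (j1 φ x)) (Fin.cons v
      (fun i => mfderiv 𝓘(ℝ, V m) 𝓘(ℝ, F') (fun x => f (j1 φ x)) x (u i))) = 0 := by
  set z := j1 φ x with hz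
  have hext := ((L.contMDiff_extLegendre z).mdifferentiableAt (by simp)).hasMFDerivAt
  let S : F' →L[ℝ] J1Model m n := mfderiv 𝓘(ℝ, F') 𝓘(ℝ, J1Model m n) s (f z)
  let A : J1Model m n →L[ℝ] ExtMomModel m n :=
    mfderiv 𝓘(ℝ, J1Model m n) 𝓘(ℝ, ExtMomModel m n) L.extLegendre z
  let T : J1Model m n →L[ℝ] F' := mfderiv 𝓘(ℝ, J1Model m n) 𝓘(ℝ, F') f z
  let J : V m →L[ℝ] J1Model m n := mfderiv 𝓘(ℝ, V m) 𝓘(ℝ, J1Model m n) (j1 φ) x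
  have hA : HasMFDerivAt 𝓘(ℝ, J1Model m n) 𝓘(ℝ, ExtMomModel m n) L.extLegendre (s (f z)) A := by
    rw [hsf]; exact hext
  have h1 : HasMFDerivAt 𝓘(ℝ, F') 𝓘(ℝ, ExtMomModel m n) h (f z) (A.comp S) :=
    (HasMFDerivAt.comp (f z) hA hs.hasMFDerivAt).congr_of_eventuallyEq hh
  have h2 : HasMFDerivAt 𝓘(ℝ, J1Model m n) 𝓘(ℝ, ExtMomModel m n) L.extLegendre z
      ((A.comp S).comp T) :=
    (HasMFDerivAt.comp z h1 hf.hasMFDerivAt).congr_of_eventuallyEq hhf.symm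
  -- Differentiating `h ∘ f = F̃L`: although $S\circ T$ need not be the identity, `A` does not see
  -- the difference.
  have h3 : (A.comp S).comp T = A := hasMFDerivAt_unique h2 hext
  have h4 : mfderiv 𝓘(ℝ, V m) 𝓘(ℝ, F') (fun x => f (j1 φ x)) x = T.comp J :=
    (HasMFDerivAt.comp x hf.hasMFDerivAt
      ((contMDiff_j1 φ x).mdifferentiableAt (by simp)).hasMFDerivAt).mfderiv
  have h5 : h (f z) = L.extLegendre z := hhf.eq_of_nhds
  -- The Lagrangian equation is tested on the lift `S v` of the vector `v`.
  have h6 := (L.ΩL_apply z _).symm.trans (hL (S v) u)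
  have key : ∀ p : B.ExtMom, p = L.extLegendre z → ∀ w : Fin (m + 1) → ExtMomModel m n,
      multisymplecticForm B p w = multisymplecticForm B (L.extLegendre z) w := by
    rintro _ rfl w; rfl
  refine Eq.trans ?_ h6
  refine (key _ h5 _).trans (congrArg (multisymplecticForm B (L.extLegendre z)) (funext fun i => ?_))
  rw [h1.mfderiv]
  induction i using Fin.cases with
  | zero => rfl
  | succ i =>
    refine Eq.trans ?_ (DFunLike.congr_fun h3 (J (u i)))
    exact congrArg (A.comp S) (DFunLike.congr_fun h4 (u i))

variable {L}

/-- The chosen preimage and `z` lie in one fibre of $\mathcal{FL}$. In submersion coordinates nearby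
points of a fibre are joined within a ball, on which $\widetilde{\mathcal{FL}}$ is constant;
connectedness makes it constant on the whole fibre. -/
lemma hamiltonSectionOnImage_legendreOnto {d : ℕ} [ChartedSpace (V d) (range L.legendre)]
    [IsManifold 𝓘(ℝ, V d) ∞ (range L.legendre)] (hd : L.IsAlmostRegular d) (z : B.J1) :
    L.hamiltonSectionOnImage (L.legendreOnto z) = L.extLegendre z := by
  have hloc : ∀ z₀ : B.J1, ∀ᶠ z in 𝓝 z₀, L.legendre z = L.legendre z₀ →
      L.extLegendre z = L.extLegendre z₀ := by
    intro z₀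
    obtain ⟨F, _, _, hF⟩ := hd.isSubmersion
    obtain ⟨Γ, k, s₀, r, hr, hk, -, hΓ, hsm, hfΓ, hnear⟩ := exists_localProjection (hF z₀)
    filter_upwards [hnear] with z hz heq
    obtain ⟨s, hs, hzs⟩ := hz
    have hon : L.legendreOnto z = L.legendreOnto z₀ := Subtype.ext heq
    -- Now `z` and `z₀` lie on the same slice of the local projection, parametrised by a ball.
    rw [hon] at hzs
    have hmaps : ∀ t ∈ Metric.ball s₀ r, (k (L.legendreOnto z₀), t) ∈
        Metric.ball (k (L.legendreOnto z₀)) r ×ˢ Metric.ball s₀ r := fun t ht =>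
      ⟨Metric.mem_ball_self hr, ht⟩
    have hc : ∀ t ∈ Metric.ball s₀ r, L.legendre (Γ (k (L.legendreOnto z₀), t)) =
        L.legendre z₀ := by
      intro t ht
      obtain ⟨h1, h2⟩ := hfΓ _ (hmaps t ht)
      exact congrArg Subtype.val (k.injOn h1 hk h2)
    have hγ : ContMDiffOn 𝓘(ℝ, F) 𝓘(ℝ, J1Model m n) ∞
        (fun t => Γ (k (L.legendreOnto z₀), t)) (Metric.ball s₀ r) :=
      hsm.comp (contDiff_const.prodMk contDiff_id).contMDiff.contMDiffOn hmaps
    have h := L.extLegendre_eq_of_legendre_eq Metric.isOpen_ball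
      (convex_ball s₀ r).isPreconnected hγ (Metric.mem_ball_self hr)
      (fun t ht => (hc t ht).trans (hc s₀ (Metric.mem_ball_self hr)).symm) hs
    rwa [← hzs, hΓ] at h
  have hP : PreconnectedSpace (L.legendre ⁻¹' {L.legendre z}) :=
    Subtype.preconnectedSpace (hd.isConnected_fibre z).isPreconnected
  have hlc : IsLocallyConstant (fun w : L.legendre ⁻¹' {L.legendre z} => L.extLegendre w.1) := by
    rw [IsLocallyConstant.iff_eventually_eq]
    intro w
    filter_upwards [continuous_subtype_val.continuousAt.eventually (hloc w.1)] with w' hw'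
    have h1 : L.legendre w'.1 = L.legendre z := w'.2
    have h2 : L.legendre w.1 = L.legendre z := w.2
    exact hw' (h1.trans h2.symm)
  exact hlc.apply_eq_of_preconnectedSpace ⟨_, (L.legendreOnto z).2.choose_spec⟩ ⟨z, rfl⟩

/-- On its target the inverse of `Φ` is a smooth section of $\mathcal{FL}$, through which the
Hamiltonian section factors by definition. -/
lemma regular_of_lagrangian {φ : B.Section}
    (hL : PointwiseFieldEquationOn (F := V m) L.ΩL (j1 φ) univ)
    (Φ : PartialDiffeomorph 𝓘(ℝ, J1Model m n) 𝓘(ℝ, J1DualModel m n) B.J1 B.J1Dual ∞)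
    (hΦ : ∀ z ∈ Φ.source, Φ z = L.legendre z) :
    PointwiseFieldEquationOn (F := V m) (hamiltonForm fun q => L.extLegendre (Φ.symm q))
      (fun x => L.legendre (j1 φ x)) {x | j1 φ x ∈ Φ.source} := by
  intro x hx v u
  have hx' : j1 φ x ∈ Φ.source := hx
  have ht : L.legendre (j1 φ x) ∈ Φ.target := by
    rw [← hΦ _ hx']; exact Φ.toPartialEquiv.map_source hx'
  have hinv : ∀ z ∈ Φ.source, Φ.symm (L.legendre z) = z := fun z hz => by
    rw [← hΦ z hz]; exact Φ.toPartialEquiv.left_inv hz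
  refine L.hamilton_of_lagrangian (f := L.legendre) (s := Φ.symm) (hL x (mem_univ x))
    ((L.contMDiff_legendre _).mdifferentiableAt (by simp))
    (((Φ.contMDiffOn_invFun).contMDiffAt (Φ.open_target.mem_nhds ht)).mdifferentiableAt (by simp))
    (hinv _ hx') (Filter.EventuallyEq.refl _ _) ?_ v u
  filter_upwards [Φ.open_source.mem_nhds hx'] with z hz
  rw [hinv z hz]

/-- Freezing the complementary coordinate at `s₀` in submersion coordinates gives a smooth local
section of $\mathcal{FL}$ onto $P$ through `j1 φ x`; $h_P$ is $\widetilde{\mathcal{FL}}$ composed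
with it. -/
lemma almostRegular_of_lagrangian {φ : B.Section}
    (hL : PointwiseFieldEquationOn (F := V m) L.ΩL (j1 φ) univ)
    {d : ℕ} [ChartedSpace (V d) (range L.legendre)]
    [IsManifold 𝓘(ℝ, V d) ∞ (range L.legendre)] (hd : L.IsAlmostRegular d) :
    PointwiseFieldEquationOn (F := V m) (F' := V d)
      ((multisymplecticForm B).pullback L.hamiltonSectionOnImage)
      (fun x => L.legendreOnto (j1 φ x)) univ := by
  intro x hx v u
  obtain ⟨F, _, _, hF⟩ := hd.isSubmersion
  obtain ⟨Γ, k, s₀, r, hr, hk, hks, hΓ, hsm, hfΓ, -⟩ := exists_localProjection (hF (j1 φ x))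
  have hk' : ContMDiffAt 𝓘(ℝ, V d) 𝓘(ℝ, V d) ∞ k (L.legendreOnto (j1 φ x)) :=
    hks.contMDiffAt (k.open_source.mem_nhds hk)
  have hball : Metric.ball (k (L.legendreOnto (j1 φ x))) r ×ˢ Metric.ball s₀ r ∈
      𝓝 (k (L.legendreOnto (j1 φ x)), s₀) :=
    prod_mem_nhds (Metric.ball_mem_nhds _ hr) (Metric.ball_mem_nhds _ hr)
  have hpair : ContMDiffAt 𝓘(ℝ, V d) 𝓘(ℝ, V d × F) ∞ (fun y => (k y, s₀))
      (L.legendreOnto (j1 φ x)) := hk'.prodMk_space contMDiffAt_const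
  have hs : ContMDiffAt 𝓘(ℝ, V d) 𝓘(ℝ, J1Model m n) ∞ (fun y => Γ (k y, s₀))
      (L.legendreOnto (j1 φ x)) :=
    ContMDiffAt.comp (g := Γ) _ (hsm.contMDiffAt hball) hpair
  refine L.hamilton_of_lagrangian (f := L.legendreOnto) (s := fun y => Γ (k y, s₀))
    (hL x (mem_univ x)) ((hd.isSubmersion.contMDiff _).mdifferentiableAt (by simp))
    (hs.mdifferentiableAt (by simp)) hΓ ?_
    (Filter.Eventually.of_forall (hamiltonSectionOnImage_legendreOnto hd)) v u
  filter_upwards [k.open_source.mem_nhds hk,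
    hk'.continuousAt.preimage_mem_nhds (Metric.ball_mem_nhds _ hr)] with y hy hy'
  obtain ⟨h1, h2⟩ := hfΓ (k y, s₀) ⟨hy', Metric.mem_ball_self hr⟩
  rw [← hamiltonSectionOnImage_legendreOnto hd, k.injOn h1 hy h2]

/-- Solutions of the Lagrangian problem induce solutions of the Hamiltonian problem. -/
lemma solvesHamiltonian {φ : B.Section}
    (hL : PointwiseFieldEquationOn (F := V m) L.ΩL (j1 φ) univ) : L.SolvesHamiltonian φ where
  smooth := L.contMDiff_legendre.comp (contMDiff_j1 φ)
  proj_eq := φ.proj_toFun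
  hyperRegular Φ hΦ Z hZ x _ :=
    -- A global diffeomorphism is a partial one with full source, so this is an instance of the
    -- regular case.
    (regular_of_lagrangian hL Φ.toPartialDiffeomorph fun z _ => hΦ z).fieldEquationOn Z hZ x
      (mem_univ (j1 φ x))
  regular Φ hΦ := (regular_of_lagrangian hL Φ hΦ).fieldEquationOn
  almostRegular _ _ _ hd := ⟨hd.isSubmersion.contMDiff.comp (contMDiff_j1 φ),
    (almostRegular_of_lagrangian hL hd).fieldEquationOn⟩

end LagrangianSystem

end Lagrangian

end FieldTheory

end

/-! ### Equivalence of the unified, Lagrangian and Hamiltonian problems -/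

theorem mainTheorem4 {m n : ℕ} {E M : Type*}
    [TopologicalSpace E] [T2Space E] [ChartedSpace (FieldTheory.V (m + n)) E]
    [IsManifold 𝓘(ℝ, FieldTheory.V (m + n)) ∞ E]
    [TopologicalSpace M] [ChartedSpace (FieldTheory.V m) M]
    [IsManifold 𝓘(ℝ, FieldTheory.V m) ∞ M]
    (B : FieldTheory.ConfigurationBundle m n E M) (L : FieldTheory.LagrangianSystem B) :
    (∀ ψ₀ : L.W₀Section, L.SolvesUnified ψ₀ →
      ∃ φ : B.Section,
        (∀ x, φ.toFun x = (ψ₀.toFun x).base) ∧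
        (∀ x, L.ρ₁ (ψ₀.toFun x) = FieldTheory.j1 φ x) ∧
        (∀ x, L.ρ₂ (ψ₀.toFun x) = L.extLegendre (FieldTheory.j1 φ x)) ∧
        L.SolvesLagrangian φ ∧
        L.SolvesHamiltonian φ) ∧
    (∀ φ : B.Section, L.SolvesLagrangian φ →
      L.SolvesHamiltonian φ ∧
      ∃ ψ₀ : L.W₀Section,
        (∀ x, L.ρ₁ (ψ₀.toFun x) = FieldTheory.j1 φ x) ∧
        (∀ x, L.ρ₂ (ψ₀.toFun x) = L.extLegendre (FieldTheory.j1 φ x)) ∧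
        L.SolvesUnified ψ₀) := by
  constructor
  · intro ψ₀ h
    have hp := FieldTheory.fieldEquationOn_iff.1 h
    have hhol := L.holonomic_of_unified ψ₀.smooth ψ₀.proj_toFun hp
    -- Membership in the graph and holonomy together identify $\psi_0$ with the lift of the jet of
    -- its base section.
    have hlift : ψ₀.toFun = fun x => L.liftW₀ (FieldTheory.j1
        (FieldTheory.NaturalBundle.baseSection ψ₀.smooth ψ₀.proj_toFun) x) := funext fun x =>
      (L.eq_liftW₀_of_unified ψ₀.smooth ψ₀.proj_toFun hp x).trans (congrArg L.liftW₀ (hhol x))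
    have hlag := (L.unified_iff_lagrangian
      (FieldTheory.NaturalBundle.baseSection ψ₀.smooth ψ₀.proj_toFun)).1 (hlift ▸ hp)
    exact ⟨_, fun x => rfl, hhol, fun x => congrArg L.ρ₂ (congrFun hlift x),
      hlag.fieldEquationOn, FieldTheory.LagrangianSystem.solvesHamiltonian hlag⟩
  · intro φ h
    have hp := FieldTheory.fieldEquationOn_iff.1 h
    exact ⟨FieldTheory.LagrangianSystem.solvesHamiltonian hp,
      ⟨fun x => L.liftW₀ (FieldTheory.j1 φ x), L.contMDiff_liftW₀_j1 φ, φ.proj_toFun⟩,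
      fun x => rfl, fun x => rfl, ((L.unified_iff_lagrangian φ).2 hp).fieldEquationOn⟩
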